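/- Let $\mathfrak{h}$ be a Cartan subalgebra of $\mathfrak{sl}_3$ with simple coroots $H_1,H_2$, simple roots $\alpha_1,\alpha_2$, $\alpha_3=\alpha_1+\alpha_2$, Weyl vector $\rho$, Cartan matrix $A$, and let $\langle\cdot,\cdot\rangle$ be the form on $\mathfrak{h}^*$ with $\langle\alpha_i,\alpha_j\rangle=A_{ij}$. Write $\mathbf{i}^z=e^{\pi \mathbf{i} z/2}$ and let $L$ be a lattice between the root lattice and the weight lattice. Let $U=\overline{\mathcal U}{}^H_{\mathbf{i}}(\mathfrak{sl}_3)$ be the unrolled restricted quantum group at a fourth root of unity: the complex algebra generated by $X_{\pm j},H_j$ ($j=1,2$) and $K_\gamma$ ($\gamma\in L$) with relations $$K_0=1,\quad K_\gamma K_\delta=K_{\gamma+\delta},\quad K_\gamma X_{\pm j}K_{-\gamma}=\mathbf{i}^{\pm\langle\gamma,\alpha_j\rangle}X_{\pm j},\quad [X_j,X_{-k}]=\delta_{jk}\frac{K_{\alpha_j}-K_{-\alpha_j}}{2\mathbf{i}},$$ $$X_{\pm j}^2=0,\quad (X_{\pm1}X_{\pm2})^2=(X_{\pm2}X_{\pm1})^2,\quad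 [H_j,X_{\pm k}]=\pm A_{jk}X_{\pm k},\quad [H_j,H_k]=[H_j,K_\gamma]=0.$$ Tensor products of $U$-modules are taken over $\mathbb{C}$ with $U$ acting through the coproduct $\Delta(K_\gamma)=K_\gamma\otimes K_\gamma$, $\Delta(X_j)=X_j\otimes K_{\alpha_j}+1\otimes X_j$, $\Delta(X_{-j})=X_{-j}\otimes1+K_{\alpha_j}^{-1}\otimes X_{-j}$, $\Delta(H_j)=H_j\otimes1+1\otimes H_j$. Let $\mathscr C$ be the category of finite-dimensional weight $U$-modules: those that are the direct sum of their simultaneous $(H_1,H_2)$-eigenspaces $V(\lambda)$, $\lambda\in\mathfrak{h}^*$, and on which each $K_\gamma$ acts on $V(\lambda)$ as $\mathbf{i}^{\langle\gamma,\lambda\rangle}$. For $\lambda\in\mathfrak{h}^*$ let $L_\lambda$ be the irreducible quotient of the Verma module of highest weight $\lambda$, and let $P_\lambda$ be the projective cover of $L_\lambda$ in $\mathscr C$; a superscript $(d)$ on either records that its dimension is $d$. Put $\lambda_k=\langle\lambda+\rho,\alpha_k\rangle$ for $k=1,2,3$, and call $\lambda$ typical if $\lambda_1,\lambda_2,\lambda_3\notin2\mathbb{Z}+1$.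 **Proposition.** Let $\lambda\in\mathfrak{h}^*$ satisfy $\lambda_1,\lambda_2\notin\mathbb{Z}$ and $\lambda_3\in2\mathbb{Z}+1$, and let $\mu\in\mathfrak{h}^*$ be typical. Then $\dim L_\lambda=4$, $\dim L_\mu=8$, one of the following five cases applies for some $i,j$ with $\{i,j\}=\{1,2\}$, and, for every such $i,j$, $L^{(4)}_\lambda\otimes L^{(8)}_\mu$ is isomorphic to 1. $P^{(8)}_{\lambda+\mu-\alpha_j}\oplus P^{(24)}_{\lambda+\mu-\alpha_3}$ if $\lambda_i+\mu_i,\mu_3\in2\mathbb{Z}$ and $\lambda_j+\mu_j\in2\mathbb{Z}+1$; 2. $P^{(8)}_{\lambda+\mu-\alpha_1}\oplus P^{(8)}_{\lambda+\mu-\alpha_2}\oplus P^{(16)}_{\lambda+\mu-\alpha_3}$ if $\mu_3\in2\mathbb{Z}$ and $\lambda_1+\mu_1,\lambda_2+\mu_2\notin\mathbb{Z}$; 3. $P^{(16)}_{\lambda+\mu-\alpha_i}\oplus P^{(8)}_{\lambda+\mu-\alpha_j}\oplus P^{(8)}_{\lambda+\mu-\alpha_3}$ if $\lambda_i+\mu_i\in2\mathbb{Z}$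 and $\lambda_j+\mu_j,\mu_3\notin\mathbb{Z}$; 4. $P^{(8)}_{\lambda+\mu}\oplus P^{(8)}_{\lambda+\mu-\alpha_i}\oplus P^{(16)}_{\lambda+\mu-\alpha_3}$ if $\lambda_i+\mu_i\in2\mathbb{Z}+1$ and $\lambda_j+\mu_j,\mu_3\notin\mathbb{Z}$; 5. $P^{(8)}_{\lambda+\mu}\oplus P^{(8)}_{\lambda+\mu-\alpha_1}\oplus P^{(8)}_{\lambda+\mu-\alpha_2}\oplus P^{(8)}_{\lambda+\mu-\alpha_3}$ if $\lambda_1+\mu_1,\lambda_2+\mu_2,\mu_3\notin\mathbb{Z}$. -/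

import Mathlib

open scoped TensorProduct

namespace UnrolledSL3

/-! ### Weights of `𝔰𝔩₃` -/

/-- The dual `𝔥*` of the Cartan subalgebra of `𝔰𝔩₃`; `w j` is the value of the weight `w` on the
`j`-th simple coroot `H_{j+1}`. -/
abbrev Wt : Type := Fin 2 → ℂ

/-- The Cartan matrix of `𝔰𝔩₃`. -/
def cartan : Matrix (Fin 2) (Fin 2) ℤ := !![2, -1; -1, 2]

/-- The simple roots `α₁, α₂` (indexed from `0`). -/
def simpleRoot (j : Fin 2) : Wt := fun k => (cartan k j : ℂ)

/-- The positive roots `α₁, α₂, α₃ = α₁ + α₂` (indexed from `0`). -/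
def root : Fin 3 → Wt := ![simpleRoot 0, simpleRoot 1, simpleRoot 0 + simpleRoot 1]

/-- The bilinear form on `𝔥*`, normalised so that roots have squared length `2`. In the basis of
fundamental weights its Gram matrix is the inverse of the Cartan matrix. -/
noncomputable def form (v w : Wt) : ℂ :=
  (2 * v 0 * w 0 + v 0 * w 1 + v 1 * w 0 + 2 * v 1 * w 1) / 3

theorem form_simpleRoot (v : Wt) (j : Fin 2) : form v (simpleRoot j) = v j := by
  fin_cases j <;> simp [form, simpleRoot, cartan] <;> ring

theorem form_simpleRoot_simpleRoot (j k : Fin 2) :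
    form (simpleRoot j) (simpleRoot k) = (cartan j k : ℂ) := by
  rw [form_simpleRoot]
  fin_cases j <;> fin_cases k <;> simp [simpleRoot, cartan]

/-- The Weyl vector. -/
def weylVector : Wt := fun _ => 1

/-- The index `w_k = ⟨w + ρ, α_k⟩`, for `k = 1, 2, 3` (indexed from `0`). -/
noncomputable def index (w : Wt) (k : Fin 3) : ℂ := form (w + weylVector) (root k)

/-- `z ∈ ℤ`. -/
def IsInt (z : ℂ) : Prop := ∃ n : ℤ, z = n

/-- `z ∈ 2ℤ`. -/
def IsEven (z : ℂ) : Prop := ∃ n : ℤ, z = 2 * n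

/-- `z ∈ 2ℤ + 1`. -/
def IsOdd (z : ℂ) : Prop := ∃ n : ℤ, z = 2 * n + 1

/-- A weight is typical if none of its three indices is an odd integer. -/
def IsTypical (w : Wt) : Prop := ∀ k : Fin 3, ¬ IsOdd (index w k)

/-- A lattice between the root lattice and the weight lattice. -/
structure QPLattice where
  /-- the underlying group -/
  carrier : AddSubgroup Wt
  simpleRoot_mem : ∀ j : Fin 2, simpleRoot j ∈ carrier
  le_weightLattice : ∀ γ ∈ carrier, ∀ j : Fin 2, IsInt (γ j)

/-- `𝐢 ^ z = exp (π 𝐢 z / 2)`. -/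
noncomputable def iPow (z : ℂ) : ℂ := Complex.exp (Real.pi * Complex.I * z / 2)

theorem iPow_zero : iPow 0 = 1 := by simp [iPow]

theorem iPow_add (y z : ℂ) : iPow (y + z) = iPow y * iPow z := by
  rw [iPow, iPow, iPow, ← Complex.exp_add]; congr 1; ring

theorem iPow_one : iPow 1 = Complex.I := by
  rw [iPow, mul_one, mul_div_right_comm, Complex.exp_pi_div_two_mul_I]

theorem iPow_neg (z : ℂ) : iPow (-z) = (iPow z)⁻¹ := by
  rw [iPow, iPow, ← Complex.exp_neg]; congr 1; ring

theorem iPow_two : iPow 2 = -1 := by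
  rw [← one_add_one_eq_two, iPow_add, iPow_one, Complex.I_mul_I]

/-! ### The unrolled restricted quantum group of `𝔰𝔩₃` at `q = 𝐢` -/

/-- Generators: `X j` is `X_{j+1}`, `Y j` is `X_{-(j+1)}`, `H j` is `H_{j+1}`. -/
inductive Gen (L : QPLattice) : Type
  | X (j : Fin 2) : Gen L
  | Y (j : Fin 2) : Gen L
  | H (j : Fin 2) : Gen L
  | K (γ : L.carrier) : Gen L

/-- The simple root `α_{j+1}` as an element of the lattice. -/
def QPLattice.sr (L : QPLattice) (j : Fin 2) : L.carrier := ⟨simpleRoot j, L.simpleRoot_mem j⟩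

namespace Free

/-- The free generators. -/
def X (L : QPLattice) (j : Fin 2) : FreeAlgebra ℂ (Gen L) := FreeAlgebra.ι ℂ (Gen.X j)
/-- The free generators. -/
def Y (L : QPLattice) (j : Fin 2) : FreeAlgebra ℂ (Gen L) := FreeAlgebra.ι ℂ (Gen.Y j)
/-- The free generators. -/
def H (L : QPLattice) (j : Fin 2) : FreeAlgebra ℂ (Gen L) := FreeAlgebra.ι ℂ (Gen.H j)
/-- The free generators. -/
def K (L : QPLattice) (γ : L.carrier) : FreeAlgebra ℂ (Gen L) := FreeAlgebra.ι ℂ (Gen.K γ)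

end Free

open Free in
/-- The defining relations. -/
inductive Rel (L : QPLattice) : FreeAlgebra ℂ (Gen L) → FreeAlgebra ℂ (Gen L) → Prop
  | K_zero : Rel L (K L 0) 1
  | K_add (γ δ : L.carrier) : Rel L (K L γ * K L δ) (K L (γ + δ))
  | K_X (γ : L.carrier) (j : Fin 2) :
      Rel L (K L γ * X L j * K L (-γ)) (iPow (form γ (simpleRoot j)) • X L j)
  | K_Y (γ : L.carrier) (j : Fin 2) :
      Rel L (K L γ * Y L j * K L (-γ)) (iPow (-form γ (simpleRoot j)) • Y L j)
  | X_Y (j : Fin 2) :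
      Rel L (X L j * Y L j - Y L j * X L j)
        ((2 * Complex.I)⁻¹ • (K L (L.sr j) - K L (-L.sr j)))
  | X_Y_of_ne (j k : Fin 2) (h : j ≠ k) : Rel L (X L j * Y L k - Y L k * X L j) 0
  | X_sq (j : Fin 2) : Rel L (X L j ^ 2) 0
  | Y_sq (j : Fin 2) : Rel L (Y L j ^ 2) 0
  | X_braid : Rel L ((X L 0 * X L 1) ^ 2) ((X L 1 * X L 0) ^ 2)
  | Y_braid : Rel L ((Y L 0 * Y L 1) ^ 2) ((Y L 1 * Y L 0) ^ 2)
  | H_X (j k : Fin 2) : Rel L (H L j * X L k - X L k * H L j) ((cartan j k : ℂ) • X L k)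
  | H_Y (j k : Fin 2) : Rel L (H L j * Y L k - Y L k * H L j) (-(cartan j k : ℂ) • Y L k)
  | H_H (j k : Fin 2) : Rel L (H L j * H L k - H L k * H L j) 0
  | H_K (j : Fin 2) (γ : L.carrier) : Rel L (H L j * K L γ - K L γ * H L j) 0

/-- The unrolled restricted quantum group of `𝔰𝔩₃` at a fourth root of unity, as a complex
associative algebra. -/
def U (L : QPLattice) : Type := RingQuot (Rel L)

noncomputable instance (L : QPLattice) : Ring (U L) := inferInstanceAs (Ring (RingQuot (Rel L)))

noncomputable instance (L : QPLattice) : Algebra ℂ (U L) :=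
  inferInstanceAs (Algebra ℂ (RingQuot (Rel L)))

namespace U

variable {L : QPLattice}

/-- The quotient map from the free algebra. -/
noncomputable def mk (L : QPLattice) : FreeAlgebra ℂ (Gen L) →ₐ[ℂ] U L :=
  RingQuot.mkAlgHom ℂ (Rel L)

/-- The generator `X_{j+1}`. -/
noncomputable def X (j : Fin 2) : U L := mk L (Free.X L j)
/-- The generator `X_{-(j+1)}`. -/
noncomputable def Y (j : Fin 2) : U L := mk L (Free.Y L j)
/-- The generator `H_{j+1}`. -/
noncomputable def H (j : Fin 2) : U L := mk L (Free.H L j)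
/-- The generator `K_γ`. -/
noncomputable def K (γ : L.carrier) : U L := mk L (Free.K L γ)

theorem mk_rel {a b : FreeAlgebra ℂ (Gen L)} (h : Rel L a b) : mk L a = mk L b :=
  RingQuot.mkAlgHom_rel ℂ h

theorem K_zero : K (0 : L.carrier) = 1 := by
  simpa [K] using mk_rel (Rel.K_zero (L := L))

theorem K_mul (γ δ : L.carrier) : K γ * K δ = K (γ + δ) := by
  simpa [K] using mk_rel (Rel.K_add γ δ)

theorem K_conj_X (γ : L.carrier) (j : Fin 2) :
    K γ * X j * K (-γ) = iPow (form γ (simpleRoot j)) • X j := by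
  simpa only [X, K, map_mul, map_smul] using mk_rel (Rel.K_X γ j)

theorem K_conj_Y (γ : L.carrier) (j : Fin 2) :
    K γ * Y j * K (-γ) = iPow (-form γ (simpleRoot j)) • Y j := by
  simpa only [Y, K, map_mul, map_smul] using mk_rel (Rel.K_Y γ j)

theorem K_conj_K (γ δ : L.carrier) : K γ * K δ * K (-γ) = K δ := by
  rw [K_mul, K_mul, add_neg_cancel_comm]

theorem K_mul_K_neg (γ : L.carrier) : K γ * K (-γ) = 1 := by
  rw [K_mul, add_neg_cancel, K_zero]

theorem K_mul_X (γ : L.carrier) (j : Fin 2) :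
    K γ * X j = iPow (form γ (simpleRoot j)) • (X j * K γ) := by
  have h2 := congrArg (· * K γ) (K_conj_X γ j)
  simpa [mul_assoc, K_mul, K_zero] using h2

theorem K_mul_Y (γ : L.carrier) (j : Fin 2) :
    K γ * Y j = iPow (-form γ (simpleRoot j)) • (Y j * K γ) := by
  have h2 := congrArg (· * K γ) (K_conj_Y γ j)
  simpa [mul_assoc, K_mul, K_zero] using h2

theorem X_Y (j : Fin 2) :
    X j * Y j - Y j * X j = (2 * Complex.I)⁻¹ • (K (L.sr j) - K (-L.sr j)) := by
  simpa only [X, Y, H, K, map_sub, map_mul, map_smul] using mk_rel (Rel.X_Y (L := L) j)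

theorem X_Y_of_ne {j k : Fin 2} (h : j ≠ k) : X j * Y k - Y k * X j = (0 : U L) := by
  simpa only [X, Y, H, K, map_sub, map_mul, map_zero] using mk_rel (Rel.X_Y_of_ne (L := L) j k h)

theorem X_mul_X (j : Fin 2) : X j * X j = (0 : U L) := by
  rw [← pow_two]
  simpa only [X, Y, H, K, map_pow, map_zero] using mk_rel (Rel.X_sq (L := L) j)

theorem Y_mul_Y (j : Fin 2) : Y j * Y j = (0 : U L) := by
  rw [← pow_two]
  simpa only [X, Y, H, K, map_pow, map_zero] using mk_rel (Rel.Y_sq (L := L) j)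

theorem X_braid : (X 0 * X 1) ^ 2 = ((X 1 * X 0) ^ 2 : U L) := by
  simpa only [X, Y, H, K, map_pow, map_mul] using mk_rel (Rel.X_braid (L := L))

theorem Y_braid : (Y 0 * Y 1) ^ 2 = ((Y 1 * Y 0) ^ 2 : U L) := by
  simpa only [X, Y, H, K, map_pow, map_mul] using mk_rel (Rel.Y_braid (L := L))

theorem H_X (j k : Fin 2) : H j * X k - X k * H j = ((cartan j k : ℂ) • X k : U L) := by
  simpa only [X, Y, H, K, map_sub, map_mul, map_smul] using mk_rel (Rel.H_X (L := L) j k)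

theorem H_Y (j k : Fin 2) : H j * Y k - Y k * H j = (-(cartan j k : ℂ) • Y k : U L) := by
  simpa only [X, Y, H, K, map_sub, map_mul, map_smul] using mk_rel (Rel.H_Y (L := L) j k)

theorem H_H (j k : Fin 2) : H j * H k - H k * H j = (0 : U L) := by
  simpa only [X, Y, H, K, map_sub, map_mul, map_zero] using mk_rel (Rel.H_H (L := L) j k)

theorem H_K (j : Fin 2) (γ : L.carrier) : H j * K γ - K γ * H j = 0 := by
  simpa only [X, Y, H, K, map_sub, map_mul, map_zero] using mk_rel (Rel.H_K j γ)

theorem K_sr_mul_X (j k : Fin 2) :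
    K (L.sr j) * X k = iPow (cartan j k) • (X k * K (L.sr j)) := by
  rw [K_mul_X]; congr 2; exact form_simpleRoot_simpleRoot j k

theorem form_neg_left (v w : Wt) : form (-v) w = -form v w := by
  simp only [form, Pi.neg_apply]; ring

theorem K_neg_sr_mul_X (j k : Fin 2) :
    K (-L.sr j) * X k = iPow (-cartan j k) • (X k * K (-L.sr j)) := by
  rw [K_mul_X]; congr 2
  rw [← form_simpleRoot_simpleRoot j k, ← form_neg_left]; rfl

theorem K_sr_mul_Y (j k : Fin 2) :
    K (L.sr j) * Y k = iPow (-cartan j k) • (Y k * K (L.sr j)) := by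
  rw [K_mul_Y]; congr 3; exact form_simpleRoot_simpleRoot j k

theorem K_neg_sr_mul_Y (j k : Fin 2) :
    K (-L.sr j) * Y k = iPow (cartan j k) • (Y k * K (-L.sr j)) := by
  rw [K_mul_Y]; congr 2
  rw [← form_simpleRoot_simpleRoot j k, ← neg_neg (form (simpleRoot j) _), ← form_neg_left (simpleRoot j)]
  rfl

/-- The algebraic identity behind the compatibility of the coproduct with the quartic relations. -/
theorem braid_aux {A : Type*} [Ring A] [Algebra ℂ A] (a b c d : A)
    (hab : a * b = -(b * a)) (hcd : c * d = -(d * c))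
    (had : a * d = -(Complex.I • (d * a))) (hcb : c * b = -(Complex.I • (b * c)))
    (ha : a * a = 0) (hb : b * b = 0) (hc : c * c = 0) (hd : d * d = 0)
    (hac : (a * c) ^ 2 = (c * a) ^ 2) (hbd : (b * d) ^ 2 = (d * b) ^ 2) :
    ((a + b) * (c + d)) ^ 2 = ((c + d) * (a + b)) ^ 2 := by
  have hab' : ∀ x, a * (b * x) = -(b * (a * x)) := fun x => by
    rw [← mul_assoc, hab, neg_mul, mul_assoc]
  have hcd' : ∀ x, c * (d * x) = -(d * (c * x)) := fun x => by
    rw [← mul_assoc, hcd, neg_mul, mul_assoc]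
  have had' : ∀ x, a * (d * x) = -(Complex.I • (d * (a * x))) := fun x => by
    rw [← mul_assoc, had, neg_mul, smul_mul_assoc, mul_assoc]
  have hcb' : ∀ x, c * (b * x) = -(Complex.I • (b * (c * x))) := fun x => by
    rw [← mul_assoc, hcb, neg_mul, smul_mul_assoc, mul_assoc]
  have ha' : ∀ x, a * (a * x) = 0 := fun x => by rw [← mul_assoc, ha, zero_mul]
  have hb' : ∀ x, b * (b * x) = 0 := fun x => by rw [← mul_assoc, hb, zero_mul]
  have hc' : ∀ x, c * (c * x) = 0 := fun x => by rw [← mul_assoc, hc, zero_mul]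
  have hd' : ∀ x, d * (d * x) = 0 := fun x => by rw [← mul_assoc, hd, zero_mul]
  simp only [pow_two, mul_assoc] at hac hbd
  simp only [pow_two, mul_add, add_mul, mul_assoc, hab, hcd, had, hcb, hab', hcd', had', hcb',
    ha, hc, ha', hb', hc', hd', mul_neg, neg_mul, mul_smul_comm, smul_mul_assoc, smul_neg,
    mul_zero, smul_zero, neg_zero, add_zero, zero_add, neg_neg, smul_smul,
    Complex.I_mul_I, hac, hbd, neg_smul, one_smul, smul_add, neg_add]
  abel

/-- The coproduct on generators. -/
noncomputable def comulGen (L : QPLattice) : Gen L → U L ⊗[ℂ] U L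
  | .X j => X j ⊗ₜ K (L.sr j) + 1 ⊗ₜ X j
  | .Y j => Y j ⊗ₜ 1 + K (-L.sr j) ⊗ₜ Y j
  | .H j => 1 ⊗ₜ H j + H j ⊗ₜ 1
  | .K γ => K γ ⊗ₜ K γ



theorem cross_XY (j k : Fin 2) :
    (X j * K (-L.sr k)) ⊗ₜ[ℂ] (K (L.sr j) * Y k) =
      (K (-L.sr k) * X j) ⊗ₜ[ℂ] (Y k * K (L.sr j)) := by
  have hs : cartan k j = cartan j k := by fin_cases j <;> fin_cases k <;> rfl
  rw [K_sr_mul_Y, K_neg_sr_mul_X, TensorProduct.tmul_smul, TensorProduct.smul_tmul', hs]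

theorem sq_aux_X (j : Fin 2) :
    (X j ⊗ₜ[ℂ] K (L.sr j) + 1 ⊗ₜ[ℂ] X j : U L ⊗[ℂ] U L) ^ 2 = 0 := by
  have h : iPow (cartan j j) = -1 := by fin_cases j <;> simp [cartan, iPow_two]
  simp [pow_two, mul_add, add_mul, X_mul_X, K_sr_mul_X, h, TensorProduct.tmul_neg]

theorem sq_aux_Y (j : Fin 2) :
    (Y j ⊗ₜ[ℂ] 1 + K (-L.sr j) ⊗ₜ[ℂ] Y j : U L ⊗[ℂ] U L) ^ 2 = 0 := by
  have h : iPow (cartan j j) = -1 := by fin_cases j <;> simp [cartan, iPow_two]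
  simp [pow_two, mul_add, add_mul, Y_mul_Y, K_neg_sr_mul_Y, h, TensorProduct.neg_tmul]

theorem comulGen_rel (L : QPLattice) ⦃a b : FreeAlgebra ℂ (Gen L)⦄ (h : Rel L a b) :
    FreeAlgebra.lift ℂ (comulGen L) a = FreeAlgebra.lift ℂ (comulGen L) b := by
  induction h with
  | K_zero =>
    simp [Free.K, comulGen, K_zero, Algebra.TensorProduct.one_def]
  | K_add γ δ => simp [Free.K, comulGen, K_mul]
  | K_X γ j =>
    simp only [Free.K, Free.X, map_mul, map_smul, FreeAlgebra.lift_ι_apply, comulGen, mul_add,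
      add_mul, Algebra.TensorProduct.tmul_mul_tmul, K_conj_X, K_conj_K, mul_one, K_mul_K_neg,
      smul_add, TensorProduct.smul_tmul', TensorProduct.tmul_smul]
  | K_Y γ j =>
    simp only [Free.K, Free.Y, map_mul, map_smul, FreeAlgebra.lift_ι_apply, comulGen, mul_add,
      add_mul, Algebra.TensorProduct.tmul_mul_tmul, K_conj_Y, K_conj_K, mul_one, K_mul_K_neg,
      smul_add, TensorProduct.smul_tmul', TensorProduct.tmul_smul]
  | X_Y j =>
    have h := X_Y (L := L) j
    rw [sub_eq_iff_eq_add] at h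
    simp only [Free.K, Free.X, Free.Y, map_mul, map_sub, map_smul, FreeAlgebra.lift_ι_apply,
      comulGen, mul_add, add_mul, Algebra.TensorProduct.tmul_mul_tmul, mul_one, one_mul,
      cross_XY, h, TensorProduct.add_tmul, TensorProduct.tmul_add, ← TensorProduct.smul_tmul',
      TensorProduct.tmul_smul, TensorProduct.sub_tmul, TensorProduct.tmul_sub]
    module
  | X_Y_of_ne j k hne =>
    have h := X_Y_of_ne (L := L) hne
    rw [sub_eq_zero] at h
    simp only [Free.X, Free.Y, map_mul, map_sub, map_zero, FreeAlgebra.lift_ι_apply,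
      comulGen, mul_add, add_mul, Algebra.TensorProduct.tmul_mul_tmul, mul_one, one_mul,
      cross_XY, h]
    abel
  | X_sq j =>
    simp only [Free.X, map_pow, map_zero, FreeAlgebra.lift_ι_apply, comulGen]
    exact sq_aux_X j
  | Y_sq j =>
    simp only [Free.Y, map_pow, map_zero, FreeAlgebra.lift_ι_apply, comulGen]
    exact sq_aux_Y j
  | X_braid =>
    simp only [Free.X, map_mul, map_pow, FreeAlgebra.lift_ι_apply, comulGen]
    apply braid_aux
    all_goals
      simp only [Algebra.TensorProduct.tmul_mul_tmul, pow_two, mul_one, one_mul, K_sr_mul_X,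
        TensorProduct.tmul_smul, X_mul_X, TensorProduct.zero_tmul, TensorProduct.tmul_zero]
    · simp [cartan, iPow_two]; try module
    · simp [cartan, iPow_two]; try module
    · simp [cartan, iPow_neg, iPow_one]; try module
    · simp [cartan, iPow_neg, iPow_one]; try module
    · have h := X_braid (L := L)
      simp only [pow_two] at h
      rw [h, K_mul, K_mul, K_mul, K_mul, add_comm (L.sr 0)]
    · have h := X_braid (L := L)
      simp only [pow_two] at h
      rw [h]
  | Y_braid =>
    simp only [Free.Y, map_mul, map_pow, FreeAlgebra.lift_ι_apply, comulGen]
    rw [add_comm (Y 0 ⊗ₜ[ℂ] 1), add_comm (Y 1 ⊗ₜ[ℂ] 1)]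
    apply braid_aux
    all_goals
      simp only [Algebra.TensorProduct.tmul_mul_tmul, pow_two, mul_one, one_mul, K_neg_sr_mul_Y,
        ← TensorProduct.smul_tmul', Y_mul_Y, TensorProduct.zero_tmul, TensorProduct.tmul_zero]
    · simp [cartan, iPow_two]; try module
    · simp [cartan, iPow_two]; try module
    · simp [cartan, iPow_neg, iPow_one]; try module
    · simp [cartan, iPow_neg, iPow_one]; try module
    · have h := Y_braid (L := L)
      simp only [pow_two] at h
      rw [h, K_mul, K_mul, K_mul, K_mul, add_comm (-L.sr 0)]
    · have h := Y_braid (L := L)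
      simp only [pow_two] at h
      rw [h]
  | H_X j k =>
    have h := H_X (L := L) j k
    have h' := H_K (L := L) j (L.sr k)
    rw [sub_eq_iff_eq_add] at h
    rw [sub_eq_zero] at h'
    simp only [Free.X, Free.H, map_mul, map_sub, map_smul, FreeAlgebra.lift_ι_apply,
      comulGen, mul_add, add_mul, Algebra.TensorProduct.tmul_mul_tmul, mul_one, one_mul, h, h',
      TensorProduct.add_tmul, TensorProduct.tmul_add, ← TensorProduct.smul_tmul',
      TensorProduct.tmul_smul]
    module
  | H_Y j k =>
    have h := H_Y (L := L) j k
    have h' := H_K (L := L) j (-L.sr k)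
    rw [sub_eq_iff_eq_add] at h
    rw [sub_eq_zero] at h'
    simp only [Free.Y, Free.H, map_mul, map_sub, map_smul, FreeAlgebra.lift_ι_apply,
      comulGen, mul_add, add_mul, Algebra.TensorProduct.tmul_mul_tmul, mul_one, one_mul, h, h',
      TensorProduct.add_tmul, TensorProduct.tmul_add, ← TensorProduct.smul_tmul',
      TensorProduct.tmul_smul]
    module
  | H_H j k =>
    have h := H_H (L := L) j k
    rw [sub_eq_zero] at h
    simp only [Free.H, map_mul, map_sub, map_zero, FreeAlgebra.lift_ι_apply,
      comulGen, mul_add, add_mul, Algebra.TensorProduct.tmul_mul_tmul, mul_one, one_mul, h]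
    abel
  | H_K j γ =>
    have h := H_K (L := L) j γ
    rw [sub_eq_zero] at h
    simp only [Free.H, Free.K, map_mul, map_sub, map_zero, FreeAlgebra.lift_ι_apply,
      comulGen, mul_add, add_mul, Algebra.TensorProduct.tmul_mul_tmul, mul_one, one_mul, h]
    abel

/-- The coproduct `U → U ⊗ U`. -/
noncomputable def comul (L : QPLattice) : U L →ₐ[ℂ] U L ⊗[ℂ] U L :=
  RingQuot.liftAlgHom ℂ ⟨FreeAlgebra.lift ℂ (comulGen L), comulGen_rel L⟩

theorem comul_mk (g : Gen L) : comul L (mk L (FreeAlgebra.ι ℂ g)) = comulGen L g := by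
  refine (RingQuot.liftAlgHom_mkAlgHom_apply ℂ (FreeAlgebra.lift ℂ (comulGen L))
    (comulGen_rel L) _).trans ?_
  rw [FreeAlgebra.lift_ι_apply]

theorem comul_X (j : Fin 2) : comul L (X j) = X j ⊗ₜ K (L.sr j) + 1 ⊗ₜ X j := comul_mk (.X j)

theorem comul_Y (j : Fin 2) : comul L (Y j) = Y j ⊗ₜ 1 + K (-L.sr j) ⊗ₜ Y j := comul_mk (.Y j)

theorem comul_H (j : Fin 2) : comul L (H j) = 1 ⊗ₜ H j + H j ⊗ₜ 1 := comul_mk (.H j)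

theorem comul_K (γ : L.carrier) : comul L (K γ) = K γ ⊗ₜ K γ := comul_mk (.K γ)

end U

/-! ### Modules -/

section Modules

variable (L : QPLattice)

/-- The weight space `V(w)`: the simultaneous eigenspace of `H_1, H_2` of weight `w`. -/
def wtSpace (V : Type) [AddCommGroup V] [Module ℂ V] [Module (U L) V] [IsScalarTower ℂ (U L) V]
    (w : Wt) : Submodule ℂ V where
  carrier := {v | ∀ j : Fin 2, (U.H j : U L) • v = w j • v}
  add_mem' {a b} ha hb j := by rw [smul_add, smul_add, ha j, hb j]
  zero_mem' j := by rw [smul_zero, smul_zero]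
  smul_mem' c a ha j := by
    rw [← algebraMap_smul (U L) c a, ← mul_smul, ← Algebra.commutes, mul_smul, ha j,
      algebraMap_smul, algebraMap_smul, smul_comm]

/-- `V` is a weight module: it is the (internal) direct sum of its weight spaces, and each `K_γ`
acts on the weight space `V(w)` as `𝐢 ^ ⟨γ, w⟩`. -/
structure IsWeightModule (V : Type) [AddCommGroup V] [Module ℂ V] [Module (U L) V]
    [IsScalarTower ℂ (U L) V] : Prop where
  indep : iSupIndep (wtSpace L V)
  iSup_eq_top : ⨆ w, wtSpace L V w = ⊤
  K_smul : ∀ (γ : L.carrier) (w : Wt), ∀ v ∈ wtSpace L V w,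
    (U.K γ : U L) • v = iPow (form γ w) • v

/-- The objects of the category `𝒞` of finite-dimensional weight modules. Morphisms are the
`U`-linear maps. -/
structure WtMod where
  /-- the underlying space -/
  carrier : Type
  [addCommGroup : AddCommGroup carrier]
  [moduleComplex : Module ℂ carrier]
  [moduleU : Module (U L) carrier]
  [isScalarTower : IsScalarTower ℂ (U L) carrier]
  [finite : FiniteDimensional ℂ carrier]
  isWeightModule : IsWeightModule L carrier

attribute [instance] WtMod.addCommGroup WtMod.moduleComplex WtMod.moduleU WtMod.isScalarTower
  WtMod.finite

/-- The left ideal of `U` generated by `X_1`, `X_2`, all `H_j - w(H_j)` and all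
`K_γ - 𝐢 ^ ⟨γ, w⟩`. -/
noncomputable def vermaIdeal (w : Wt) : Submodule (U L) (U L) :=
  Submodule.span (U L)
    (Set.range (fun j : Fin 2 => (U.X j : U L)) ∪
      Set.range (fun j : Fin 2 => (U.H j - algebraMap ℂ (U L) (w j) : U L)) ∪
      Set.range (fun γ : L.carrier => (U.K γ - algebraMap ℂ (U L) (iPow (form γ w)) : U L)))

/-- The Verma module of highest weight `w`. -/
abbrev Verma (w : Wt) : Type := U L ⧸ vermaIdeal L w

/-- The irreducible module of highest weight `w`: the quotient of the Verma module by the sum of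
all its proper submodules. -/
abbrev Irr (w : Wt) : Type :=
  Verma L w ⧸ sSup {N : Submodule (U L) (Verma L w) | N ≠ ⊤}

/-- `P` is projective in `𝒞`: maps out of `P` lift along epimorphisms, which in `𝒞` are the
surjections. -/
def IsProjective (P : WtMod L) : Prop :=
  ∀ (A B : WtMod L) (g : A.carrier →ₗ[U L] B.carrier) (f : P.carrier →ₗ[U L] B.carrier),
    Function.Surjective g → ∃ h : P.carrier →ₗ[U L] A.carrier, g ∘ₗ h = f

/-- `P` is (the) projective cover in `𝒞` of the irreducible module of highest weight `w`. -/
def IsProjectiveCover (P : WtMod L) (w : Wt) : Prop :=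
  IsProjective L P ∧ ∃ π : P.carrier →ₗ[U L] Irr L w, Function.Surjective π ∧
    ∀ N : Submodule (U L) P.carrier, N ⊔ LinearMap.ker π = ⊤ → N = ⊤

end Modules

/-! ### Tensor products -/

section Tensor

variable {L : QPLattice}

/-- The tensor product over `ℂ` of two `U`-modules, with `U` acting through the coproduct. (This is
a type synonym, since `V ⊗ W` already carries the action of `U` on the first factor alone.) -/
def TensorMod (V W : Type) [AddCommGroup V] [Module ℂ V] [AddCommGroup W] [Module ℂ W] : Type :=
  V ⊗[ℂ] W

variable (V W : Type) [AddCommGroup V] [Module ℂ V] [AddCommGroup W] [Module ℂ W]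

noncomputable instance : AddCommGroup (TensorMod V W) := inferInstanceAs (AddCommGroup (V ⊗[ℂ] W))

noncomputable instance : Module ℂ (TensorMod V W) := inferInstanceAs (Module ℂ (V ⊗[ℂ] W))

variable [Module (U L) V] [IsScalarTower ℂ (U L) V] [Module (U L) W] [IsScalarTower ℂ (U L) W]

/-- The representation of `U` on `V ⊗ W`. -/
noncomputable def tensorRep (L : QPLattice) (V W : Type) [AddCommGroup V] [Module ℂ V]
    [AddCommGroup W] [Module ℂ W] [Module (U L) V] [IsScalarTower ℂ (U L) V] [Module (U L) W]
    [IsScalarTower ℂ (U L) W] : U L →ₐ[ℂ] Module.End ℂ (V ⊗[ℂ] W) :=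
  (Module.endTensorEndAlgHom.comp
    (Algebra.TensorProduct.map (Algebra.lsmul ℂ ℂ V) (Algebra.lsmul ℂ ℂ W))).comp (U.comul L)

noncomputable instance : Module (U L) (TensorMod V W) :=
  Module.compHom (V ⊗[ℂ] W) (tensorRep L V W).toRingHom

theorem TensorMod.smul_def (u : U L) (t : TensorMod V W) : u • t = tensorRep L V W u t := rfl

instance : IsScalarTower ℂ (U L) (TensorMod V W) where
  smul_assoc c u t := by
    rw [TensorMod.smul_def, TensorMod.smul_def, map_smul]; rfl

/-- The pure tensor `v ⊗ w`. -/
def TensorMod.tmul (v : V) (w : W) : TensorMod V W := v ⊗ₜ[ℂ] w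

variable {V W}

theorem TensorMod.smul_tmul_of_comul {u a b c d : U L}
    (h : U.comul L u = a ⊗ₜ b + c ⊗ₜ d) (v : V) (w : W) :
    u • tmul V W v w = tmul V W (a • v) (b • w) + tmul V W (c • v) (d • w) := by
  change Module.endTensorEndAlgHom (Algebra.TensorProduct.map (Algebra.lsmul ℂ ℂ V)
    (Algebra.lsmul ℂ ℂ W) (U.comul L u)) (v ⊗ₜ[ℂ] w) = _
  rw [h, map_add, map_add]
  rfl

theorem TensorMod.X_smul_tmul (j : Fin 2) (v : V) (w : W) :
    (U.X j : U L) • tmul V W v w =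
      tmul V W ((U.X j : U L) • v) ((U.K (L.sr j) : U L) • w) +
        tmul V W v ((U.X j : U L) • w) := by
  rw [smul_tmul_of_comul (U.comul_X j) v w, one_smul]

end Tensor

/-- `T ≅ ⨁_k P_k`, where the list `l` consists of pairs `(d_k, w_k)` and `P_k` is a projective cover
in `𝒞`, of dimension `d_k`, of the irreducible module of highest weight `w_k`. -/
def IsSumOfProjectives (L : QPLattice) (T : Type) [AddCommGroup T] [Module (U L) T]
    (l : List (ℕ × Wt)) : Prop :=
  ∃ P : Fin l.length → WtMod L,
    (∀ k, IsProjectiveCover L (P k) (l.get k).2 ∧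
      Module.finrank ℂ (P k).carrier = (l.get k).1) ∧
    Nonempty (T ≃ₗ[U L] ((k : Fin l.length) → (P k).carrier))

end UnrolledSL3

open UnrolledSL3

/-! Write `[z]` for `qn z`, which vanishes exactly at the even integers. Weights are handled through
their values on the simple coroots, which are the indices `λ_1`, `λ_2` lowered by one.

A highest weight module is spanned by eight monomials in `X_{-1}`, `X_{-2}`. The longest raising
word times the longest lowering word acts on a highest weight vector by a scalar (`IsHW.top`) that
is nonzero exactly for typical weights. Hence a typical Verma module is simple of dimension eight.
It is also projective: applying this product to any weight vector lifting a highest weight vector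
gives, up to a nonzero scalar, a highest weight vector lifting it (`exists_isHW_lift`). The same
argument inside `Hom_ℂ(L_λ, A)`, combined with the adjunction `Hom(V ⊗ M, A) = Hom(M, Hom_ℂ(V, A))`,
shows that `T = L_λ ⊗ L_μ` is projective (`IsTypical.isProjective_tensor`).

A projective object is governed by its simple quotients, so the homomorphisms from `T` to each `L_x`
have to be counted. Let `v`, `v'` be the highest weight vectors of `L_λ`, `L_μ`. Then `T` is
generated by `X_{-j} X_{-i} v ⊗ v'`, and homomorphisms `T → A` are the same as vectors of weight `λ
+ μ - α_3` in `A` that satisfy one quadratic relation in the raising operators (`IsAdm`,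
`IsAdm.exists_hom`). Raising such a vector in `L_x` shows that `x` is one of `λ + μ`, `λ + μ - α_1`,
`λ + μ - α_2`, `λ + μ - α_3`. Linear algebra in degrees at most two of `L_x` then decides which of
these occur.

In each of the five cases the occurring weights have multiplicity one, and all but at most one are
typical. A typical `L_x` is its own projective cover and splits off (`exists_split`). What is left
has a single simple quotient, so it is the projective cover of the remaining irreducible
(`isProjectiveCover_of_homOne`), and its dimension is what remains of `32 = 4 · 8`. No atypical
projective has to be constructed by other means. -/

set_option linter.unusedSectionVars false

namespace UnrolledSL3

/-! ### Quantum integers at a fourth root of unity -/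

/-- The quantum integer `[z] = (𝐢 ^ z - 𝐢 ^ (-z)) / (2 𝐢)`. -/
noncomputable def qn (z : ℂ) : ℂ := Complex.sin (Real.pi * z / 2)

/-- Since `𝐢 ^ z` is an exponential, the quantum integer is the sine of `πz/2`, so every identity
between quantum integers below is a trigonometric one. -/
theorem qn_eq (z : ℂ) : (2 * Complex.I)⁻¹ * (iPow z - iPow (-z)) = qn z := by
  rw [qn, Complex.sin, iPow, iPow]
  have h1 : (Real.pi : ℂ) * Complex.I * -z / 2 = -(Real.pi * z / 2) * Complex.I := by ring
  have h2 : (Real.pi : ℂ) * Complex.I * z / 2 = (Real.pi * z / 2) * Complex.I := by ring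
  rw [h1, h2, mul_inv, Complex.inv_I]
  ring

theorem qn_eq_zero_iff (z : ℂ) : qn z = 0 ↔ IsEven z := by
  have hpi : (Real.pi : ℂ) ≠ 0 := by exact_mod_cast Real.pi_ne_zero
  rw [qn, Complex.sin_eq_zero_iff]
  refine exists_congr fun n => ?_
  constructor
  · intro h
    have h' : (Real.pi : ℂ) * z = Real.pi * (2 * n) := by linear_combination 2 * h
    exact mul_left_cancel₀ hpi h'
  · rintro rfl; ring

theorem qn_add_one (z : ℂ) : qn (z + 1) = Complex.cos (Real.pi * z / 2) := by
  rw [qn, ← Complex.sin_add_pi_div_two]; congr 1; ring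

theorem qn_sub_one (z : ℂ) : qn (z - 1) = -Complex.cos (Real.pi * z / 2) := by
  rw [qn, ← Complex.sin_sub_pi_div_two]; congr 1; ring

theorem qn_sub_two (z : ℂ) : qn (z - 2) = -qn z := by
  rw [qn, qn, ← Complex.sin_sub_pi]; congr 1; ring

theorem qn_zero : qn 0 = 0 := by simp [qn]

theorem qn_one : qn 1 = 1 := by simp [qn]

theorem qn_neg (z : ℂ) : qn (-z) = -qn z := by
  rw [qn, qn, ← Complex.sin_neg]; congr 1; ring

/-- The addition formula in the form in which it occurs in rank two. -/
theorem qn_add_sub_one (a b : ℂ) :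
    qn (a + b - 1) = qn a * qn b - qn (a + 1) * qn (b + 1) := by
  rw [qn_sub_one, qn_add_one, qn_add_one, qn, qn, mul_add, add_div, Complex.cos_add]; ring

/-- These are the sine and cosine of one angle. In the case analysis, the vanishing of one supplies
the nonvanishing of the other. -/
theorem qn_ne_zero_or (a : ℂ) : qn a ≠ 0 ∨ qn (a + 1) ≠ 0 := by
  by_contra! h
  rw [qn_add_one, qn] at h
  have := Complex.sin_sq_add_cos_sq (Real.pi * a / 2)
  rw [h.1, h.2] at this
  norm_num at this

theorem qn_sub (a b : ℂ) : qn (a - b) = qn a * qn (b + 1) - qn (a + 1) * qn b := by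
  rw [qn_add_one, qn_add_one, qn, qn, qn, mul_sub, sub_div, Complex.sin_sub]

/-! ### The bilinear form -/

theorem form_add_left (u v w : Wt) : form (u + v) w = form u w + form v w := by
  simp only [form, Pi.add_apply]; ring

theorem form_add_right (u v w : Wt) : form u (v + w) = form u v + form u w := by
  simp only [form, Pi.add_apply]; ring

theorem form_neg_right (u v : Wt) : form u (-v) = -form u v := by
  simp only [form, Pi.neg_apply]; ring

theorem form_sub_right (u v w : Wt) : form u (v - w) = form u v - form u w := by
  simp only [form, Pi.sub_apply]; ring

theorem form_simpleRoot_left (v : Wt) (j : Fin 2) : form (simpleRoot j) v = v j := by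
  fin_cases j <;> simp [form, simpleRoot, cartan] <;> ring

theorem simpleRoot_self (i : Fin 2) : simpleRoot i i = 2 := by
  fin_cases i <;> simp [simpleRoot, cartan]

theorem simpleRoot_of_ne {i j : Fin 2} (h : i ≠ j) : simpleRoot i j = -1 := by
  fin_cases i <;> fin_cases j <;> simp_all [simpleRoot, cartan]

theorem simpleRoot_sum (i : Fin 2) : simpleRoot i 0 + simpleRoot i 1 = 1 := by
  fin_cases i <;> simp [simpleRoot, cartan] <;> norm_num

/-- The height of a weight: the value on the sum of the simple coroots. -/
def ht (w : Wt) : ℂ := w 0 + w 1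

theorem ht_sub_simpleRoot (w : Wt) (i : Fin 2) : ht (w - simpleRoot i) = ht w - 1 := by
  have := simpleRoot_sum i
  simp only [ht, Pi.sub_apply]; linear_combination -this

theorem eq_or_eq_of_ne {i j : Fin 2} (h : i ≠ j) (k : Fin 2) : k = i ∨ k = j := by
  revert i j k; decide

/-! ### Generators acting on modules -/

section Generators

variable (L : QPLattice)

/-- The generator `X_{j+1}`. -/
noncomputable abbrev E (j : Fin 2) : U L := U.X j
/-- The generator `X_{-(j+1)}`. -/
noncomputable abbrev F (j : Fin 2) : U L := U.Y j

/-- The sum of the two Cartan generators. -/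
noncomputable def hU : U L := U.H 0 + U.H 1

variable {L} {V W : Type} [AddCommGroup V] [Module ℂ V] [Module (U L) V] [IsScalarTower ℂ (U L) V]
  [AddCommGroup W] [Module ℂ W] [Module (U L) W] [IsScalarTower ℂ (U L) W]

theorem U.mk_surjective : Function.Surjective (U.mk L) := RingQuot.mkAlgHom_surjective ℂ (Rel L)

/-- Induction on elements of `U`. -/
theorem U.induction {C : U L → Prop} (hc : ∀ c : ℂ, C (algebraMap ℂ (U L) c))
    (hX : ∀ j, C (U.X j)) (hY : ∀ j, C (U.Y j)) (hH : ∀ j, C (U.H j)) (hK : ∀ γ, C (U.K γ))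
    (hmul : ∀ a b, C a → C b → C (a * b)) (hadd : ∀ a b, C a → C b → C (a + b)) (u : U L) :
    C u := by
  obtain ⟨x, rfl⟩ := U.mk_surjective u
  refine FreeAlgebra.induction ℂ (Gen L) (motive := fun x => C (U.mk L x)) ?_ ?_ ?_ ?_ x
  · intro c; rw [AlgHom.commutes]; exact hc c
  · rintro (j | j | j | γ)
    exacts [hX j, hY j, hH j, hK γ]
  · intro a b ha hb; rw [map_mul]; exact hmul _ _ ha hb
  · intro a b ha hb; rw [map_add]; exact hadd _ _ ha hb

/-- A complex subspace that is stable under the generators is stable under `U`. -/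
theorem smul_mem_of_generators (N : Submodule ℂ V)
    (hX : ∀ j, ∀ v ∈ N, E L j • v ∈ N) (hY : ∀ j, ∀ v ∈ N, F L j • v ∈ N)
    (hH : ∀ j, ∀ v ∈ N, (U.H j : U L) • v ∈ N) (hK : ∀ γ, ∀ v ∈ N, (U.K γ : U L) • v ∈ N)
    (u : U L) : ∀ v ∈ N, u • v ∈ N := by
  induction u using U.induction with
  | hc c => intro v hv; rw [algebraMap_smul]; exact N.smul_mem c hv
  | hX j => exact hX j
  | hY j => exact hY j
  | hH j => exact hH j
  | hK γ => exact hK γ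
  | hmul a b ha hb => intro v hv; rw [mul_smul]; exact ha _ (hb _ hv)
  | hadd a b ha hb => intro v hv; rw [add_smul]; exact N.add_mem (ha _ hv) (hb _ hv)

/-- A complex linear map that commutes with the generators is `U`-linear. -/
noncomputable def linearMapOfGenerators (f : V →ₗ[ℂ] W)
    (hX : ∀ j v, f (E L j • v) = E L j • f v) (hY : ∀ j v, f (F L j • v) = F L j • f v)
    (hH : ∀ j v, f ((U.H j : U L) • v) = (U.H j : U L) • f v)
    (hK : ∀ γ v, f ((U.K γ : U L) • v) = (U.K γ : U L) • f v) : V →ₗ[U L] W where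
  toFun := f
  map_add' := f.map_add
  map_smul' u := by
    simp only [RingHom.id_apply]
    induction u using U.induction with
    | hc c => intro v; rw [algebraMap_smul, algebraMap_smul, f.map_smul]
    | hX j => exact hX j
    | hY j => exact hY j
    | hH j => exact hH j
    | hK γ => exact hK γ
    | hmul a b ha hb => intro v; rw [mul_smul, mul_smul, ha, hb]
    | hadd a b ha hb => intro v; rw [add_smul, add_smul, f.map_add, ha, hb]

theorem map_complex_smul (f : V →ₗ[U L] W) (c : ℂ) (v : V) : f (c • v) = c • f v := by
  rw [← algebraMap_smul (U L) c v, map_smul, algebraMap_smul]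

theorem U_smul_comm (u : U L) (c : ℂ) (v : V) : u • c • v = c • u • v :=
  smul_algebra_smul_comm c u v

theorem E_E (j : Fin 2) (v : V) : E L j • E L j • v = 0 := by
  rw [smul_smul, E, U.X_mul_X, zero_smul]

theorem F_F (j : Fin 2) (v : V) : F L j • F L j • v = 0 := by
  rw [smul_smul, F, U.Y_mul_Y, zero_smul]

theorem E_F_of_ne {i j : Fin 2} (h : i ≠ j) (v : V) : E L i • F L j • v = F L j • E L i • v := by
  rw [smul_smul, smul_smul, sub_eq_zero.mp (U.X_Y_of_ne h)]

theorem E_braid {i j : Fin 2} (h : i ≠ j) (v : V) :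
    E L i • E L j • E L i • E L j • v = E L j • E L i • E L j • E L i • v := by
  have key : E L 0 • E L 1 • E L 0 • E L 1 • v = E L 1 • E L 0 • E L 1 • E L 0 • v := by
    have := U.X_braid (L := L)
    simp only [pow_two] at this
    simpa [mul_smul] using congrArg (· • v) this
  fin_cases i <;> fin_cases j
  exacts [absurd rfl h, key, key.symm, absurd rfl h]

theorem F_braid {i j : Fin 2} (h : i ≠ j) (v : V) :
    F L i • F L j • F L i • F L j • v = F L j • F L i • F L j • F L i • v := by
  have key : F L 0 • F L 1 • F L 0 • F L 1 • v = F L 1 • F L 0 • F L 1 • F L 0 • v := by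
    have := U.Y_braid (L := L)
    simp only [pow_two] at this
    simpa [mul_smul] using congrArg (· • v) this
  fin_cases i <;> fin_cases j
  exacts [absurd rfl h, key, key.symm, absurd rfl h]

/-- `v` has weight `w`, and the `K_γ` act accordingly. -/
structure IsWt (L : QPLattice) {V : Type} [AddCommGroup V] [Module ℂ V] [Module (U L) V]
    (w : Wt) (v : V) : Prop where
  H : ∀ j, (U.H j : U L) • v = w j • v
  K : ∀ γ : L.carrier, (U.K γ : U L) • v = iPow (form γ w) • v

/-- `v` is a (possibly zero) highest weight vector of weight `w`. -/
structure IsHW (L : QPLattice) {V : Type} [AddCommGroup V] [Module ℂ V] [Module (U L) V]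
    (w : Wt) (v : V) : Prop where
  wt : IsWt L w v
  X : ∀ j, E L j • v = 0

namespace IsWt

variable {w : Wt} {v : V}

theorem smul (h : IsWt L w v) (c : ℂ) : IsWt L w (c • v) where
  H j := by rw [U_smul_comm, h.H, smul_comm]
  K γ := by rw [U_smul_comm, h.K, smul_comm]

theorem add (h : IsWt L w v) {v' : V} (h' : IsWt L w v') : IsWt L w (v + v') where
  H j := by rw [smul_add, h.H, h'.H, smul_add]
  K γ := by rw [smul_add, h.K, h'.K, smul_add]

theorem map (h : IsWt L w v) (f : V →ₗ[U L] W) : IsWt L w (f v) where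
  H j := by rw [← map_smul, h.H, map_complex_smul]
  K γ := by rw [← map_smul, h.K, map_complex_smul]

theorem E (h : IsWt L w v) (k : Fin 2) : IsWt L (w + simpleRoot k) (E L k • v) where
  H j := by
    have := congrArg (· • v) (U.H_X (L := L) j k)
    simp only [sub_smul, mul_smul, h.H, smul_assoc, U_smul_comm, sub_eq_iff_eq_add] at this
    rw [this, Pi.add_apply, add_smul, add_comm]; rfl
  K γ := by
    have := congrArg (· • v) (U.K_mul_X (L := L) γ k)
    simp only [mul_smul, h.K, smul_assoc, U_smul_comm] at this
    rw [this, form_add_right, iPow_add, mul_smul, smul_comm]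

theorem F (h : IsWt L w v) (k : Fin 2) : IsWt L (w - simpleRoot k) (F L k • v) where
  H j := by
    have := congrArg (· • v) (U.H_Y (L := L) j k)
    simp only [sub_smul, mul_smul, h.H, smul_assoc, U_smul_comm, sub_eq_iff_eq_add] at this
    rw [this, Pi.sub_apply, sub_smul, neg_smul, sub_eq_neg_add]; rfl
  K γ := by
    have := congrArg (· • v) (U.K_mul_Y (L := L) γ k)
    simp only [mul_smul, h.K, smul_assoc, U_smul_comm] at this
    rw [this, form_sub_right, sub_eq_add_neg, iPow_add, mul_smul, smul_comm]

theorem hU (h : IsWt L w v) : hU L • v = ht w • v := by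
  rw [UnrolledSL3.hU, add_smul, h.H, h.H, ht, add_smul]

/-- `K_{±α_j}` acts on weight `w` by `𝐢 ^ (± w j)`, so the commutator becomes a quantum integer. -/
theorem E_F (h : IsWt L w v) (j : Fin 2) :
    UnrolledSL3.E L j • UnrolledSL3.F L j • v =
      UnrolledSL3.F L j • UnrolledSL3.E L j • v + qn (w j) • v := by
  have := congrArg (· • v) (U.X_Y (L := L) j)
  simp only [sub_smul, mul_smul, smul_assoc, h.K, sub_eq_iff_eq_add] at this
  rw [this, add_comm, ← qn_eq, mul_smul, sub_smul]
  congr 4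
  · congr 1; exact form_simpleRoot_left w j
  · congr 1
    rw [← form_simpleRoot_left w j, ← U.form_neg_left]; rfl

theorem zero (w : Wt) : IsWt L w (0 : V) where
  H j := by simp
  K γ := by simp

theorem mem_wtSpace (h : IsWt L w v) : v ∈ wtSpace L V w := h.H

end IsWt

theorem IsHW.map {w : Wt} {v : V} (h : IsHW L w v) (f : V →ₗ[U L] W) : IsHW L w (f v) where
  wt := h.wt.map f
  X j := by rw [← map_smul, h.X, map_zero]

theorem IsHW.smul {w : Wt} {v : V} (h : IsHW L w v) (c : ℂ) : IsHW L w (c • v) where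
  wt := h.wt.smul c
  X j := by rw [U_smul_comm, h.X, smul_zero]

/-! ### Weight modules -/

/-- `H_1` and `H_2` commute, and simultaneous eigenspaces of commuting operators are independent.
The independence clause in the definition of a weight module is therefore automatic. -/
theorem iSupIndep_wtSpace (L : QPLattice) (V : Type) [AddCommGroup V] [Module ℂ V] [Module (U L) V]
    [IsScalarTower ℂ (U L) V] : iSupIndep (wtSpace L V) := by
  let f : Fin 2 → Module.End ℂ V := fun j => Algebra.lsmul ℂ ℂ V (U.H j : U L)
  have hcomm : ∀ i j, Commute (f i) (f j) := fun i j => by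
    have := sub_eq_zero.mp (U.H_H (L := L) i j)
    show f i * f j = f j * f i
    rw [← map_mul, ← map_mul, this]
  have key := Module.End.independent_iInf_maxGenEigenspace_of_forall_mapsTo f
    (fun i j φ => Module.End.mapsTo_maxGenEigenspace_of_comm (hcomm j i) φ)
  refine key.mono fun w v hv => ?_
  rw [Submodule.mem_iInf]
  intro j
  exact Module.End.eigenspace_le_maxGenEigenspace (Module.End.mem_eigenspace_iff.mpr (hv j))

/-- A weight vector in a sum of weight vectors. -/
theorem exists_weight_decomposition {s : Set V} (hs : ∀ v ∈ s, ∃ w, IsWt L w v)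
    (v : V) (hv : v ∈ Submodule.span ℂ s) :
    ∃ f : Wt →₀ V, (∀ w, IsWt L w (f w)) ∧ (f.sum fun _ x => x) = v := by
  classical
  induction hv using Submodule.span_induction with
  | mem x hx =>
    obtain ⟨w, hw⟩ := hs x hx
    refine ⟨Finsupp.single w x, fun w' => ?_, by simp⟩
    by_cases h : w = w'
    · subst h; simpa using hw
    · rw [Finsupp.single_eq_of_ne' h]; exact .zero _
  | zero => exact ⟨0, fun w => .zero _, by simp⟩
  | add x y _ _ hx hy =>
    obtain ⟨f, hf, rfl⟩ := hx
    obtain ⟨g, hg, rfl⟩ := hy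
    exact ⟨f + g, fun w => (hf w).add (hg w), Finsupp.sum_add_index' (by simp) (by simp)⟩
  | smul c x _ hx =>
    obtain ⟨f, hf, rfl⟩ := hx
    refine ⟨c • f, fun w => (hf w).smul c, ?_⟩
    rw [Finsupp.sum_smul_index' (by simp), Finsupp.smul_sum]

/-- Uniqueness of weight components: a vector that is itself of weight `w` has no other component.
-/
theorem eq_of_weight_decomposition {f : Wt →₀ V} (hf : ∀ w, f w ∈ wtSpace L V w) {w : Wt} {v : V}
    (hv : v ∈ wtSpace L V w) (h : (f.sum fun _ x => x) = v) : f w = v := by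
  classical
  have hind := iSupIndep_wtSpace L V
  have h0 : ∀ g : Wt →₀ V, (∀ w, g w ∈ wtSpace L V w) → (g.sum fun _ x => x) = 0 → g = 0 :=
    fun g hg hs => by
      ext w
      by_contra hne
      have hmem : w ∈ g.support := by simpa using hne
      exact hne <| (iSupIndep_iff_finsetSum_eq_zero_imp_eq_zero _).mp hind g.support g
        (fun i _ => hg i) hs w hmem
  have := h0 (f - Finsupp.single w v) (fun w' => ?_) ?_
  · rw [sub_eq_zero] at this; rw [this, Finsupp.single_eq_same]
  · refine Submodule.sub_mem _ (hf w') ?_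
    by_cases hw : w = w'
    · subst hw; simpa using hv
    · rw [Finsupp.single_eq_of_ne' hw]; exact zero_mem _
  · rw [Finsupp.sum_sub_index (by simp), h, Finsupp.sum_single_index rfl, sub_self]

end Generators

section WeightModules

variable {L : QPLattice} {V W : Type} [AddCommGroup V] [Module ℂ V] [Module (U L) V]
  [IsScalarTower ℂ (U L) V] [AddCommGroup W] [Module ℂ W] [Module (U L) W]
  [IsScalarTower ℂ (U L) W]

theorem csmul_smul (a b : ℂ) (v : V) : a • b • v = (a * b) • v := smul_smul a b v

/-- For the `K`-condition, expand an `H`-eigenvector in vectors on which `K` acts correctly; by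
uniqueness it equals its own component. -/
theorem isWeightModule_of_span {s : Set V} (hs : ∀ v ∈ s, ∃ w, IsWt L w v)
    (htop : Submodule.span ℂ s = ⊤) : IsWeightModule L V where
  indep := iSupIndep_wtSpace L V
  iSup_eq_top := by
    rw [eq_top_iff, ← htop, Submodule.span_le]
    intro v hv
    obtain ⟨w, hw⟩ := hs v hv
    exact Submodule.mem_iSup_of_mem w hw.mem_wtSpace
  K_smul γ w v hv := by
    obtain ⟨f, hf, hfv⟩ := exists_weight_decomposition hs v (htop ▸ Submodule.mem_top)
    have := eq_of_weight_decomposition (fun w => (hf w).mem_wtSpace) hv hfv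
    rw [← this]
    exact (hf w).K γ

theorem IsWeightModule.isWt (hV : IsWeightModule L V) {w : Wt} {v : V} (hv : v ∈ wtSpace L V w) :
    IsWt L w v := ⟨hv, fun γ => hV.K_smul γ w v hv⟩

theorem IsWeightModule.span_eq_top (hV : IsWeightModule L V) :
    Submodule.span ℂ {v : V | ∃ w, IsWt L w v} = ⊤ := by
  rw [eq_top_iff, ← hV.iSup_eq_top, iSup_le_iff]
  exact fun w v hv => Submodule.subset_span ⟨w, hV.isWt hv⟩

theorem IsWeightModule.of_surjective (hV : IsWeightModule L V) (g : V →ₗ[U L] W)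
    (hg : Function.Surjective g) : IsWeightModule L W := by
  refine isWeightModule_of_span (s := g '' {v : V | ∃ w, IsWt L w v}) ?_ ?_
  · rintro _ ⟨v, ⟨w, hw⟩, rfl⟩
    exact ⟨w, hw.map g⟩
  · have := Submodule.map_span (g.restrictScalars ℂ) {v : V | ∃ w, IsWt L w v}
    rw [hV.span_eq_top, Submodule.map_top, (LinearMap.range_eq_top (f := g.restrictScalars ℂ)).mpr hg] at this
    exact this.symm

/-- Take any preimage and keep only its component of weight `w`; homomorphisms respect components.
-/
theorem IsWeightModule.exists_isWt_lift (hV : IsWeightModule L V) (g : V →ₗ[U L] W)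
    (hg : Function.Surjective g) {w : Wt} {b : W} (hb : IsWt L w b) : ∃ a, IsWt L w a ∧ g a = b := by
  obtain ⟨a, rfl⟩ := hg b
  obtain ⟨f, hf, hfa⟩ := exists_weight_decomposition (s := {v : V | ∃ w, IsWt L w v})
    (fun _ h => h) a (hV.span_eq_top ▸ Submodule.mem_top)
  refine ⟨f w, hf w, ?_⟩
  have h := eq_of_weight_decomposition (f := f.mapRange g g.map_zero) (w := w) (v := g a)
    (fun w' => ?_) hb.mem_wtSpace ?_
  · simpa using h
  · simpa using ((hf w').map g).mem_wtSpace
  · rw [Finsupp.sum_mapRange_index (by simp), ← hfa, Finsupp.sum, Finsupp.sum, map_sum]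

/-! ### Action on highest weight vectors -/

/-- `E_i` is moved through each word; every passage past an `F_i` leaves the quantum integer of the
weight reached there. The action of `E_j` follows by exchanging `i` and `j`. -/
theorem IsHW.fs {i j : Fin 2} (hij : i ≠ j) {w : Wt} {v : V} (h : IsHW L w v) :
    E L i • F L i • v = qn (w i) • v ∧
    E L i • F L j • v = 0 ∧
    E L i • F L j • F L i • v = qn (w i) • F L j • v ∧
    E L i • F L i • F L j • v = qn (w i + 1) • F L j • v ∧
    E L i • F L i • F L j • F L i • v =
      qn (w i) • F L i • F L j • v + qn (w i - 1) • F L j • F L i • v ∧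
    E L i • F L j • F L i • F L j • v = 0 ∧
    E L i • F L i • F L j • F L i • F L j • v = qn (w i) • F L j • F L i • F L j • v := by
  have s1 := simpleRoot_self i
  have s2 := simpleRoot_of_ne hij.symm
  have e1 : E L i • F L i • v = qn (w i) • v := by
    rw [h.wt.E_F, h.X, smul_zero, zero_add]
  have e1' : E L i • F L j • v = 0 := by rw [E_F_of_ne hij, h.X, smul_zero]
  have e2 : E L i • F L j • F L i • v = qn (w i) • F L j • v := by
    rw [E_F_of_ne hij, e1, U_smul_comm]
  have e2' : E L i • F L i • F L j • v = qn (w i + 1) • F L j • v := by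
    rw [(h.wt.F j).E_F, e1', smul_zero, zero_add, Pi.sub_apply, s2, sub_neg_eq_add]
  have e3' : E L i • F L j • F L i • F L j • v = 0 := by
    rw [E_F_of_ne hij, e2', U_smul_comm, F_F, smul_zero]
  refine ⟨e1, e1', e2, e2', ?_, e3', ?_⟩
  · rw [((h.wt.F i).F j).E_F, e2, U_smul_comm, Pi.sub_apply, Pi.sub_apply, s1, s2]
    congr 3; ring
  · rw [(((h.wt.F j).F i).F j).E_F, e3', smul_zero, zero_add, Pi.sub_apply, Pi.sub_apply,
      Pi.sub_apply, s1, s2]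
    congr 2; ring

/-- The scalar by which the product of the longest elements acts on a highest weight vector. -/
theorem IsHW.top {i j : Fin 2} (hij : i ≠ j) {w : Wt} {v : V} (h : IsHW L w v) :
    E L i • E L j • E L i • E L j • F L i • F L j • F L i • F L j • v =
      (qn (w i) * qn (w j) * qn (w i + w j - 1)) • v := by
  obtain ⟨a1, a1', a2, a2', a3, a3', a4⟩ := h.fs hij
  obtain ⟨b1, b1', b2, b2', b3, b3', b4⟩ := h.fs hij.symm
  have h1 : qn (w i - 1) = -qn (w i + 1) := by rw [qn_sub_one, qn_add_one]
  -- The innermost raising operator is `E_j`, so the braid relation first rewrites the lowering word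
  -- to begin with `F_j`.
  rw [F_braid hij, b4, U_smul_comm, a3]
  simp only [U_smul_comm, smul_add, b2, b2', a1, csmul_smul, ← add_smul]
  rw [qn_add_sub_one, h1]
  congr 1; ring

/-- The monomials in the negative generators, applied to a vector. -/
noncomputable def mono (L : QPLattice) {V : Type} [AddCommGroup V] [Module (U L) V] (i j : Fin 2)
    (v : V) : Fin 8 → V :=
  ![v, F L i • v, F L j • v, F L j • F L i • v, F L i • F L j • v, F L i • F L j • F L i • v,
    F L j • F L i • F L j • v, F L i • F L j • F L i • F L j • v]

/-- The degrees of the monomials. -/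
def mdeg : Fin 8 → ℕ := ![0, 1, 1, 2, 2, 3, 3, 4]

theorem IsWt.mono {w : Wt} {v : V} (h : IsWt L w v) (i j : Fin 2) (k : Fin 8) :
    ∃ w', IsWt L w' (mono L i j v k) ∧ ht w' = ht w - mdeg k := by
  fin_cases k
  · exact ⟨w, h, by simp [mdeg]⟩
  · exact ⟨_, h.F i, by simp [mdeg, ht_sub_simpleRoot]⟩
  · exact ⟨_, h.F j, by simp [mdeg, ht_sub_simpleRoot]⟩
  · exact ⟨_, (h.F i).F j, by simp [mdeg, ht_sub_simpleRoot]; ring⟩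
  · exact ⟨_, (h.F j).F i, by simp [mdeg, ht_sub_simpleRoot]; ring⟩
  · exact ⟨_, ((h.F i).F j).F i, by simp [mdeg, ht_sub_simpleRoot]; ring⟩
  · exact ⟨_, ((h.F j).F i).F j, by simp [mdeg, ht_sub_simpleRoot]; ring⟩
  · exact ⟨_, (((h.F j).F i).F j).F i, by simp [mdeg, ht_sub_simpleRoot]; ring⟩

/-- Squares vanish and the two alternating words of length four agree, so the lowering operators
produce nothing beyond the eight monomials. The raising operators shorten words by `IsHW.fs`. This
bounds every highest weight module by dimension eight. -/
theorem IsHW.smul_mem_span {i j : Fin 2} (hij : i ≠ j) {w : Wt} {v : V} (h : IsHW L w v) (u : U L) :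
    ∀ z ∈ Submodule.span ℂ (Set.range (mono L i j v)),
      u • z ∈ Submodule.span ℂ (Set.range (mono L i j v)) := by
  set N := Submodule.span ℂ (Set.range (mono L i j v)) with hN
  have m : ∀ k, mono L i j v k ∈ N := fun k => Submodule.subset_span ⟨k, rfl⟩
  have ind : ∀ u : U L, (∀ k, u • mono L i j v k ∈ N) → ∀ z ∈ N, u • z ∈ N := by
    intro u hu z hz
    induction hz using Submodule.span_induction with
    | mem x hx => obtain ⟨k, rfl⟩ := hx; exact hu k
    | zero => rw [smul_zero]; exact zero_mem _
    | add x y _ _ hx hy => rw [smul_add]; exact N.add_mem hx hy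
    | smul c x _ hx => rw [U_smul_comm]; exact N.smul_mem c hx
  obtain ⟨a1, a1', a2, a2', a3, a3', a4⟩ := h.fs hij
  obtain ⟨b1, b1', b2, b2', b3, b3', b4⟩ := h.fs hij.symm
  have m0 : v ∈ N := m 0
  have m1 : F L i • v ∈ N := m 1
  have m2 : F L j • v ∈ N := m 2
  have m3 : F L j • F L i • v ∈ N := m 3
  have m4 : F L i • F L j • v ∈ N := m 4
  have m5 : F L i • F L j • F L i • v ∈ N := m 5
  have m6 : F L j • F L i • F L j • v ∈ N := m 6
  have m7 : F L i • F L j • F L i • F L j • v ∈ N := m 7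
  have z0 : (0 : V) ∈ N := N.zero_mem
  refine smul_mem_of_generators N (fun k => ind _ fun l => ?_) (fun k => ind _ fun l => ?_)
    (fun k => ind _ fun l => ?_) (fun γ => ind _ fun l => ?_) u
  · obtain rfl | rfl := eq_or_eq_of_ne hij k
    · fin_cases l <;> simp only [mono, Fin.zero_eta, Fin.mk_one, Fin.reduceFinMk, Matrix.cons_val]
      · rw [h.X]; exact z0
      · rw [a1]; exact N.smul_mem _ m0
      · rw [a1']; exact z0
      · rw [a2]; exact N.smul_mem _ m2
      · rw [a2']; exact N.smul_mem _ m2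
      · rw [a3]; exact N.add_mem (N.smul_mem _ m4) (N.smul_mem _ m3)
      · rw [a3']; exact z0
      · rw [a4]; exact N.smul_mem _ m6
    · fin_cases l <;> simp only [mono, Fin.zero_eta, Fin.mk_one, Fin.reduceFinMk, Matrix.cons_val]
      · rw [h.X]; exact z0
      · rw [b1']; exact z0
      · rw [b1]; exact N.smul_mem _ m0
      · rw [b2']; exact N.smul_mem _ m1
      · rw [b2]; exact N.smul_mem _ m1
      · rw [b3']; exact z0
      · rw [b3]; exact N.add_mem (N.smul_mem _ m3) (N.smul_mem _ m4)
      · rw [F_braid hij, b4]; exact N.smul_mem _ m5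
  · obtain rfl | rfl := eq_or_eq_of_ne hij k
    · fin_cases l <;>
        simp only [mono, Fin.zero_eta, Fin.mk_one, Fin.reduceFinMk, Matrix.cons_val, F_F] <;>
        assumption
    · fin_cases l <;>
        simp only [mono, Fin.zero_eta, Fin.mk_one, Fin.reduceFinMk, Matrix.cons_val, F_F] <;>
        first
        | assumption
        | (rw [← F_braid hij]; assumption)
        | (rw [F_braid hij, F_F]; exact z0)
  · obtain ⟨w', hw', -⟩ := h.wt.mono i j l
    rw [hw'.H]; exact N.smul_mem _ (m l)
  · obtain ⟨w', hw', -⟩ := h.wt.mono i j l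
    rw [hw'.K]; exact N.smul_mem _ (m l)

theorem IsHW.mem_span_of_mem {i j : Fin 2} (hij : i ≠ j) {w : Wt} {v : V} (h : IsHW L w v) {z : V}
    (hz : z ∈ Submodule.span (U L) {v}) : z ∈ Submodule.span ℂ (Set.range (mono L i j v)) := by
  obtain ⟨u, rfl⟩ := Submodule.mem_span_singleton.mp hz
  exact h.smul_mem_span hij u _ (Submodule.subset_span ⟨0, rfl⟩)

/-! ### Separating degrees -/

theorem aeval_hU_smul {c : ℂ} {z : V} (hz : hU L • z = c • z) (q : Polynomial ℂ) :
    Polynomial.aeval (hU L) q • z = q.eval c • z := by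
  induction q using Polynomial.induction_on' with
  | add p q hp hq => rw [map_add, add_smul, hp, hq, Polynomial.eval_add, add_smul]
  | monomial n a =>
    rw [Polynomial.aeval_monomial, Polynomial.eval_monomial, mul_smul, mul_smul, algebraMap_smul]
    congr 1
    induction n with
    | zero => simp
    | succ n ih => rw [pow_succ, mul_smul, hz, U_smul_comm, ih, smul_smul, pow_succ, mul_comm]

/-- The Lagrange polynomial in the sum of the Cartan generators that projects to the vectors of
height `t - n`, up to a scalar. -/
noncomputable def lag (L : QPLattice) (t : ℂ) (n : ℕ) : U L :=
  Polynomial.aeval (hU L)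
    (∏ m ∈ (Finset.range 5).erase n, (Polynomial.X - Polynomial.C (t - m)))

/-- The scalar by which `lag L t n` acts on vectors of height `t - n`. -/
def lagC (n : ℕ) : ℂ := ∏ m ∈ (Finset.range 5).erase n, ((m : ℂ) - n)

theorem lagC_ne_zero (n : ℕ) : lagC n ≠ 0 := by
  refine Finset.prod_ne_zero_iff.mpr fun m hm => sub_ne_zero.mpr ?_
  exact_mod_cast (Finset.mem_erase.mp hm).1

theorem lag_smul_self {t : ℂ} {n : ℕ} {z : V} (hz : hU L • z = (t - n) • z) :
    lag L t n • z = lagC n • z := by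
  rw [lag, aeval_hU_smul hz, Polynomial.eval_prod]
  congr 1
  exact Finset.prod_congr rfl fun m _ => by simp

theorem lag_smul_of_ne {t : ℂ} {n m : ℕ} (hm : m < 5) (hmn : m ≠ n) {z : V}
    (hz : hU L • z = (t - m) • z) : lag L t n • z = 0 := by
  rw [lag, aeval_hU_smul hz, Polynomial.eval_prod,
    Finset.prod_eq_zero (i := m) (by simp [hm, hmn]) (by simp), zero_smul]

theorem IsWt.hU_mono {w : Wt} {v : V} (h : IsWt L w v) (i j : Fin 2) (k : Fin 8) :
    UnrolledSL3.hU L • UnrolledSL3.mono L i j v k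
      = (ht w - mdeg k) • UnrolledSL3.mono L i j v k := by
  obtain ⟨w', hw', e⟩ := h.mono i j k
  rw [hw'.hU, e]

theorem mdeg_lt (k : Fin 8) : mdeg k < 5 := by revert k; decide

/-- Each monomial is an eigenvector of `H_1 + H_2`, with eigenvalue determined by its degree. The
degrees run from `0` to `4`, and the Lagrange polynomial vanishes at all of them but `n`. -/
theorem lag_smul_sum {w : Wt} {v : V} (h : IsWt L w v) (i j : Fin 2) (c : Fin 8 → ℂ) (n : ℕ) :
    lag L (ht w) n • ∑ k, c k • mono L i j v k =
      lagC n • ∑ k, if mdeg k = n then c k • mono L i j v k else 0 := by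
  rw [Finset.smul_sum, Finset.smul_sum]
  refine Finset.sum_congr rfl fun k _ => ?_
  rw [U_smul_comm]
  split_ifs with hk
  · rw [lag_smul_self (by rw [h.hU_mono, hk]), smul_comm]
  · rw [lag_smul_of_ne (mdeg_lt k) hk (h.hU_mono i j k), smul_zero, smul_zero]

/-- A vector of height `ht w - n` generated by a vector of weight `w` is a combination of monomials
of degree `n`. -/
theorem exists_eq_sum_of_height {w : Wt} {v : V} (h : IsWt L w v) (i j : Fin 2) {z : V}
    (hz : z ∈ Submodule.span ℂ (Set.range (mono L i j v))) {n : ℕ}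
    (hzn : hU L • z = (ht w - n) • z) :
    ∃ c : Fin 8 → ℂ, z = ∑ k, if mdeg k = n then c k • mono L i j v k else 0 := by
  obtain ⟨c, rfl⟩ := (Submodule.mem_span_range_iff_exists_fun ℂ).mp hz
  refine ⟨c, ?_⟩
  have := lag_smul_self hzn
  rw [lag_smul_sum h] at this
  exact (smul_right_injective V (lagC_ne_zero n) this).symm

/-- Relations among the monomials are homogeneous, even when the monomials are dependent. -/
theorem sum_degree_eq_zero {w : Wt} {v : V} (h : IsWt L w v) (i j : Fin 2) {c : Fin 8 → ℂ}
    (hc : ∑ k, c k • mono L i j v k = 0) (n : ℕ) :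
    (∑ k, if mdeg k = n then c k • mono L i j v k else 0) = 0 := by
  have := lag_smul_sum h i j c n
  rw [hc, smul_zero] at this
  exact (smul_eq_zero.mp this.symm).resolve_left (lagC_ne_zero n)

theorem IsHW.eq_smul_of_height {w : Wt} {v : V} (h : IsHW L w v) {z : V}
    (hz : z ∈ Submodule.span (U L) {v}) (hzn : hU L • z = ht w • z) : ∃ c : ℂ, z = c • v := by
  obtain ⟨c, hc⟩ := exists_eq_sum_of_height (n := 0) h.wt 0 1
    (h.mem_span_of_mem (by decide) hz) (by simpa using hzn)
  exact ⟨c 0, by simpa [Fin.sum_univ_eight, mdeg, mono] using hc⟩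

theorem IsHW.eq_smul_of_isWt_sub {i j : Fin 2} (hij : i ≠ j) {w : Wt} {v : V} (h : IsHW L w v) {z : V}
    (hz : z ∈ Submodule.span (U L) {v}) (hzw : IsWt L (w - simpleRoot i) z) :
    ∃ c : ℂ, z = c • F L i • v := by
  obtain ⟨c, hc⟩ := exists_eq_sum_of_height (n := 1) h.wt i j (h.mem_span_of_mem hij hz)
    (by rw [hzw.hU, ht_sub_simpleRoot]; simp)
  simp [Fin.sum_univ_eight, mdeg, mono] at hc
  refine ⟨c 1, ?_⟩
  -- `F_i v` and `F_j v` have the same height. `H_i` separates them: its eigenvalues are `w i - 2`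
  -- and `w i + 1`, whose difference is the `3` below.
  have h1 := hzw.H i
  have s1 := simpleRoot_self i
  have s2 := simpleRoot_of_ne hij.symm
  rw [hc, smul_add, U_smul_comm, U_smul_comm, (h.wt.F i).H, (h.wt.F j).H] at h1
  simp only [Pi.sub_apply, s1, s2] at h1
  have h2 : (3 : ℂ) • c 2 • F L j • v = 0 := by
    rw [← sub_eq_zero] at h1
    rw [← h1]
    generalize F L i • v = x
    generalize F L j • v = y
    module
  rw [hc, (smul_eq_zero.mp h2).resolve_left (by norm_num), add_zero]

theorem IsHW.eq_add_of_isWt_sub {i j : Fin 2} (hij : i ≠ j) {w : Wt} {v : V} (h : IsHW L w v) {z : V}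
    (hz : z ∈ Submodule.span (U L) {v}) (hzw : IsWt L (w - simpleRoot i - simpleRoot j) z) :
    ∃ c d : ℂ, z = c • F L j • F L i • v + d • F L i • F L j • v := by
  obtain ⟨c, hc⟩ := exists_eq_sum_of_height (n := 2) h.wt i j (h.mem_span_of_mem hij hz)
    (by rw [hzw.hU, ht_sub_simpleRoot, ht_sub_simpleRoot]; congr 1; push_cast; ring)
  exact ⟨c 3, c 4, by simpa [Fin.sum_univ_eight, mdeg, mono] using hc⟩

/-- A relation is split by degree and then raised. Degree one is detected by the two simple quantum
integers, degree two by a determinant equal to `[w i + w j - 1]`, degree three reduces to degree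
two, and degree four is `IsHW.top`. -/
theorem linearIndependent_mono {i j : Fin 2} (hij : i ≠ j) {w : Wt} {v : V} (h : IsHW L w v)
    (hv : v ≠ 0) (ha : qn (w i) ≠ 0) (hb : qn (w j) ≠ 0) (hab : qn (w i + w j - 1) ≠ 0) :
    LinearIndependent ℂ (mono L i j v) := by
  obtain ⟨a1, a1', a2, a2', a3, a3', a4⟩ := h.fs hij
  obtain ⟨b1, b1', b2, b2', b3, b3', b4⟩ := h.fs hij.symm
  have hi : F L i • v ≠ 0 := fun h0 => smul_ne_zero ha hv (by rw [← a1, h0, smul_zero])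
  have hj : F L j • v ≠ 0 := fun h0 => smul_ne_zero hb hv (by rw [← b1, h0, smul_zero])
  have h2 : ∀ c d : ℂ, c • F L j • F L i • v + d • F L i • F L j • v = 0 → c = 0 ∧ d = 0 := by
    intro c d hcd
    have h1 := congrArg (E L i • ·) hcd
    have h2 := congrArg (E L j • ·) hcd
    simp only [smul_add, U_smul_comm, a2, a2', b2, b2', smul_zero, csmul_smul, ← add_smul,
      smul_eq_zero, hi, hj, or_false] at h1 h2
    -- The addition formula identifies `hab` with the determinant of the system `h1`, `h2`; what
    -- follows is Cramer's rule.
    rw [qn_add_sub_one] at hab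
    constructor
    · refine (mul_eq_zero.mp ?_).resolve_right hab
      linear_combination qn (w j) * h1 - qn (w i + 1) * h2
    · refine (mul_eq_zero.mp ?_).resolve_right hab
      linear_combination qn (w i) * h2 - qn (w j + 1) * h1
  have h3 : ∀ c d : ℂ, c • F L i • F L j • F L i • v + d • F L j • F L i • F L j • v = 0 →
      c = 0 ∧ d = 0 := by
    intro c d hcd
    have h1 := congrArg (E L i • ·) hcd
    have h2' := congrArg (E L j • ·) hcd
    simp only [smul_add, U_smul_comm, a3, a3', b3, b3', smul_zero, csmul_smul, add_zero,
      zero_add] at h1 h2'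
    rw [add_comm] at h1
    exact ⟨(mul_eq_zero.mp (h2 _ _ h1).2).resolve_right ha,
      (mul_eq_zero.mp (h2 _ _ h2').1).resolve_right hb⟩
  rw [Fintype.linearIndependent_iff]
  intro c hc
  have d0 := sum_degree_eq_zero h.wt i j hc 0
  have d1 := sum_degree_eq_zero h.wt i j hc 1
  have d2 := sum_degree_eq_zero h.wt i j hc 2
  have d3 := sum_degree_eq_zero h.wt i j hc 3
  have d4 := sum_degree_eq_zero h.wt i j hc 4
  simp [Fin.sum_univ_eight, mdeg, mono, hv] at d0 d1 d2 d3 d4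
  have c1 := congrArg (E L i • ·) d1
  have c2 := congrArg (E L j • ·) d1
  simp only [smul_add, U_smul_comm, a1, a1', b1, b1', smul_zero, csmul_smul, add_zero,
      zero_add, smul_eq_zero, hv, or_false, mul_eq_zero, ha, hb] at c1 c2
  have c4 : c 7 = 0 := by
    refine d4.resolve_right fun h0 => ?_
    have := h.top hij
    rw [h0] at this
    simp only [smul_zero] at this
    exact smul_ne_zero (mul_ne_zero (mul_ne_zero ha hb) hab) hv this.symm
  obtain ⟨c3, c3'⟩ := h2 _ _ d2
  obtain ⟨c5, c6⟩ := h3 _ _ d3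
  intro k
  fin_cases k <;> assumption

/-- Every nonzero weight vector generates a nonzero highest weight vector. -/
theorem IsWt.exists_isHW {w : Wt} {a : V} (h : IsWt L w a) (ha : a ≠ 0) :
    ∃ x, ∃ b : V, b ≠ 0 ∧ IsHW L x b := by
  have hne : (0 : Fin 2) ≠ 1 := by decide
  have hw : ∀ {x : Wt} {b : V}, IsWt L x b → b ≠ 0 →
      UnrolledSL3.E L 0 • b = 0 → UnrolledSL3.E L 1 • b = 0 →
      ∃ x, ∃ b : V, b ≠ 0 ∧ IsHW L x b :=
    fun {x b} hb hb0 h0 h1 => ⟨x, b, hb0, hb, fun j => by fin_cases j <;> assumption⟩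
  -- Apply the two raising operators alternately and stop at the last nonzero vector. The operator
  -- used last kills it because squares vanish; for words of length four the braid relation takes
  -- care of the other operator.
  by_cases h1 : UnrolledSL3.E L 1 • a = 0
  · by_cases h2 : UnrolledSL3.E L 0 • a = 0
    · exact hw h ha h2 h1
    by_cases h3 : UnrolledSL3.E L 1 • UnrolledSL3.E L 0 • a = 0
    · exact hw (h.E 0) h2 (E_E _ _) h3
    by_cases h4 : UnrolledSL3.E L 0 • UnrolledSL3.E L 1 • UnrolledSL3.E L 0 • a = 0
    · exact hw ((h.E 0).E 1) h3 h4 (E_E _ _)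
    · refine hw (((h.E 0).E 1).E 0) h4 (E_E _ _) ?_
      rw [← E_braid hne, h1]; simp only [smul_zero]
  · by_cases h3 : UnrolledSL3.E L 0 • UnrolledSL3.E L 1 • a = 0
    · exact hw (h.E 1) h1 h3 (E_E _ _)
    by_cases h4 : UnrolledSL3.E L 1 • UnrolledSL3.E L 0 • UnrolledSL3.E L 1 • a = 0
    · exact hw ((h.E 1).E 0) h3 (E_E _ _) h4
    by_cases h5 : UnrolledSL3.E L 0 • UnrolledSL3.E L 1 • UnrolledSL3.E L 0 •
        UnrolledSL3.E L 1 • a = 0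
    · exact hw (((h.E 1).E 0).E 1) h4 h5 (E_E _ _)
    · refine hw ((((h.E 1).E 0).E 1).E 0) h5 (E_E _ _) ?_
      rw [E_braid hne, E_E]

/-- Lifting of highest weight vectors of typical weight along homomorphisms. -/
theorem exists_isHW_lift (g : V →ₗ[U L] W) {w : Wt} {a : V} {b : W} (ha : IsWt L w a)
    (hb : IsHW L w b) (hab : g a = b)
    (hw : qn (w 0) * qn (w 1) * qn (w 0 + w 1 - 1) ≠ 0) : ∃ a', IsHW L w a' ∧ g a' = b := by
  have hne : (0 : Fin 2) ≠ 1 := by decide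
  set c := qn (w 0) * qn (w 1) * qn (w 0 + w 1 - 1)
  have hwt := ((((((((ha.F 1).F 0).F 1).F 0).E 1).E 0).E 1).E 0)
  have e : w - simpleRoot 1 - simpleRoot 0 - simpleRoot 1 - simpleRoot 0 + simpleRoot 1 +
      simpleRoot 0 + simpleRoot 1 + simpleRoot 0 = w := by abel
  rw [e] at hwt
  -- The longest raising word sends every vector to one killed by both `E`s, and after the longest
  -- lowering word the weight is `w` again. On `b` the product is the scalar `c`.
  refine ⟨c⁻¹ • E L 0 • E L 1 • E L 0 • E L 1 • F L 0 • F L 1 • F L 0 • F L 1 • a,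
    IsHW.smul ⟨hwt, fun j => ?_⟩ _, ?_⟩
  · fin_cases j
    · exact E_E _ _
    · rw [E_braid hne]; exact E_E _ _
  · simp only [map_complex_smul, map_smul, hab]
    rw [hb.top hne, smul_smul, inv_mul_cancel₀ hw, one_smul]

end WeightModules

/-! ### Existence of highest weight modules

The four-dimensional modules below have highest weight vectors of weight `w` whenever `w` vanishes
on one of the simple coroots; tensor products of two of them yield all weights. -/

section Model

/-- The weights of the standard basis of the four-dimensional model. -/
def modelWt (i j : Fin 2) (w : Wt) : Fin 4 → Wt :=
  ![w, w - simpleRoot j, w - simpleRoot j - simpleRoot i, w - simpleRoot j - simpleRoot i - simpleRoot j]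

/-- The matrices of the positive generators. -/
noncomputable def modelX (j : Fin 2) (w : Wt) (k : Fin 2) : Matrix (Fin 4) (Fin 4) ℂ :=
  if k = j then !![0, qn (w j), 0, 0; 0, 0, 0, 0; 0, 0, 0, qn (w j - 1); 0, 0, 0, 0]
  else !![0, 0, 0, 0; 0, 0, 1, 0; 0, 0, 0, 0; 0, 0, 0, 0]

/-- The matrices of the negative generators. -/
noncomputable def modelY (j k : Fin 2) : Matrix (Fin 4) (Fin 4) ℂ :=
  if k = j then !![0, 0, 0, 0; 1, 0, 0, 0; 0, 0, 0, 0; 0, 0, 1, 0]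
  else !![0, 0, 0, 0; 0, 0, 0, 0; 0, 1, 0, 0; 0, 0, 0, 0]

/-- The matrices of the generators. -/
noncomputable def modelGen (L : QPLattice) (i j : Fin 2) (w : Wt) :
    Gen L → Matrix (Fin 4) (Fin 4) ℂ
  | .X k => modelX j w k
  | .Y k => modelY j k
  | .H k => Matrix.diagonal fun n => modelWt i j w n k
  | .K γ => Matrix.diagonal fun n => iPow (form γ (modelWt i j w n))

variable {i j : Fin 2} (hij : i ≠ j) (w : Wt)
include hij

/-- All that the relations with `H` and `K` need: nonzero entries join weights that differ by the
simple root. -/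
theorem modelX_wt (k : Fin 2) (n m : Fin 4) :
    modelX j w k n m = 0 ∨ modelWt i j w n = modelWt i j w m + simpleRoot k := by
  obtain rfl | rfl := eq_or_eq_of_ne hij k
  · fin_cases n <;> fin_cases m <;> simp [modelX, modelWt, hij]
  · fin_cases n <;> fin_cases m <;> simp [modelX, modelWt]

theorem modelY_wt (k : Fin 2) (n m : Fin 4) :
    modelY j k n m = 0 ∨ modelWt i j w n = modelWt i j w m + -simpleRoot k := by
  obtain rfl | rfl := eq_or_eq_of_ne hij k
  · fin_cases n <;> fin_cases m <;> simp [modelY, modelWt, hij, sub_eq_add_neg]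
  · fin_cases n <;> fin_cases m <;> simp [modelY, modelWt, sub_eq_add_neg]

end Model

theorem diagonal_conj_of_wt {wt : Fin 4 → Wt} {M : Matrix (Fin 4) (Fin 4) ℂ} {α : Wt}
    (h : ∀ n m, M n m = 0 ∨ wt n = wt m + α) (γ : Wt) :
    (Matrix.diagonal fun n => iPow (form γ (wt n))) * M *
      (Matrix.diagonal fun n => iPow (form (-γ) (wt n))) = iPow (form γ α) • M := by
  ext n m
  rw [Matrix.mul_diagonal, Matrix.diagonal_mul, Matrix.smul_apply, smul_eq_mul]
  obtain h0 | h0 := h n m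
  · simp [h0]
  · have e : iPow (form γ (wt m)) * iPow (form (-γ) (wt m)) = 1 := by
      rw [← iPow_add, U.form_neg_left, add_neg_cancel, iPow_zero]
    rw [h0, form_add_right, iPow_add]
    linear_combination iPow (form γ α) * M n m * e

theorem diagonal_comm_of_wt {wt : Fin 4 → Wt} {M : Matrix (Fin 4) (Fin 4) ℂ} {α : Wt}
    (h : ∀ n m, M n m = 0 ∨ wt n = wt m + α) (k : Fin 2) :
    (Matrix.diagonal fun n => wt n k) * M - M * (Matrix.diagonal fun n => wt n k) = α k • M := by
  ext n m
  rw [Matrix.sub_apply, Matrix.mul_diagonal, Matrix.diagonal_mul, Matrix.smul_apply, smul_eq_mul]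
  obtain h0 | h0 := h n m
  · simp [h0]
  · rw [h0, Pi.add_apply]; ring

/-- The basis models `v, F_j v, F_i F_j v, F_j F_i F_j v` with `F_i v = 0`. The condition `w i = 0`
makes this consistent, since `[0] = 0`. Only degrees `0` to `3` occur, so both sides of each braid
relation act by zero. -/
theorem modelGen_rel (L : QPLattice) {i j : Fin 2} (hij : i ≠ j) (w : Wt) (hw : w i = 0)
    ⦃a b : FreeAlgebra ℂ (Gen L)⦄ (h : Rel L a b) :
    FreeAlgebra.lift ℂ (modelGen L i j w) a = FreeAlgebra.lift ℂ (modelGen L i j w) b := by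
  have s1 := simpleRoot_self i
  have s2 := simpleRoot_self j
  have s3 := simpleRoot_of_ne hij
  have s4 := simpleRoot_of_ne hij.symm
  have hX : ∀ k, modelX j w k ^ 2 = 0 := fun k => by
    obtain rfl | rfl := eq_or_eq_of_ne hij k <;>
      · rw [pow_two]; ext n m
        fin_cases n <;> fin_cases m <;> simp [modelX, hij, Matrix.mul_apply, Fin.sum_univ_four]
  have hY : ∀ k, modelY j k ^ 2 = 0 := fun k => by
    obtain rfl | rfl := eq_or_eq_of_ne hij k <;>
      · rw [pow_two]; ext n m
        fin_cases n <;> fin_cases m <;> simp [modelY, hij, Matrix.mul_apply, Fin.sum_univ_four]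
  have hXX : ∀ k l, k ≠ l → (modelX j w k * modelX j w l) ^ 2 = 0 := fun k l hkl => by
    obtain rfl | rfl := eq_or_eq_of_ne hij k <;> obtain rfl | rfl := eq_or_eq_of_ne hij l <;>
      first
      | exact absurd rfl hkl
      | (rw [pow_two]; ext n m
         fin_cases n <;> fin_cases m <;> simp [modelX, hij, Matrix.mul_apply, Fin.sum_univ_four])
  have hYY : ∀ k l, k ≠ l → (modelY j k * modelY j l) ^ 2 = 0 := fun k l hkl => by
    obtain rfl | rfl := eq_or_eq_of_ne hij k <;> obtain rfl | rfl := eq_or_eq_of_ne hij l <;>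
      first
      | exact absurd rfl hkl
      | (rw [pow_two]; ext n m
         fin_cases n <;> fin_cases m <;> simp [modelY, hij, Matrix.mul_apply, Fin.sum_univ_four])
  have hne : (0 : Fin 2) ≠ 1 := by decide
  induction h with
  | K_zero =>
    simp [Free.K, modelGen, form, iPow_zero]
  | K_add γ δ =>
    simp [Free.K, modelGen, form_add_left, iPow_add]
  | K_X γ k =>
    simp only [Free.K, Free.X, map_mul, map_smul, FreeAlgebra.lift_ι_apply, modelGen]
    exact diagonal_conj_of_wt (modelX_wt hij w k) γ
  | K_Y γ k =>
    simp only [Free.K, Free.Y, map_mul, map_smul, FreeAlgebra.lift_ι_apply, modelGen]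
    rw [← form_neg_right]
    exact diagonal_conj_of_wt (modelY_wt hij w k) γ
  | X_Y k =>
    have hK : (2 * Complex.I)⁻¹ • (modelGen L i j w (.K (L.sr k)) - modelGen L i j w (.K (-L.sr k))) =
        Matrix.diagonal fun n => qn (modelWt i j w n k) := by
      ext n m
      simp only [modelGen, Matrix.smul_apply, Matrix.sub_apply, Matrix.diagonal_apply]
      split_ifs with h
      · rw [← qn_eq, smul_eq_mul]
        have e1 : form (L.sr k) (modelWt i j w n) = modelWt i j w n k := form_simpleRoot_left _ _
        have e2 : form ((-L.sr k : L.carrier) : Wt) (modelWt i j w n) = -modelWt i j w n k := by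
          rw [← form_simpleRoot_left (modelWt i j w n) k, ← U.form_neg_left]; rfl
        rw [e1, e2]
      · simp
    simp only [Free.K, Free.X, Free.Y, map_mul, map_sub, map_smul, FreeAlgebra.lift_ι_apply]
    rw [hK]
    have q1 : qn (w j - 1 - 2) = - qn (w j - 1) := qn_sub_two _
    have q2 : qn (w j - 2) = - qn (w j) := qn_sub_two _
    obtain rfl | rfl := eq_or_eq_of_ne hij k
    · ext n m
      fin_cases n <;> fin_cases m <;>
        simp [modelGen, modelX, modelY, modelWt, hij, hw, s1,
          s4, qn_zero, qn_one] <;> norm_num [qn_zero, qn_one, qn_neg]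
    · ext n m
      fin_cases n <;> fin_cases m <;>
        simp [modelGen, modelX, modelY, modelWt, s2, s3]
      · exact q2.symm
      · congr 1; ring
      · rw [← q1]; congr 1; ring
  | X_Y_of_ne k l hne =>
    simp only [Free.X, Free.Y, map_mul, map_sub, map_zero, FreeAlgebra.lift_ι_apply, modelGen]
    obtain rfl | rfl := eq_or_eq_of_ne hij k <;> obtain rfl | rfl := eq_or_eq_of_ne hij l <;>
      first
      | exact absurd rfl hne
      | (ext n m
         fin_cases n <;> fin_cases m <;>
          simp [modelX, modelY, hij])
  | X_sq k =>
    simpa only [Free.X, map_pow, map_zero, FreeAlgebra.lift_ι_apply, modelGen] using hX k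
  | Y_sq k =>
    simpa only [Free.Y, map_pow, map_zero, FreeAlgebra.lift_ι_apply, modelGen] using hY k
  | X_braid =>
    simp only [Free.X, map_mul, map_pow, FreeAlgebra.lift_ι_apply, modelGen]
    rw [hXX _ _ hne, hXX _ _ hne.symm]
  | Y_braid =>
    simp only [Free.Y, map_mul, map_pow, FreeAlgebra.lift_ι_apply, modelGen]
    rw [hYY _ _ hne, hYY _ _ hne.symm]
  | H_X k l =>
    simp only [Free.H, Free.X, map_mul, map_sub, map_smul, FreeAlgebra.lift_ι_apply, modelGen]
    exact diagonal_comm_of_wt (modelX_wt hij w l) k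
  | H_Y k l =>
    simp only [Free.H, Free.Y, map_mul, map_sub, map_smul, FreeAlgebra.lift_ι_apply, modelGen]
    exact diagonal_comm_of_wt (modelY_wt hij w l) k
  | H_H k l =>
    simp [Free.H, modelGen, mul_comm]
  | H_K k γ =>
    simp [Free.H, Free.K, modelGen, mul_comm]

/-- The four-dimensional representation. -/
noncomputable def modelRep (L : QPLattice) {i j : Fin 2} (hij : i ≠ j) (w : Wt) (hw : w i = 0) :
    U L →ₐ[ℂ] Matrix (Fin 4) (Fin 4) ℂ :=
  RingQuot.liftAlgHom ℂ ⟨FreeAlgebra.lift ℂ (modelGen L i j w), modelGen_rel L hij w hw⟩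

theorem modelRep_mk (L : QPLattice) {i j : Fin 2} (hij : i ≠ j) (w : Wt) (hw : w i = 0)
    (g : Gen L) : modelRep L hij w hw (U.mk L (FreeAlgebra.ι ℂ g)) = modelGen L i j w g := by
  refine (RingQuot.liftAlgHom_mkAlgHom_apply ℂ (FreeAlgebra.lift ℂ (modelGen L i j w))
    (modelGen_rel L hij w hw) _).trans ?_
  rw [FreeAlgebra.lift_ι_apply]

/-- There is a module with a nonzero highest weight vector of weight `w`. -/
def HasHW (L : QPLattice) (w : Wt) : Prop :=
  ∃ (V : Type) (_ : AddCommGroup V) (_ : Module ℂ V) (_ : Module (U L) V)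
    (_ : IsScalarTower ℂ (U L) V) (v : V), v ≠ 0 ∧ IsHW L w v

theorem hasHW_of_apply_eq_zero (L : QPLattice) {i j : Fin 2} (hij : i ≠ j) {w : Wt} (hw : w i = 0) :
    HasHW L w := by
  let f : U L →ₐ[ℂ] Module.End ℂ (Fin 4 → ℂ) :=
    (Matrix.toLinAlgEquiv' : Matrix (Fin 4) (Fin 4) ℂ ≃ₐ[ℂ] _).toAlgHom.comp (modelRep L hij w hw)
  let _ : Module (U L) (Fin 4 → ℂ) := Module.compHom (Fin 4 → ℂ) f.toRingHom
  have hsm : ∀ (g : Gen L) (v : Fin 4 → ℂ),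
      U.mk L (FreeAlgebra.ι ℂ g) • v = (modelGen L i j w g).mulVec v := fun g v => by
    change f (U.mk L (FreeAlgebra.ι ℂ g)) v = _
    simp only [f, AlgHom.comp_apply, modelRep_mk]
    exact Matrix.toLinAlgEquiv'_apply _ _
  have : IsScalarTower ℂ (U L) (Fin 4 → ℂ) :=
    ⟨fun c u v => by
      change f (c • u) v = c • f u v
      rw [map_smul]; rfl⟩
  refine ⟨Fin 4 → ℂ, _, _, _, this, Pi.single 0 1, ?_, ⟨⟨fun k => ?_, fun γ => ?_⟩, fun k => ?_⟩⟩
  · exact fun h => one_ne_zero (α := ℂ) (by simpa using congrFun h 0)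
  · refine (hsm (.H k) _).trans ?_
    ext n; fin_cases n <;> simp [modelGen, Matrix.mulVec_diagonal, modelWt]
  · refine (hsm (.K γ) _).trans ?_
    ext n; fin_cases n <;> simp [modelGen, Matrix.mulVec_diagonal, modelWt]
  · refine (hsm (.X k) _).trans ?_
    obtain rfl | rfl := eq_or_eq_of_ne hij k <;>
    · ext n; fin_cases n <;> simp [modelGen, modelX, hij]

/-! ### Tensor products -/

section Tensor

variable {L : QPLattice} {V W : Type} [AddCommGroup V] [Module ℂ V] [Module (U L) V]
  [IsScalarTower ℂ (U L) V] [AddCommGroup W] [Module ℂ W] [Module (U L) W]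
  [IsScalarTower ℂ (U L) W]

open TensorMod in
theorem TensorMod.Y_smul_tmul (j : Fin 2) (v : V) (w : W) :
    F L j • tmul V W v w = tmul V W (F L j • v) w +
      tmul V W ((U.K (-L.sr j) : U L) • v) (F L j • w) := by
  rw [smul_tmul_of_comul (U.comul_Y j) v w, one_smul]

open TensorMod in
theorem TensorMod.H_smul_tmul (j : Fin 2) (v : V) (w : W) :
    (U.H j : U L) • tmul V W v w = tmul V W v ((U.H j : U L) • w) +
      tmul V W ((U.H j : U L) • v) w := by
  rw [smul_tmul_of_comul (U.comul_H j) v w, one_smul, one_smul]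

open TensorMod in
theorem TensorMod.K_smul_tmul (γ : L.carrier) (v : V) (w : W) :
    (U.K γ : U L) • tmul V W v w = tmul V W ((U.K γ : U L) • v) ((U.K γ : U L) • w) := by
  rw [smul_tmul_of_comul (a := U.K γ) (b := U.K γ) (c := 0) (d := 0)
    (by rw [U.comul_K, TensorProduct.zero_tmul, add_zero]) v w, zero_smul]
  exact (congrArg (fun t : V ⊗[ℂ] W => ((U.K γ : U L) • v) ⊗ₜ[ℂ] ((U.K γ : U L) • w) + t)
    (TensorProduct.zero_tmul V _)).trans (add_zero _)

theorem IsWt.tmul {x y : Wt} {v : V} {w : W} (hv : IsWt L x v) (hw : IsWt L y w) :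
    IsWt L (x + y) (TensorMod.tmul V W v w) where
  H j := by
    rw [TensorMod.H_smul_tmul, hv.H, hw.H, Pi.add_apply, add_smul, add_comm]
    exact congrArg₂ (· + ·) (TensorProduct.smul_tmul' _ _ _).symm (TensorProduct.tmul_smul _ _ _)
  K γ := by
    rw [TensorMod.K_smul_tmul, hv.K, hw.K, form_add_right, iPow_add, mul_smul]
    exact (TensorProduct.smul_tmul' _ _ _).symm.trans (congrArg _ (TensorProduct.tmul_smul _ _ _))

theorem IsHW.tmul {x y : Wt} {v : V} {w : W} (hv : IsHW L x v) (hw : IsHW L y w) :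
    IsHW L (x + y) (TensorMod.tmul V W v w) where
  wt := hv.wt.tmul hw.wt
  X j := by
    rw [TensorMod.X_smul_tmul, hv.X, hw.X]
    exact (congrArg₂ (· + ·) (TensorProduct.zero_tmul V _) (TensorProduct.tmul_zero W _)).trans
      (add_zero _)

theorem IsWeightModule.tensorMod (hV : IsWeightModule L V) (hW : IsWeightModule L W) :
    IsWeightModule L (TensorMod V W) := by
  refine isWeightModule_of_span (s := Set.image2 (TensorMod.tmul V W)
    {v : V | ∃ w, IsWt L w v} {v : W | ∃ w, IsWt L w v}) ?_ ?_
  · rintro _ ⟨v, ⟨x, hv⟩, w, ⟨y, hw⟩, rfl⟩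
    exact ⟨x + y, hv.tmul hw⟩
  · have := Submodule.map₂_span_span ℂ (TensorProduct.mk ℂ V W) {v : V | ∃ w, IsWt L w v}
      {v : W | ∃ w, IsWt L w v}
    rw [hV.span_eq_top, hW.span_eq_top, TensorProduct.map₂_mk_top_top_eq_top] at this
    exact this.symm

end Tensor

theorem hasHW (L : QPLattice) (w : Wt) : HasHW L w := by
  obtain ⟨V, _, _, _, _, v, hv, hv'⟩ := hasHW_of_apply_eq_zero L (i := 0) (j := 1) (by decide)
    (w := ![0, w 1]) rfl
  obtain ⟨V', _, _, _, _, v', hv0, hv0'⟩ := hasHW_of_apply_eq_zero L (i := 1) (j := 0) (by decide)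
    (w := ![w 0, 0]) rfl
  refine ⟨TensorMod V V', inferInstance, inferInstance, inferInstance, inferInstance,
    TensorMod.tmul V V' v v', ?_, ?_⟩
  -- The pure tensor is nonzero because a product of functionals detects it.
  · obtain ⟨f, hf⟩ := not_forall.mp (mt (Module.forall_dual_apply_eq_zero_iff ℂ v).mp hv)
    obtain ⟨g, hg⟩ := not_forall.mp (mt (Module.forall_dual_apply_eq_zero_iff ℂ v').mp hv0)
    intro h
    have := congrArg (LinearMap.mul' ℂ ℂ ∘ₗ TensorProduct.map f g) h
    exact mul_ne_zero hf hg this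
  · have e : w = ![0, w 1] + ![w 0, 0] := by ext k; fin_cases k <;> simp
    rw [e]
    exact hv'.tmul hv0'

theorem LinearMap.ext_of_span_singleton {L : QPLattice} {V W : Type} [AddCommGroup V]
    [Module (U L) V] [AddCommGroup W] [Module (U L) W] {f g : V →ₗ[U L] W} {v : V}
    (hv : Submodule.span (U L) {v} = ⊤) (h : f v = g v) : f = g :=
  LinearMap.ext_on (s := {v}) hv (by rintro _ rfl; exact h)

/-! ### Heights and uniqueness of the highest weight. -/

section HighestWeight

variable {L : QPLattice} {V W : Type} [AddCommGroup V] [Module ℂ V] [Module (U L) V]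
  [IsScalarTower ℂ (U L) V] [AddCommGroup W] [Module ℂ W] [Module (U L) W]
  [IsScalarTower ℂ (U L) W]

theorem IsWt.unique {x y : Wt} {v : V} (hx : IsWt L x v) (hy : IsWt L y v) (hv : v ≠ 0) : x = y := by
  ext j
  exact smul_left_injective ℂ hv ((hx.H j).symm.trans (hy.H j))

theorem IsHW.lag_smul_eq {w : Wt} {v : V} (h : IsHW L w v) {z : V}
    (hz : z ∈ Submodule.span (U L) {v}) : ∃ c : ℂ, lag L (ht w) 0 • z = c • v := by
  obtain ⟨c, rfl⟩ := (Submodule.mem_span_range_iff_exists_fun ℂ).mp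
    (h.mem_span_of_mem (i := 0) (j := 1) (by decide) hz)
  refine ⟨lagC 0 * c 0, ?_⟩
  rw [lag_smul_sum h.wt]
  simp [Fin.sum_univ_eight, mdeg, mono, mul_smul]

/-- If the top component of some element of `N` were nonzero, `N` would contain the generator.
Unlike properness, this conclusion passes to sums of submodules. -/
theorem IsHW.lag_smul_eq_zero {w : Wt} {v : V} (h : IsHW L w v)
    (hv : Submodule.span (U L) {v} = ⊤) {N : Submodule (U L) V} (hN : N ≠ ⊤) {z : V} (hz : z ∈ N) :
    lag L (ht w) 0 • z = 0 := by
  obtain ⟨c, hc⟩ := h.lag_smul_eq (z := z) (hv ▸ Submodule.mem_top)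
  by_cases hc0 : c = 0
  · rw [hc, hc0, zero_smul]
  · refine absurd ?_ hN
    rw [eq_top_iff, ← hv, Submodule.span_singleton_le_iff_mem]
    have : c⁻¹ • c • v ∈ N := by
      rw [← hc, ← algebraMap_smul (U L) c⁻¹]
      exact N.smul_mem _ (N.smul_mem _ hz)
    rwa [smul_smul, inv_mul_cancel₀ hc0, one_smul] at this

theorem IsHW.lag_smul_self {w : Wt} {v : V} (h : IsHW L w v) :
    lag L (ht w) 0 • v = lagC 0 • v :=
  UnrolledSL3.lag_smul_self (by rw [h.wt.hU]; simp)

/-- The polynomial with roots `ht w - m` for `m < 5` in `H_1 + H_2` kills the whole module, so each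
eigenvalue is one of its roots. -/
theorem IsHW.exists_height {w : Wt} {v : V} (h : IsHW L w v)
    (hv : Submodule.span (U L) {v} = ⊤) {z : V} (hz : z ≠ 0) {c : ℂ} (hzc : hU L • z = c • z) :
    ∃ n : ℕ, c = ht w - n := by
  set q : Polynomial ℂ := ∏ m ∈ Finset.range 5, (Polynomial.X - Polynomial.C (ht w - m)) with hq
  have h1 : Polynomial.aeval (hU L) q • z = 0 := by
    have hz : z ∈ Submodule.span (U L) {v} := hv ▸ Submodule.mem_top
    obtain ⟨d, rfl⟩ := (Submodule.mem_span_range_iff_exists_fun ℂ).mp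
      (h.mem_span_of_mem (i := 0) (j := 1) (by decide) hz)
    rw [Finset.smul_sum]
    refine Finset.sum_eq_zero fun k _ => ?_
    rw [U_smul_comm, aeval_hU_smul (h.wt.hU_mono 0 1 k), hq, Polynomial.eval_prod,
      Finset.prod_eq_zero (i := mdeg k) (Finset.mem_range.mpr (mdeg_lt k)) (by simp), zero_smul,
      smul_zero]
  rw [aeval_hU_smul hzc, smul_eq_zero, or_iff_left hz, hq, Polynomial.eval_prod,
    Finset.prod_eq_zero_iff] at h1
  obtain ⟨n, -, hn⟩ := h1
  exact ⟨n, by simpa [sub_eq_zero] using hn⟩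

theorem span_singleton_eq_top [IsSimpleModule (U L) V] {v : V} (hv : v ≠ 0) :
    Submodule.span (U L) {v} = ⊤ :=
  (eq_bot_or_eq_top _).resolve_left (by simpa using hv)

/-- The highest weight of a simple module is unique. -/
theorem IsHW.weight_unique [IsSimpleModule (U L) V] {x y : Wt} {u v : V} (hu : IsHW L x u)
    (hv : IsHW L y v) (hu0 : u ≠ 0) (hv0 : v ≠ 0) : x = y := by
  obtain ⟨n, hn⟩ := hu.exists_height (span_singleton_eq_top hu0) hv0 hv.wt.hU
  obtain ⟨m, hm⟩ := hv.exists_height (span_singleton_eq_top hv0) hu0 hu.wt.hU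
  -- Each of the two heights lies a natural number below the other, so they coincide.
  have h0 : ((n + m : ℕ) : ℂ) = 0 := by push_cast; linear_combination hn + hm
  have h1 : n = 0 := by have := Nat.cast_eq_zero.mp h0; omega
  have hht : ht y = ht x := by rw [hn, h1]; simp
  obtain ⟨c, rfl⟩ := hu.eq_smul_of_height (z := v)
    (span_singleton_eq_top (L := L) hu0 ▸ Submodule.mem_top) (by rw [hv.wt.hU, hht])
  exact (hu.wt.smul c).unique hv.wt hv0

theorem IsHW.eq_zero_of_ne [IsSimpleModule (U L) V] {x y : Wt} {u v : V} (hu : IsHW L x u)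
    (hv : IsHW L y v) (hv0 : v ≠ 0) (hxy : x ≠ y) : u = 0 := by
  by_contra hu0
  exact hxy (hu.weight_unique hv hu0 hv0)

end HighestWeight

/-! ### Verma modules and their irreducible quotients -/

section Irr

variable (L : QPLattice) (w : Wt)

/-- The generator of the Verma module. -/
noncomputable def vgen : Verma L w := Submodule.Quotient.mk 1

/-- The image of the generator of the Verma module in the irreducible quotient. -/
noncomputable def igen : Irr L w := Submodule.Quotient.mk (vgen L w)

theorem smul_vgen (u : U L) : u • vgen L w = Submodule.Quotient.mk u := by
  rw [vgen, ← Submodule.Quotient.mk_smul, smul_eq_mul, mul_one]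

theorem span_vgen : Submodule.span (U L) {vgen L w} = ⊤ := by
  rw [eq_top_iff]
  intro z _
  obtain ⟨u, rfl⟩ := Submodule.Quotient.mk_surjective _ z
  exact Submodule.mem_span_singleton.mpr ⟨u, smul_vgen L w u⟩

theorem isHW_vgen : IsHW L w (vgen L w) where
  wt :=
    { H := fun j => by
        rw [smul_vgen, ← algebraMap_smul (U L) (w j), smul_vgen, Submodule.Quotient.eq]
        exact Submodule.subset_span (Or.inl (Or.inr ⟨j, rfl⟩))
      K := fun γ => by
        rw [smul_vgen, ← algebraMap_smul (U L) (iPow _), smul_vgen, Submodule.Quotient.eq]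
        exact Submodule.subset_span (Or.inr ⟨γ, rfl⟩) }
  X j := by
    rw [smul_vgen, Submodule.Quotient.mk_eq_zero]
    exact Submodule.subset_span (Or.inl (Or.inl ⟨j, rfl⟩))

variable {L w} in
/-- The universal property of Verma modules. -/
theorem exists_verma_lift {A : Type} [AddCommGroup A] [Module ℂ A] [Module (U L) A]
    [IsScalarTower ℂ (U L) A] {b : A} (hb : IsHW L w b) :
    ∃ f : Verma L w →ₗ[U L] A, f (vgen L w) = b := by
  refine ⟨(vermaIdeal L w).liftQ (LinearMap.toSpanSingleton (U L) A b) ?_, ?_⟩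
  · rw [vermaIdeal, Submodule.span_le]
    rintro _ ((⟨j, rfl⟩ | ⟨j, rfl⟩) | ⟨γ, rfl⟩)
    · exact hb.X j
    · simp only [SetLike.mem_coe, LinearMap.mem_ker, LinearMap.toSpanSingleton_apply, sub_smul,
        algebraMap_smul, hb.wt.H, sub_self]
    · simp only [SetLike.mem_coe, LinearMap.mem_ker, LinearMap.toSpanSingleton_apply, sub_smul,
        algebraMap_smul, hb.wt.K, sub_self]
  · simp [vgen]

/-- A presentation by generators and relations does not show that the quotient is nonzero. The
universal property sends the generator to a nonzero vector in an explicit module. -/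
theorem vgen_ne_zero : vgen L w ≠ 0 := by
  obtain ⟨V, _, _, _, _, v, hv, hv'⟩ := hasHW L w
  obtain ⟨f, hf⟩ := exists_verma_lift hv'
  intro h
  rw [h, map_zero] at hf
  exact hv hf.symm

theorem lag_smul_eq_zero_of_mem_sSup {z : Verma L w}
    (hz : z ∈ sSup {N : Submodule (U L) (Verma L w) | N ≠ ⊤}) : lag L (ht w) 0 • z = 0 := by
  rw [sSup_eq_iSup'] at hz
  induction hz using Submodule.iSup_induction' with
  | mem N z hz => exact (isHW_vgen L w).lag_smul_eq_zero (span_vgen L w) N.2 hz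
  | zero => rw [smul_zero]
  | add x y _ _ hx hy => rw [smul_add, hx, hy, add_zero]

theorem vgen_notMem : vgen L w ∉ sSup {N : Submodule (U L) (Verma L w) | N ≠ ⊤} := fun h => by
  have := lag_smul_eq_zero_of_mem_sSup L w h
  rw [(isHW_vgen L w).lag_smul_self] at this
  exact smul_ne_zero (lagC_ne_zero 0) (vgen_ne_zero L w) this

/-- The sum of all proper submodules has no top component, so it is proper, and it contains every
other proper submodule. -/
theorem isCoatom_sSup : IsCoatom (sSup {N : Submodule (U L) (Verma L w) | N ≠ ⊤}) := by
  refine ⟨fun h => vgen_notMem L w (by rw [h]; trivial), fun N hN => ?_⟩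
  by_contra hne
  exact absurd (le_sSup (show N ∈ {N : Submodule (U L) (Verma L w) | N ≠ ⊤} from hne)) hN.not_ge

instance isSimpleModule_irr : IsSimpleModule (U L) (Irr L w) :=
  isSimpleModule_iff_isCoatom.mpr (isCoatom_sSup L w)

theorem igen_ne_zero : igen L w ≠ 0 := fun h =>
  vgen_notMem L w ((Submodule.Quotient.mk_eq_zero _).mp h)

theorem isHW_igen : IsHW L w (igen L w) := (isHW_vgen L w).map (Submodule.mkQ _)

theorem span_igen : Submodule.span (U L) {igen L w} = ⊤ := span_singleton_eq_top (igen_ne_zero L w)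

variable {L w} in
theorem mem_span_igen (z : Irr L w) : z ∈ Submodule.span (U L) {igen L w} :=
  span_igen L w ▸ Submodule.mem_top

theorem span_mono_igen {i j : Fin 2} (hij : i ≠ j) :
    Submodule.span ℂ (Set.range (mono L i j (igen L w))) = ⊤ :=
  eq_top_iff.mpr fun z _ => (isHW_igen L w).mem_span_of_mem hij (mem_span_igen z)

theorem span_mono_vgen {i j : Fin 2} (hij : i ≠ j) :
    Submodule.span ℂ (Set.range (mono L i j (vgen L w))) = ⊤ :=
  eq_top_iff.mpr fun _ _ =>
    (isHW_vgen L w).mem_span_of_mem hij (span_vgen L w ▸ Submodule.mem_top)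

instance finiteDimensional_irr : FiniteDimensional ℂ (Irr L w) :=
  ⟨span_mono_igen L w (i := 0) (j := 1) (by decide) ▸ Submodule.fg_span (Set.finite_range _)⟩

theorem isWeightModule_irr : IsWeightModule L (Irr L w) :=
  isWeightModule_of_span (by
    rintro _ ⟨k, rfl⟩
    obtain ⟨w', h, -⟩ := (isHW_igen L w).wt.mono 0 1 k
    exact ⟨w', h⟩) (span_mono_igen L w (i := 0) (j := 1) (by decide))

/-- The irreducible module as an object of the category of weight modules. -/
noncomputable abbrev irrMod : WtMod L where
  carrier := Irr L w
  isWeightModule := isWeightModule_irr L w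

variable {L w}

/-- A simple module with a nonzero highest weight vector is isomorphic to the irreducible module of
that highest weight. -/
theorem exists_equiv_irr {S : Type} [AddCommGroup S] [Module ℂ S] [Module (U L) S]
    [IsScalarTower ℂ (U L) S] [IsSimpleModule (U L) S] {b : S} (hb : IsHW L w b) (hb0 : b ≠ 0) :
    Nonempty (S ≃ₗ[U L] Irr L w) := by
  obtain ⟨f, hf⟩ := exists_verma_lift hb
  have hsurj : Function.Surjective f := by
    rw [← LinearMap.range_eq_top, eq_top_iff, ← span_singleton_eq_top hb0,
      Submodule.span_singleton_le_iff_mem]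
    exact ⟨_, hf⟩
  have hker : IsCoatom (LinearMap.ker f) := by
    rw [← isSimpleModule_iff_isCoatom]
    exact IsSimpleModule.congr (f.quotKerEquivOfSurjective hsurj)
  -- The kernel is maximal and contained in the proper submodule on the right, so the two agree.
  have heq : LinearMap.ker f = sSup {N : Submodule (U L) (Verma L w) | N ≠ ⊤} :=
    ((hker.le_iff.mp (le_sSup hker.1)).resolve_left (isCoatom_sSup L w).1).symm
  exact ⟨(f.quotKerEquivOfSurjective hsurj).symm.trans (Submodule.quotEquivOfEq _ _ heq)⟩

/-- A nonzero weight module has a nonzero weight vector, and raising it yields a highest weight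
vector. Thus the `L_x` exhaust the simple weight modules. -/
theorem exists_equiv_irr_of_isWeightModule {S : Type} [AddCommGroup S] [Module ℂ S]
    [Module (U L) S] [IsScalarTower ℂ (U L) S] [IsSimpleModule (U L) S]
    (hS : IsWeightModule L S) : ∃ w, Nonempty (S ≃ₗ[U L] Irr L w) := by
  have : Nontrivial S := IsSimpleModule.nontrivial (U L) S
  obtain ⟨w, a, ha, ha0⟩ : ∃ w, ∃ a : S, IsWt L w a ∧ a ≠ 0 := by
    by_contra! h
    have h0 : Submodule.span ℂ {v : S | ∃ w, IsWt L w v} ≤ ⊥ := by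
      rw [Submodule.span_le]
      rintro v ⟨w, hv⟩
      exact h w v hv
    rw [hS.span_eq_top, top_le_iff] at h0
    exact bot_ne_top h0
  obtain ⟨x, b, hb0, hb⟩ := ha.exists_isHW ha0
  exact ⟨x, exists_equiv_irr hb hb0⟩

theorem irr_hom_eq_zero {x y : Wt} (h : x ≠ y) (f : Irr L x →ₗ[U L] Irr L y) : f = 0 :=
  LinearMap.ext_of_span_singleton (span_igen L x) <|
    ((isHW_igen L x).map f).eq_zero_of_ne (isHW_igen L y) (igen_ne_zero L y) h

theorem surjective_of_ne_zero {A : Type} [AddCommGroup A] [Module (U L) A] {f : A →ₗ[U L] Irr L w}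
    (hf : f ≠ 0) : Function.Surjective f := LinearMap.surjective_of_ne_zero hf

end Irr

/-! ### Typical weights -/

section Typical

theorem isOdd_add_one_iff (z : ℂ) : IsOdd (z + 1) ↔ IsEven z :=
  exists_congr fun n => by rw [add_left_inj]

theorem isEven_iff_isOdd_add (z : ℂ) (k : ℤ) (hk : Odd k) : IsEven z ↔ IsOdd (z + k) := by
  obtain ⟨m, rfl⟩ := hk
  constructor
  · rintro ⟨n, rfl⟩; exact ⟨n + m, by push_cast; ring⟩
  · rintro ⟨n, hn⟩; exact ⟨n - m, by push_cast at hn ⊢; linear_combination hn⟩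

theorem index_zero (w : Wt) : index w 0 = w 0 + 1 := by
  simp only [index, root, Matrix.cons_val, form_simpleRoot, Pi.add_apply, weylVector]

theorem index_one (w : Wt) : index w 1 = w 1 + 1 := by
  simp only [index, root, Matrix.cons_val, form_simpleRoot, Pi.add_apply, weylVector]

theorem index_two (w : Wt) : index w 2 = w 0 + w 1 + 2 := by
  simp only [index, root, Matrix.cons_val, form_add_right, form_simpleRoot, Pi.add_apply,
    weylVector]
  ring

/-- The three arguments differ from the indices by the odd numbers `1`, `1`, `3`, so an odd index
corresponds to a vanishing quantum integer. -/
theorem isTypical_iff (w : Wt) :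
    IsTypical w ↔ qn (w 0) ≠ 0 ∧ qn (w 1) ≠ 0 ∧ qn (w 0 + w 1 - 1) ≠ 0 := by
  have h := isEven_iff_isOdd_add (w 0 + w 1 - 1) 3 (by decide)
  have e : w 0 + w 1 - 1 + (3 : ℤ) = w 0 + w 1 + 2 := by push_cast; ring
  rw [e] at h
  simp only [IsTypical, Fin.forall_fin_succ, IsEmpty.forall_iff, and_true, Ne, qn_eq_zero_iff, h,
    Fin.succ_zero_eq_one, Fin.succ_one_eq_two, index_zero, index_one, index_two,
    isOdd_add_one_iff]

theorem IsTypical.qn_ne_zero {i j : Fin 2} (hij : i ≠ j) {w : Wt} (h : IsTypical w) :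
    qn (w i) ≠ 0 ∧ qn (w j) ≠ 0 ∧ qn (w i + w j - 1) ≠ 0 := by
  obtain ⟨h0, h1, h2⟩ := (isTypical_iff w).mp h
  fin_cases i <;> fin_cases j
  · exact absurd rfl hij
  · exact ⟨h0, h1, h2⟩
  · exact ⟨h1, h0, by rw [add_comm] at h2; exact h2⟩
  · exact absurd rfl hij

theorem isTypical_of_ne {i j : Fin 2} (hij : i ≠ j) {w : Wt} (h0 : qn (w i) ≠ 0)
    (h1 : qn (w j) ≠ 0) (h2 : qn (w i + w j - 1) ≠ 0) : IsTypical w := by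
  rw [isTypical_iff]
  fin_cases i <;> fin_cases j
  · exact absurd rfl hij
  · exact ⟨h0, h1, h2⟩
  · exact ⟨h1, h0, by rw [add_comm] at h2; exact h2⟩
  · exact absurd rfl hij

variable {L : QPLattice} {w : Wt}

theorem IsTypical.linearIndependent {i j : Fin 2} (hij : i ≠ j) (h : IsTypical w) :
    LinearIndependent ℂ (mono L i j (igen L w)) := by
  obtain ⟨h0, h1, h2⟩ := h.qn_ne_zero hij
  exact linearIndependent_mono hij (isHW_igen L w) (igen_ne_zero L w) h0 h1 h2

theorem IsTypical.finrank (h : IsTypical w) : Module.finrank ℂ (Irr L w) = 8 := by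
  have h01 : (0 : Fin 2) ≠ 1 := by decide
  simpa using Module.finrank_eq_card_basis (Module.Basis.mk (h.linearIndependent (L := L) h01)
    (span_mono_igen L w h01).ge)

theorem map_mono {V W : Type} [AddCommGroup V] [Module (U L) V] [AddCommGroup W] [Module (U L) W]
    (f : V →ₗ[U L] W) (i j : Fin 2) (v : V) (k : Fin 8) :
    f (mono L i j v k) = mono L i j (f v) k := by
  fin_cases k <;> simp [mono]

/-- The universal property of typical irreducible modules. -/
theorem IsTypical.exists_lift (h : IsTypical w) {A : Type} [AddCommGroup A] [Module ℂ A]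
    [Module (U L) A] [IsScalarTower ℂ (U L) A] {b : A} (hb : IsHW L w b) :
    ∃ f : Irr L w →ₗ[U L] A, f (igen L w) = b := by
  have h01 : (0 : Fin 2) ≠ 1 := by decide
  obtain ⟨f, hf⟩ := exists_verma_lift hb
  -- A typical Verma module is already simple: its eight spanning monomials stay independent in the
  -- irreducible quotient, so the maximal submodule vanishes.
  have hinj : ∀ z ∈ sSup {N : Submodule (U L) (Verma L w) | N ≠ ⊤}, z = 0 := fun z hz => by
    have hz' : z ∈ Submodule.span ℂ (Set.range (mono L 0 1 (vgen L w))) :=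
      span_mono_vgen L w h01 ▸ Submodule.mem_top
    obtain ⟨c, rfl⟩ := (Submodule.mem_span_range_iff_exists_fun ℂ).mp hz'
    have h0 := (Submodule.Quotient.mk_eq_zero _).mpr hz
    rw [← Submodule.mkQ_apply, map_sum] at h0
    simp only [map_complex_smul, map_mono] at h0
    have := Fintype.linearIndependent_iff.mp (h.linearIndependent (L := L) h01) c h0
    simp [this]
  refine ⟨Submodule.liftQ _ f fun z hz => by rw [hinj z hz]; exact zero_mem _, ?_⟩
  exact hf

/-- Homomorphisms from a typical `L_w` are highest weight vectors of weight `w`, and these lift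
along surjections by `exists_isHW_lift`. -/
theorem IsTypical.isProjective (h : IsTypical w) : IsProjective L (irrMod L w) := by
  intro A B g f hg
  have hb : IsHW L w (f (igen L w)) := (isHW_igen L w).map f
  obtain ⟨a, ha, hab⟩ := A.isWeightModule.exists_isWt_lift g hg hb.wt
  obtain ⟨h0, h1, h2⟩ := h.qn_ne_zero (i := 0) (j := 1) (by decide)
  obtain ⟨a', ha', hab'⟩ := exists_isHW_lift g ha hb hab (mul_ne_zero (mul_ne_zero h0 h1) h2)
  obtain ⟨k, hk⟩ := h.exists_lift ha'
  refine ⟨k, LinearMap.ext_of_span_singleton (V := Irr L w) (span_igen L w) ?_⟩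
  exact (congrArg g hk).trans hab'

end Typical

/-! ### A relation in atypical irreducible modules -/

theorem sub_simpleRoot_sub_ne (w : Wt) (i j : Fin 2) : w - simpleRoot i - simpleRoot j ≠ w :=
  fun h => by
    have := congrArg ht h
    rw [ht_sub_simpleRoot, ht_sub_simpleRoot, sub_sub] at this
    norm_num at this

section FourDim

variable (L : QPLattice) {i j : Fin 2} (hij : i ≠ j) {w : Wt}
include hij

/-- The difference of the two sides is killed by `E_i` for every weight, and by `E_j` because the
determinant `[w i + w j - 1]` vanishes. A simple module has no nonzero highest weight vector of
lower weight. -/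
theorem relation_of_atypical (h : qn (w i + w j - 1) = 0) :
    qn (w i) • F L i • F L j • igen L w = qn (w i + 1) • F L j • F L i • igen L w := by
  obtain ⟨a1, a1', a2, a2', -⟩ := (isHW_igen L w).fs hij
  obtain ⟨b1, b1', b2, b2', -⟩ := (isHW_igen L w).fs hij.symm
  rw [qn_add_sub_one] at h
  rw [← sub_eq_zero]
  refine IsHW.eq_zero_of_ne (x := w - simpleRoot i - simpleRoot j) ⟨?_, fun k => ?_⟩
    (isHW_igen L w) (igen_ne_zero L w) (sub_simpleRoot_sub_ne w i j)
  · rw [sub_eq_add_neg (qn (w i) • _), ← neg_smul]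
    refine IsWt.add (IsWt.smul ?_ _) ((((isHW_igen L w).wt.F i).F j).smul _)
    rw [sub_right_comm]
    exact ((isHW_igen L w).wt.F j).F i
  · obtain rfl | rfl := eq_or_eq_of_ne hij k
    · rw [smul_sub, U_smul_comm, U_smul_comm, a2, a2', csmul_smul, csmul_smul, mul_comm, sub_self]
    · rw [smul_sub, U_smul_comm, U_smul_comm, b2, b2', csmul_smul, csmul_smul, ← sub_smul, h,
        zero_smul]

end FourDim

/-! ### The module of linear maps -/

section Antipode

variable {L : QPLattice}

theorem X_mul_K_neg (j k : Fin 2) :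
    (U.X k : U L) * U.K (-L.sr j) = iPow (cartan j k) • (U.K (-L.sr j) * U.X k) := by
  rw [U.K_neg_sr_mul_X, smul_smul, ← iPow_add, add_neg_cancel, iPow_zero, one_smul]

theorem X_mul_K_neg_mul (j k : Fin 2) (u : U L) :
    (U.X k : U L) * (U.K (-L.sr j) * u) = iPow (cartan j k) • (U.K (-L.sr j) * (U.X k * u)) := by
  rw [← mul_assoc, X_mul_K_neg, smul_mul_assoc, mul_assoc]

theorem K_mul_Y_mul (j k : Fin 2) (u : U L) :
    (U.K (L.sr j) : U L) * (U.Y k * u) = iPow (-cartan j k) • (U.Y k * (U.K (L.sr j) * u)) := by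
  rw [← mul_assoc, U.K_sr_mul_Y, smul_mul_assoc, mul_assoc]

theorem K_mul_K_mul (γ δ : L.carrier) (u : U L) : U.K γ * (U.K δ * u) = U.K (γ + δ) * u := by
  rw [← mul_assoc, U.K_mul]

/-- The inverse of the antipode on generators. -/
noncomputable def antiGen (L : QPLattice) : Gen L → (U L)ᵐᵒᵖ
  | .X j => .op (-(U.K (-L.sr j) * U.X j))
  | .Y j => .op (-(U.Y j * U.K (L.sr j)))
  | .H j => .op (-U.H j)
  | .K γ => .op (U.K (-γ))

/-- The target is the opposite algebra, so each relation is checked with its words reversed.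
Collecting the `K`s on one side costs powers of `𝐢`; in the braid relations these agree on both
sides. -/
theorem antiGen_rel (L : QPLattice) ⦃a b : FreeAlgebra ℂ (Gen L)⦄ (h : Rel L a b) :
    FreeAlgebra.lift ℂ (antiGen L) a = FreeAlgebra.lift ℂ (antiGen L) b := by
  have hsym : ∀ j k, cartan j k = cartan k j := by
    intro j k; fin_cases j <;> fin_cases k <;> rfl
  have hKXY : ∀ j k : Fin 2, (U.Y k * U.K (L.sr k)) * (U.K (-L.sr j) * U.X j) =
      U.K (-L.sr j) * (U.Y k * U.X j) * (U.K (L.sr k) : U L) := fun j k => by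
    have h1 := U.K_neg_sr_mul_Y (L := L) j k
    have h2 := U.K_sr_mul_X (L := L) k j
    rw [mul_assoc (U.Y k), K_mul_K_mul, add_comm, ← U.K_mul, mul_assoc (U.K _), h2, mul_smul_comm,
      mul_smul_comm, ← mul_assoc (U.K (-L.sr j)) (U.Y k), h1, smul_mul_assoc, smul_mul_assoc,
      hsym j k]
    simp only [mul_assoc]
  have hKX : ∀ j (u : U L), (U.K (-L.sr j) : U L) * u = u * U.K (-L.sr j) →
      U.K (-L.sr j) * u * U.K (L.sr j) = u := fun j u hu => by
    rw [hu, mul_assoc, U.K_mul, neg_add_cancel, U.K_zero, mul_one]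
  apply MulOpposite.unop_injective
  induction h with
  | K_zero => simp [Free.K, antiGen, U.K_zero]
  | K_add γ δ =>
    simp [Free.K, antiGen, U.K_mul]
  | K_X γ j =>
    simp only [Free.K, Free.X, map_mul, map_smul, FreeAlgebra.lift_ι_apply, antiGen,
      MulOpposite.unop_mul, MulOpposite.unop_op, MulOpposite.unop_smul, neg_neg]
    rw [neg_mul, mul_neg, smul_neg, ← mul_smul_comm, ← U.K_conj_X γ j]
    simp only [mul_assoc, K_mul_K_mul]
    rw [add_comm]
  | K_Y γ j =>
    simp only [Free.K, Free.Y, map_mul, map_smul, FreeAlgebra.lift_ι_apply, antiGen,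
      MulOpposite.unop_mul, MulOpposite.unop_op, MulOpposite.unop_smul, neg_neg]
    rw [neg_mul, mul_neg, smul_neg, ← smul_mul_assoc, ← U.K_conj_Y γ j]
    simp only [mul_assoc, U.K_mul]
    rw [add_comm]
  | X_Y j =>
    simp only [Free.K, Free.X, Free.Y, map_mul, map_sub, map_smul, FreeAlgebra.lift_ι_apply,
      antiGen, MulOpposite.unop_mul, MulOpposite.unop_op, MulOpposite.unop_smul,
      MulOpposite.unop_sub, neg_neg, neg_mul_neg]
    have h := U.X_Y (L := L) j
    have e : (U.K (-L.sr j) : U L) * U.X j * (U.Y j * U.K (L.sr j)) =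
        U.K (-L.sr j) * (U.X j * U.Y j) * U.K (L.sr j) := by simp only [mul_assoc]
    have hc : ∀ j, (U.K (-L.sr j) : U L) * (U.X j * U.Y j) = (U.X j * U.Y j) * U.K (-L.sr j) :=
      fun j => by
        rw [← mul_assoc, U.K_neg_sr_mul_X, smul_mul_assoc, mul_assoc, U.K_neg_sr_mul_Y,
          mul_smul_comm, smul_smul, ← iPow_add, neg_add_cancel, iPow_zero, one_smul, mul_assoc]
    have hc' : ∀ j, (U.K (-L.sr j) : U L) * (U.Y j * U.X j) = (U.Y j * U.X j) * U.K (-L.sr j) :=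
      fun j => by
        rw [← mul_assoc, U.K_neg_sr_mul_Y, smul_mul_assoc, mul_assoc, U.K_neg_sr_mul_X,
          mul_smul_comm, smul_smul, ← iPow_add, add_neg_cancel, iPow_zero, one_smul, mul_assoc]
    rw [hKXY, e, hKX j _ (hc j), hKX j _ (hc' j), ← neg_sub, h, ← smul_neg, neg_sub]
  | X_Y_of_ne j k hne =>
    simp only [Free.X, Free.Y, map_mul, map_sub, map_zero, FreeAlgebra.lift_ι_apply,
      antiGen, MulOpposite.unop_mul, MulOpposite.unop_op, MulOpposite.unop_sub,
      MulOpposite.unop_zero, neg_mul_neg]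
    rw [hKXY, ← sub_eq_zero.mp (U.X_Y_of_ne hne)]
    simp only [mul_assoc, sub_self]
  | X_sq j =>
    simp only [Free.X, pow_two, map_mul, map_zero, FreeAlgebra.lift_ι_apply, antiGen,
      MulOpposite.unop_mul, MulOpposite.unop_op, MulOpposite.unop_zero, neg_mul_neg]
    simp only [mul_assoc, X_mul_K_neg_mul, U.X_mul_X, mul_zero, smul_zero]
  | Y_sq j =>
    simp only [Free.Y, pow_two, map_mul, map_zero, FreeAlgebra.lift_ι_apply, antiGen,
      MulOpposite.unop_mul, MulOpposite.unop_op, MulOpposite.unop_zero, neg_mul_neg]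
    rw [mul_assoc, K_mul_Y_mul, mul_smul_comm, ← mul_assoc, U.Y_mul_Y, zero_mul, smul_zero]
  | X_braid =>
    simp only [Free.X, pow_two, map_mul, FreeAlgebra.lift_ι_apply, antiGen,
      MulOpposite.unop_mul, MulOpposite.unop_op, neg_mul_neg]
    have h := U.X_braid (L := L)
    simp only [pow_two, mul_assoc] at h
    simp only [mul_assoc, X_mul_K_neg_mul, mul_smul_comm, smul_mul_assoc,
      smul_smul, ← iPow_add, h]
    simp only [K_mul_K_mul]
    congr 2; abel_nf
  | Y_braid =>
    simp only [Free.Y, pow_two, map_mul, FreeAlgebra.lift_ι_apply, antiGen,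
      MulOpposite.unop_mul, MulOpposite.unop_op, neg_mul_neg]
    have h := U.Y_braid (L := L)
    simp only [pow_two, mul_assoc] at h
    have h' : ∀ u : U L, (U.Y 0 : U L) * (U.Y 1 * (U.Y 0 * (U.Y 1 * u))) =
        U.Y 1 * (U.Y 0 * (U.Y 1 * (U.Y 0 * u))) := fun u => by
      simpa only [mul_assoc] using congrArg (· * u) h
    simp only [mul_assoc, K_mul_Y_mul, mul_smul_comm, smul_mul_assoc, smul_smul, ← iPow_add, h']
    simp only [U.K_mul]
    congr 5; abel_nf
  | H_X j k =>
    simp only [Free.X, Free.H, map_mul, map_sub, map_smul, FreeAlgebra.lift_ι_apply,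
      antiGen, MulOpposite.unop_mul, MulOpposite.unop_op, MulOpposite.unop_smul,
      MulOpposite.unop_sub, neg_mul_neg]
    have h1 := U.H_X (L := L) j k
    have h2 := U.H_K j (-L.sr k)
    rw [sub_eq_zero] at h2
    rw [smul_neg, ← mul_smul_comm, ← h1, mul_sub, neg_sub, ← mul_assoc _ (U.H j), ← h2]
    simp only [mul_assoc]
  | H_Y j k =>
    simp only [Free.Y, Free.H, map_mul, map_sub, map_smul, FreeAlgebra.lift_ι_apply,
      antiGen, MulOpposite.unop_mul, MulOpposite.unop_op, MulOpposite.unop_smul,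
      MulOpposite.unop_sub, neg_mul_neg]
    have h1 := U.H_Y (L := L) j k
    have h2 := U.H_K j (L.sr k)
    rw [sub_eq_zero] at h2
    rw [smul_neg, ← smul_mul_assoc, ← h1, sub_mul, neg_sub, mul_assoc (U.Y k) (U.H j), h2]
    simp only [mul_assoc]
  | H_H j k =>
    simp only [Free.H, map_mul, map_sub, map_zero, FreeAlgebra.lift_ι_apply,
      antiGen, MulOpposite.unop_mul, MulOpposite.unop_op, MulOpposite.unop_zero,
      MulOpposite.unop_sub, neg_mul_neg]
    exact U.H_H k j
  | H_K j γ =>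
    simp only [Free.H, Free.K, map_mul, map_sub, map_zero, FreeAlgebra.lift_ι_apply,
      antiGen, MulOpposite.unop_mul, MulOpposite.unop_op, MulOpposite.unop_zero,
      MulOpposite.unop_sub]
    have h2 := U.H_K j (-γ)
    rw [mul_neg, neg_mul, neg_sub_neg, h2]

/-- The inverse of the antipode. -/
noncomputable def antiHom (L : QPLattice) : U L →ₐ[ℂ] (U L)ᵐᵒᵖ :=
  RingQuot.liftAlgHom ℂ ⟨FreeAlgebra.lift ℂ (antiGen L), antiGen_rel L⟩

theorem antiHom_mk (L : QPLattice) (g : Gen L) :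
    antiHom L (U.mk L (FreeAlgebra.ι ℂ g)) = antiGen L g := by
  refine (RingQuot.liftAlgHom_mkAlgHom_apply ℂ (FreeAlgebra.lift ℂ (antiGen L))
    (antiGen_rel L) _).trans ?_
  rw [FreeAlgebra.lift_ι_apply]

end Antipode

/-- The space of complex linear maps between two `U`-modules; `U` acts on it in such a way that maps
out of a tensor product `V ⊗ M` are the same as maps from `M` to `HomMod V A`. -/
def HomMod (V A : Type) [AddCommGroup V] [Module ℂ V] [AddCommGroup A] [Module ℂ A] : Type :=
  V →ₗ[ℂ] A

/-! ### The action on linear maps and the tensor-hom adjunction. -/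

section HomMod

variable {L : QPLattice} {V A B : Type} [AddCommGroup V] [Module ℂ V] [Module (U L) V]
  [IsScalarTower ℂ (U L) V] [AddCommGroup A] [Module ℂ A] [Module (U L) A]
  [IsScalarTower ℂ (U L) A] [AddCommGroup B] [Module ℂ B] [Module (U L) B]
  [IsScalarTower ℂ (U L) B]

noncomputable instance : AddCommGroup (HomMod V A) := inferInstanceAs (AddCommGroup (V →ₗ[ℂ] A))

noncomputable instance : Module ℂ (HomMod V A) := inferInstanceAs (Module ℂ (V →ₗ[ℂ] A))

instance : FunLike (HomMod V A) V A := inferInstanceAs (FunLike (V →ₗ[ℂ] A) V A)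

instance : LinearMapClass (HomMod V A) ℂ V A := inferInstanceAs (LinearMapClass (V →ₗ[ℂ] A) ℂ V A)

variable (L V A) in
/-- Precomposition with the action of `U`. -/
noncomputable def precompRep : (U L)ᵐᵒᵖ →ₐ[ℂ] Module.End ℂ (V →ₗ[ℂ] A) where
  toFun u := LinearMap.lcomp ℂ A (Algebra.lsmul ℂ ℂ V u.unop)
  map_one' := by ext f v; simp
  map_mul' a b := by ext f v; simp
  map_zero' := by ext f v; simp
  map_add' a b := by ext f v; simp
  commutes' c := by
    ext f v
    simp

variable (L V A) in
/-- Postcomposition with the action of `U`. -/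
noncomputable def postcompRep : U L →ₐ[ℂ] Module.End ℂ (V →ₗ[ℂ] A) where
  toFun u := LinearMap.compRight ℂ (Algebra.lsmul ℂ ℂ A u)
  map_one' := by ext f v; simp
  map_mul' a b := by ext f v; simp
  map_zero' := by ext f v; simp
  map_add' a b := by ext f v; simp
  commutes' c := by
    ext f v
    simp

theorem commute_precompRep_postcompRep (x y : U L) :
    Commute ((precompRep L V A).comp (antiHom L) x) (postcompRep L V A y) := rfl

variable (L V A) in
/-- The representation of `U` on the space of linear maps. -/
noncomputable def homRep : U L →ₐ[ℂ] Module.End ℂ (V →ₗ[ℂ] A) :=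
  (Algebra.TensorProduct.lift ((precompRep L V A).comp (antiHom L)) (postcompRep L V A)
    commute_precompRep_postcompRep).comp (U.comul L)

noncomputable instance : Module (U L) (HomMod V A) :=
  Module.compHom (V →ₗ[ℂ] A) (homRep L V A).toRingHom

instance : IsScalarTower ℂ (U L) (HomMod V A) where
  smul_assoc c u φ := by
    change homRep L V A (c • u) φ = c • homRep L V A u φ
    rw [map_smul]; rfl

@[simp] theorem HomMod.smul_apply (c : ℂ) (f : HomMod V A) (v : V) : (c • f) v = c • f v := rfl

@[ext] theorem HomMod.ext {f g : HomMod V A} (h : ∀ v, f v = g v) : f = g := LinearMap.ext h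

theorem HomMod.smul_apply_of_comul {u a b c d : U L} (h : U.comul L u = a ⊗ₜ b + c ⊗ₜ d)
    (φ : HomMod V A) (v : V) :
    (u • φ) v = b • φ ((antiHom L a).unop • v) + d • φ ((antiHom L c).unop • v) := by
  change (Algebra.TensorProduct.lift ((precompRep L V A).comp (antiHom L)) (postcompRep L V A)
    commute_precompRep_postcompRep) (U.comul L u) φ v = _
  rw [h, map_add, Algebra.TensorProduct.lift_tmul, Algebra.TensorProduct.lift_tmul]
  rfl

theorem HomMod.X_apply (j : Fin 2) (φ : HomMod V A) (v : V) :
    (E L j • φ) v = E L j • φ v -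
      (U.K (L.sr j) : U L) • φ ((U.K (-L.sr j) : U L) • E L j • v) := by
  rw [HomMod.smul_apply_of_comul (U.comul_X j), map_one, MulOpposite.unop_one, one_smul,
    show antiHom L (U.X j) = antiGen L (.X j) from antiHom_mk L _, antiGen, MulOpposite.unop_op,
    neg_smul, map_neg, smul_neg, mul_smul]
  abel

theorem HomMod.Y_apply (j : Fin 2) (φ : HomMod V A) (v : V) :
    (F L j • φ) v = F L j • φ ((U.K (L.sr j) : U L) • v) -
      φ (F L j • (U.K (L.sr j) : U L) • v) := by
  rw [HomMod.smul_apply_of_comul (U.comul_Y j), one_smul,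
    show antiHom L (U.Y j) = antiGen L (.Y j) from antiHom_mk L _,
    show antiHom L (U.K (-L.sr j)) = antiGen L (.K (-L.sr j)) from antiHom_mk L _,
    antiGen, antiGen, MulOpposite.unop_op, MulOpposite.unop_op, neg_smul, map_neg, mul_smul,
    neg_neg]
  abel

theorem HomMod.H_apply (j : Fin 2) (φ : HomMod V A) (v : V) :
    ((U.H j : U L) • φ) v = (U.H j : U L) • φ v - φ ((U.H j : U L) • v) := by
  rw [HomMod.smul_apply_of_comul (U.comul_H j), map_one, MulOpposite.unop_one, one_smul, one_smul,
    show antiHom L (U.H j) = antiGen L (.H j) from antiHom_mk L _, antiGen, MulOpposite.unop_op,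
    neg_smul, map_neg]
  abel

theorem HomMod.K_apply (γ : L.carrier) (φ : HomMod V A) (v : V) :
    ((U.K γ : U L) • φ) v = (U.K γ : U L) • φ ((U.K (-γ) : U L) • v) := by
  rw [HomMod.smul_apply_of_comul (a := U.K γ) (b := U.K γ) (c := 0) (d := 0)
    (by rw [U.comul_K, TensorProduct.zero_tmul, add_zero]), zero_smul, add_zero,
    show antiHom L (U.K γ) = antiGen L (.K γ) from antiHom_mk L _, antiGen, MulOpposite.unop_op]

theorem K_smul_K_neg (γ : L.carrier) (v : V) : (U.K γ : U L) • (U.K (-γ) : U L) • v = v := by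
  rw [smul_smul, U.K_mul_K_neg, one_smul]

theorem K_neg_smul_K (γ : L.carrier) (v : V) : (U.K (-γ) : U L) • (U.K γ : U L) • v = v := by
  rw [smul_smul, U.K_mul, neg_add_cancel, U.K_zero, one_smul]

/-- For `φ` of weight `m`, conjugation by `K_{α_j}` is the scalar `𝐢 ^ (m j)`. Hence `φ` is a
highest weight vector exactly when it commutes with the raising operators up to these scalars. -/
theorem IsWt.hom_X_apply {m : Wt} {φ : HomMod V A} (h : IsWt L m φ) (j : Fin 2) (v : V) :
    (UnrolledSL3.E L j • φ) v =
      UnrolledSL3.E L j • φ v - iPow (m j) • φ (UnrolledSL3.E L j • v) := by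
  have h1 : (U.K (L.sr j) : U L) • φ ((U.K (-L.sr j) : U L) • UnrolledSL3.E L j • v) =
      ((U.K (L.sr j) : U L) • φ) (UnrolledSL3.E L j • v) := (HomMod.K_apply _ _ _).symm
  have e : form (L.sr j) m = m j := form_simpleRoot_left m j
  rw [HomMod.X_apply, h1, h.K, e, HomMod.smul_apply]

/-- A linear map that shifts the weights of a basis is a weight vector. -/
theorem isWt_homMod {ι : Type} (b : Module.Basis ι ℂ V) {y : ι → Wt} (hb : ∀ k, IsWt L (y k) (b k))
    {m : Wt} {φ : HomMod V A} (h : ∀ k, IsWt L (m + y k) (φ (b k))) : IsWt L m φ where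
  H j := b.ext fun k => by
    refine (HomMod.H_apply j φ (b k)).trans ?_
    rw [(hb k).H, (h k).H, map_smul, ← sub_smul, Pi.add_apply, add_sub_cancel_right]
    rfl
  K γ := b.ext fun k => by
    refine (HomMod.K_apply γ φ (b k)).trans ?_
    have e : iPow (form ((-γ : L.carrier) : Wt) (y k)) * iPow (form γ (m + y k)) =
        iPow (form γ m) := by
      rw [← iPow_add, form_add_right, show ((-γ : L.carrier) : Wt) = -(γ : Wt) from rfl,
        U.form_neg_left]
      congr 1; ring
    rw [(hb k).K, map_smul, U_smul_comm, (h k).K, smul_smul, e]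
    rfl

variable (L) in
/-- Postcomposition with a homomorphism. -/
noncomputable def postcomp (g : A →ₗ[U L] B) : HomMod V A →ₗ[U L] HomMod V B :=
  linearMapOfGenerators
    ({ toFun := fun φ => ((g.restrictScalars ℂ) ∘ₗ (show V →ₗ[ℂ] A from φ) : V →ₗ[ℂ] B)
       map_add' := fun _ _ => HomMod.ext fun _ => map_add g _ _
       map_smul' := fun c _ => HomMod.ext fun _ => map_complex_smul g c _ } :
      HomMod V A →ₗ[ℂ] HomMod V B)
    (fun j φ => HomMod.ext fun v => by
      rw [HomMod.X_apply]
      change g ((E L j • φ) v) = E L j • g (φ v) - _ • g (φ _)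
      rw [HomMod.X_apply, map_sub, map_smul, map_smul])
    (fun j φ => HomMod.ext fun v => by
      rw [HomMod.Y_apply]
      change g ((F L j • φ) v) = F L j • g (φ _) - g (φ _)
      rw [HomMod.Y_apply, map_sub, map_smul])
    (fun j φ => HomMod.ext fun v => by
      rw [HomMod.H_apply]
      change g (((U.H j : U L) • φ) v) = (U.H j : U L) • g (φ v) - g (φ _)
      rw [HomMod.H_apply, map_sub, map_smul])
    (fun γ φ => HomMod.ext fun v => by
      rw [HomMod.K_apply]
      change g (((U.K γ : U L) • φ) v) = (U.K γ : U L) • g (φ _)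
      rw [HomMod.K_apply, map_smul])

variable {M : Type} [AddCommGroup M] [Module ℂ M] [Module (U L) M] [IsScalarTower ℂ (U L) M]

theorem TensorMod.induction {C : TensorMod V M → Prop}
    (htmul : ∀ v m, C (TensorMod.tmul V M v m)) (hadd : ∀ s t, C s → C t → C (s + t))
    (t : TensorMod V M) : C t := by
  refine TensorProduct.induction_on (motive := C) t ?_ htmul hadd
  simpa [TensorMod.tmul] using htmul 0 0

/-- Homomorphisms out of a tensor product. -/
theorem exists_uncurry (f : M →ₗ[U L] HomMod V A) :
    ∃ F : TensorMod V M →ₗ[U L] A, ∀ v m, F (TensorMod.tmul V M v m) = f m v := by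
  let f' : M →ₗ[ℂ] V →ₗ[ℂ] A := f.restrictScalars ℂ
  let F₀ : TensorMod V M →ₗ[ℂ] A := TensorProduct.lift f'.flip
  have hF : ∀ v m, F₀ (TensorMod.tmul V M v m) = f m v := fun v m => rfl
  have hgen : ∀ u : U L, (∀ v m, F₀ (u • TensorMod.tmul V M v m) = u • f m v) →
      ∀ t, F₀ (u • t) = u • F₀ t := fun u hu t => by
    induction t using TensorMod.induction with
    | htmul v m => rw [hu, hF]
    | hadd s t hs ht => rw [smul_add, map_add, map_add, smul_add, hs, ht]
  refine ⟨linearMapOfGenerators F₀ (fun j => hgen _ fun v m => ?_) (fun j => hgen _ fun v m => ?_)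
    (fun j => hgen _ fun v m => ?_) (fun γ => hgen _ fun v m => ?_), hF⟩
  -- The `X ⊗ K` term of the coproduct cancels the correction term in the action of `X` on linear
  -- maps.
  · rw [TensorMod.X_smul_tmul, map_add, hF, hF, map_smul f, map_smul f, HomMod.K_apply, HomMod.X_apply]
    abel
  · rw [TensorMod.Y_smul_tmul, map_add, hF, hF, map_smul f, HomMod.Y_apply, K_smul_K_neg]
    abel
  · rw [TensorMod.H_smul_tmul, map_add, hF, hF, map_smul f, HomMod.H_apply]
    abel
  · rw [TensorMod.K_smul_tmul, hF, map_smul f, HomMod.K_apply, K_neg_smul_K]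

/-- The linear map obtained by fixing the second factor of a pure tensor. -/
noncomputable def curryAt (f : TensorMod V M →ₗ[U L] A) (m : M) : HomMod V A :=
  (f.restrictScalars ℂ) ∘ₗ (TensorProduct.mk ℂ V M).flip m

theorem curryAt_apply (f : TensorMod V M →ₗ[U L] A) (m : M) (v : V) :
    curryAt f m v = f (TensorMod.tmul V M v m) := rfl

theorem TensorMod.tmul_smul (c : ℂ) (v : V) (m : M) :
    TensorMod.tmul V M v (c • m) = c • TensorMod.tmul V M v m := TensorProduct.tmul_smul c v m

theorem IsHW.curryAt {w : Wt} {m : M} (hm : IsHW L w m) (f : TensorMod V M →ₗ[U L] A) :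
    IsHW L w (curryAt f m) where
  wt :=
    { H := fun j => HomMod.ext fun v => by
        rw [HomMod.H_apply, HomMod.smul_apply, curryAt_apply, curryAt_apply, ← map_smul,
          TensorMod.H_smul_tmul, map_add, add_sub_cancel_right, hm.wt.H, TensorMod.tmul_smul,
          map_complex_smul]
      K := fun γ => HomMod.ext fun v => by
        rw [HomMod.K_apply, HomMod.smul_apply, curryAt_apply, curryAt_apply, ← map_smul,
          TensorMod.K_smul_tmul, K_smul_K_neg, hm.wt.K, TensorMod.tmul_smul, map_complex_smul] }
  X j := HomMod.ext fun v => by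
    have h0 : TensorMod.tmul V M v 0 = 0 := TensorProduct.tmul_zero M v
    rw [HomMod.X_apply, curryAt_apply, curryAt_apply, ← map_smul, ← map_smul,
      TensorMod.X_smul_tmul, TensorMod.K_smul_tmul, K_smul_K_neg, hm.X, h0, add_zero, sub_self]
    rfl

end HomMod

/-! ### Tensor products with typical modules -/

section TensorTypical

variable {L : QPLattice} {V A : Type} [AddCommGroup V] [Module ℂ V] [Module (U L) V]
  [IsScalarTower ℂ (U L) V] [AddCommGroup A] [Module ℂ A] [Module (U L) A]
  [IsScalarTower ℂ (U L) A] {m : Wt}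

/-- By adjunction, maps out of `V ⊗ L_m` are maps from `L_m` to `HomMod V A`, which for typical `m`
are highest weight vectors. -/
theorem IsTypical.exists_tensor_lift (hm : IsTypical m) {φ : HomMod V A} (hφ : IsHW L m φ) :
    ∃ F : TensorMod V (Irr L m) →ₗ[U L] A, ∀ v, F (TensorMod.tmul V _ v (igen L m)) = φ v := by
  obtain ⟨f, hf⟩ := hm.exists_lift hφ
  obtain ⟨F, hF⟩ := exists_uncurry f
  exact ⟨F, fun v => by rw [hF, hf]⟩

/-- A submodule of `V ⊗ L_m` containing all `v ⊗ x`, for `x` the highest weight vector, is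
everything. -/
theorem eq_top_of_forall_tmul_mem {N : Submodule (U L) (TensorMod V (Irr L m))}
    (hN : ∀ v, TensorMod.tmul V _ v (igen L m) ∈ N) : N = ⊤ := by
  have h01 : (0 : Fin 2) ≠ 1 := by decide
  let N' : Submodule ℂ (Irr L m) :=
    { carrier := {x | ∀ v, TensorMod.tmul V _ v x ∈ N}
      zero_mem' := fun v => by
        rw [show TensorMod.tmul V (Irr L m) v 0 = 0 from TensorProduct.tmul_zero _ v]
        exact N.zero_mem
      add_mem' := fun {x y} hx hy v => by
        rw [show TensorMod.tmul V (Irr L m) v (x + y) = TensorMod.tmul V _ v x +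
          TensorMod.tmul V _ v y from TensorProduct.tmul_add v x y]
        exact N.add_mem (hx v) (hy v)
      smul_mem' := fun c x hx v => by
        rw [TensorMod.tmul_smul, ← algebraMap_smul (U L) c]
        exact N.smul_mem _ (hx v) }
  -- Twisting `v` by `K_{α_j}` cancels the inverse in the coproduct. `F_j` then yields `v ⊗ F_j x`
  -- plus a term already in `N`.
  have hF : ∀ j, ∀ x ∈ N', F L j • x ∈ N' := fun j x hx v => by
    have h1 := N.smul_mem (F L j) (hx ((U.K (L.sr j) : U L) • v))
    rw [TensorMod.Y_smul_tmul, K_neg_smul_K] at h1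
    exact (N.add_mem_iff_right (hx _)).mp h1
  have h0 : igen L m ∈ N' := hN
  have htop : ∀ x, x ∈ N' := fun x => by
    have hx : x ∈ Submodule.span ℂ (Set.range (mono L 0 1 (igen L m))) :=
      span_mono_igen L m h01 ▸ Submodule.mem_top
    refine Submodule.span_le.mpr ?_ hx
    rintro _ ⟨k, rfl⟩
    fin_cases k
    · exact h0
    · exact hF _ _ h0
    · exact hF _ _ h0
    · exact hF _ _ (hF _ _ h0)
    · exact hF _ _ (hF _ _ h0)
    · exact hF _ _ (hF _ _ (hF _ _ h0))
    · exact hF _ _ (hF _ _ (hF _ _ h0))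
    · exact hF _ _ (hF _ _ (hF _ _ (hF _ _ h0)))
  rw [eq_top_iff]
  intro t _
  induction t using TensorMod.induction with
  | htmul v x => exact htop x v
  | hadd s t hs ht => exact N.add_mem (hs trivial) (ht trivial)

variable (L) in
/-- The tensor product of two irreducible modules as an object of the category of weight modules. -/
noncomputable abbrev tensorIrr (l m : Wt) : WtMod L where
  carrier := TensorMod (Irr L l) (Irr L m)
  finite := inferInstanceAs (FiniteDimensional ℂ (Irr L l ⊗[ℂ] Irr L m))
  isWeightModule := (isWeightModule_irr L l).tensorMod (isWeightModule_irr L m)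

/-- The lifting problem is moved to `HomMod`. There `f` becomes a highest weight vector, a weight
vector lifting it is chosen on a weight basis of `L_l`, and `exists_isHW_lift` corrects that lift to
a highest weight vector. -/
theorem IsTypical.isProjective_tensor (hm : IsTypical m) {l : Wt} {ι : Type}
    (b : Module.Basis ι ℂ (Irr L l)) {y : ι → Wt} (hb : ∀ k, IsWt L (y k) (b k)) :
    IsProjective L (tensorIrr L l m) := by
  intro A B g f hg
  have hφ := (isHW_igen L m).curryAt f
  have hwt : ∀ k, IsWt L (m + y k) (curryAt f (igen L m) (b k)) := fun k => by
    rw [add_comm]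
    exact ((hb k).tmul (isHW_igen L m).wt).map f
  choose a ha hga using fun k => A.isWeightModule.exists_isWt_lift g hg (hwt k)
  let ψ : HomMod (Irr L l) A.carrier := b.constr ℂ a
  have hψb : ∀ k, ψ (b k) = a k := fun k => b.constr_basis ℂ a k
  have hψ : IsWt L m ψ := isWt_homMod b hb fun k => by rw [hψb]; exact ha k
  have hψφ : postcomp L g ψ = curryAt f (igen L m) := b.ext fun k => by
    refine Eq.trans ?_ (hga k)
    exact congrArg g (hψb k)
  obtain ⟨h0, h1, h2⟩ := hm.qn_ne_zero (i := 0) (j := 1) (by decide)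
  obtain ⟨χ, hχ, hχφ⟩ := exists_isHW_lift (postcomp L g) hψ hφ hψφ
    (mul_ne_zero (mul_ne_zero h0 h1) h2)
  obtain ⟨k, hk⟩ := hm.exists_tensor_lift hχ
  refine ⟨k, ?_⟩
  have key : LinearMap.eqLocus (g ∘ₗ k) f = ⊤ := by
    refine eq_top_of_forall_tmul_mem fun v => ?_
    have := congrArg (fun φ : HomMod (Irr L l) B.carrier => φ v) hχφ
    exact (congrArg g (hk v)).trans this
  exact LinearMap.eqLocus_eq_top.mp key

end TensorTypical

/-! ### The four-dimensional irreducible modules -/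

/-- The weights whose irreducible module has dimension four, being atypical for `α₃` only. -/
structure IsFourDim (i j : Fin 2) (w : Wt) : Prop where
  ne : i ≠ j
  qi : qn (w i) ≠ 0
  qj : qn (w j) ≠ 0
  qi' : qn (w i + 1) ≠ 0
  qj' : qn (w j + 1) ≠ 0
  q3 : qn (w i + w j - 1) = 0

section FourDim

variable {L : QPLattice} {i j : Fin 2} {w : Wt}

/-- The four monomials that form a basis. -/
noncomputable def four (L : QPLattice) {V : Type} [AddCommGroup V] [Module (U L) V] (i j : Fin 2)
    (v : V) : Fin 4 → V := ![v, F L i • v, F L j • v, F L j • F L i • v]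

/-- The weights of the basis. -/
def fourWt (i j : Fin 2) (w : Wt) : Fin 4 → Wt :=
  ![w, w - simpleRoot i, w - simpleRoot j, w - simpleRoot i - simpleRoot j]

theorem isWt_four {V : Type} [AddCommGroup V] [Module ℂ V] [Module (U L) V]
    [IsScalarTower ℂ (U L) V] {v : V} (h : IsWt L w v) (i j : Fin 2) (k : Fin 4) :
    IsWt L (fourWt i j w k) (four L i j v k) := by
  fin_cases k
  exacts [h, h.F i, h.F j, (h.F i).F j]

theorem IsFourDim.linearIndependent (h : IsFourDim i j w) :
    LinearIndependent ℂ (four L i j (igen L w)) := by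
  obtain ⟨a1, a1', a2, a2', -⟩ := (isHW_igen L w).fs h.ne
  obtain ⟨b1, b1', b2, b2', -⟩ := (isHW_igen L w).fs h.ne.symm
  have hv := igen_ne_zero L w
  have hi : F L i • igen L w ≠ 0 := fun h0 => smul_ne_zero h.qi hv (by rw [← a1, h0, smul_zero])
  have hj : F L j • igen L w ≠ 0 := fun h0 => smul_ne_zero h.qj hv (by rw [← b1, h0, smul_zero])
  have hji : F L j • F L i • igen L w ≠ 0 := fun h0 =>
    smul_ne_zero h.qi hj (by rw [← a2, h0, smul_zero])
  rw [Fintype.linearIndependent_iff]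
  intro c hc
  -- Padding by zeros makes the degree separation for all eight monomials applicable.
  have hc' : ∑ k, (![c 0, c 1, c 2, c 3, 0, 0, 0, 0] : Fin 8 → ℂ) k • mono L i j (igen L w) k = 0 := by
    rw [← hc]
    simp [Fin.sum_univ_eight, Fin.sum_univ_four, mono, four]
  have d0 := sum_degree_eq_zero (isHW_igen L w).wt i j hc' 0
  have d1 := sum_degree_eq_zero (isHW_igen L w).wt i j hc' 1
  have d2 := sum_degree_eq_zero (isHW_igen L w).wt i j hc' 2
  simp [Fin.sum_univ_eight, mdeg, mono, hv, hji] at d0 d1 d2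
  have c1 := congrArg (E L i • ·) d1
  have c2 := congrArg (E L j • ·) d1
  simp only [smul_add, U_smul_comm, a1, a1', b1, b1', smul_zero, csmul_smul, add_zero,
      zero_add, smul_eq_zero, hv, or_false, mul_eq_zero, h.qi, h.qj] at c1 c2
  intro k
  fin_cases k <;> assumption

/-- Atypicality makes `F_i F_j v` proportional to `F_j F_i v`, with both coefficients in the
relation nonzero. Every longer word then contains a square and vanishes. -/
theorem IsFourDim.span_eq_top (h : IsFourDim i j w) :
    Submodule.span ℂ (Set.range (four L i j (igen L w))) = ⊤ := by
  have hr := relation_of_atypical L h.ne h.q3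
  have h1 : F L i • F L j • igen L w =
      ((qn (w i))⁻¹ * qn (w i + 1)) • F L j • F L i • igen L w := by
    rw [mul_smul, ← hr, csmul_smul, inv_mul_cancel₀ h.qi, one_smul]
  have h5 : F L i • F L j • F L i • igen L w = 0 := by
    have := congrArg (F L i • ·) hr
    simp only [U_smul_comm, F_F, smul_zero] at this
    exact (smul_eq_zero.mp this.symm).resolve_left h.qi'
  have h6 : F L j • F L i • F L j • igen L w = 0 := by
    rw [h1, U_smul_comm, F_F, smul_zero]
  rw [eq_top_iff, ← span_mono_igen L w h.ne, Submodule.span_le]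
  have m : ∀ k, four L i j (igen L w) k ∈
      Submodule.span ℂ (Set.range (four L i j (igen L w))) := fun k =>
    Submodule.subset_span ⟨k, rfl⟩
  rintro _ ⟨k, rfl⟩
  fin_cases k
  · exact m 0
  · exact m 1
  · exact m 2
  · exact m 3
  · change F L i • F L j • igen L w ∈ _
    rw [h1]; exact Submodule.smul_mem _ _ (m 3)
  · change F L i • F L j • F L i • igen L w ∈ _
    rw [h5]; exact zero_mem _
  · change F L j • F L i • F L j • igen L w ∈ _
    rw [h6]; exact zero_mem _
  · change F L i • F L j • F L i • F L j • igen L w ∈ _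
    rw [h6, smul_zero]; exact zero_mem _

/-- The basis of a four-dimensional irreducible module. -/
noncomputable def IsFourDim.basis (L : QPLattice) (h : IsFourDim i j w) :
    Module.Basis (Fin 4) ℂ (Irr L w) := Module.Basis.mk h.linearIndependent h.span_eq_top.ge

theorem IsFourDim.basis_apply (h : IsFourDim i j w) (k : Fin 4) :
    h.basis L k = four L i j (igen L w) k := by simp [IsFourDim.basis]

theorem IsFourDim.finrank (h : IsFourDim i j w) : Module.finrank ℂ (Irr L w) = 4 := by
  simpa using Module.finrank_eq_card_basis (h.basis L)

end FourDim

/-! ### Homomorphisms out of the tensor product -/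

section TensorFour

variable {L : QPLattice} {i j : Fin 2} {l m : Wt}

theorem iPow_ne_zero (z : ℂ) : iPow z ≠ 0 := Complex.exp_ne_zero _

/-- The possible images, under homomorphisms, of the cyclic generator of the tensor product of a
four-dimensional and a typical irreducible module. -/
structure IsAdm (L : QPLattice) (i j : Fin 2) (l m : Wt) {A : Type} [AddCommGroup A] [Module ℂ A]
    [Module (U L) A] (a : A) : Prop where
  wt : IsWt L (l + m - simpleRoot i - simpleRoot j) a
  rel : qn (l j + 1) • E L j • E L i • a = qn (l j) • E L i • E L j • a

/-- The cyclic generator of the tensor product. -/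
noncomputable def tgen (L : QPLattice) (i j : Fin 2) (l m : Wt) : TensorMod (Irr L l) (Irr L m) :=
  TensorMod.tmul _ _ (F L j • F L i • igen L l) (igen L m)

/-- The second factor is killed by the raising operators, so they act on the first factor alone, up
to an invertible scalar. -/
theorem E_tmul_igen {V : Type} [AddCommGroup V] [Module ℂ V] [Module (U L) V]
    [IsScalarTower ℂ (U L) V] (k : Fin 2) (v : V) :
    E L k • TensorMod.tmul V (Irr L m) v (igen L m) =
      iPow (m k) • TensorMod.tmul V (Irr L m) (E L k • v) (igen L m) := by
  have h0 : TensorMod.tmul V (Irr L m) v 0 = 0 := TensorProduct.tmul_zero _ v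
  have e : form (L.sr k) m = m k := form_simpleRoot_left m k
  rw [TensorMod.X_smul_tmul, (isHW_igen L m).X, h0, add_zero, (isHW_igen L m).wt.K, e,
    TensorMod.tmul_smul]

theorem TensorMod.smul_tmul {V M : Type} [AddCommGroup V] [Module ℂ V] [AddCommGroup M] [Module ℂ M]
    (c : ℂ) (v : V) (x : M) :
    TensorMod.tmul V M (c • v) x = c • TensorMod.tmul V M v x :=
  (TensorProduct.smul_tmul' c v x).symm

/-- On `F_j F_i v`, the words `E_j E_i` and `E_i E_j` give `v` with coefficients `[l i][l j]` and
`[l i][l j + 1]`; the relation records this ratio. -/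
theorem isAdm_tgen (hij : i ≠ j) : IsAdm L i j l m (tgen L i j l m) where
  wt := by
    have := ((((isHW_igen L l).wt.F i).F j).tmul (isHW_igen L m).wt)
    rw [show l - simpleRoot i - simpleRoot j + m = l + m - simpleRoot i - simpleRoot j by abel]
      at this
    exact this
  rel := by
    obtain ⟨a1, a1', a2, a2', -⟩ := (isHW_igen L l).fs hij
    obtain ⟨b1, b1', b2, b2', -⟩ := (isHW_igen L l).fs hij.symm
    simp only [tgen, E_tmul_igen, U_smul_comm, a2, b2', TensorMod.smul_tmul, a1, b1, csmul_smul]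
    congr 1; ring

theorem IsAdm.map {A B : Type} [AddCommGroup A] [Module ℂ A] [Module (U L) A]
    [IsScalarTower ℂ (U L) A] [AddCommGroup B] [Module ℂ B] [Module (U L) B]
    [IsScalarTower ℂ (U L) B] {a : A} (h : IsAdm L i j l m a) (f : A →ₗ[U L] B) :
    IsAdm L i j l m (f a) where
  wt := h.wt.map f
  rel := by
    rw [← map_smul, ← map_smul, ← map_complex_smul, h.rel, map_complex_smul, map_smul, map_smul]

/-- `F_j F_i v` is the lowest basis vector of `L_l`. The raising operators recover the other three
from it with nonzero coefficients, and `eq_top_of_forall_tmul_mem` does the rest. -/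
theorem span_tgen (hl : IsFourDim i j l) : Submodule.span (U L) {tgen L i j l m} = ⊤ := by
  obtain ⟨a1, a1', a2, a2', -⟩ := (isHW_igen L l).fs hl.ne
  obtain ⟨b1, b1', b2, b2', -⟩ := (isHW_igen L l).fs hl.ne.symm
  set N := Submodule.span (U L) {tgen L i j l m} with hN
  have hc : ∀ (c : ℂ), c ≠ 0 → ∀ v : TensorMod (Irr L l) (Irr L m), c • v ∈ N → v ∈ N :=
    fun c hc v hv => by
      have := N.smul_mem (algebraMap ℂ (U L) c⁻¹) hv
      rwa [algebraMap_smul, csmul_smul, inv_mul_cancel₀ hc, one_smul] at this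
  have hE : ∀ k (v : Irr L l), TensorMod.tmul _ _ v (igen L m) ∈ N →
      TensorMod.tmul _ _ (E L k • v) (igen L m) ∈ N := fun k v hv => by
    have := N.smul_mem (E L k) hv
    rw [E_tmul_igen] at this
    exact hc _ (iPow_ne_zero _) _ this
  have h3 : TensorMod.tmul _ _ (F L j • F L i • igen L l) (igen L m) ∈ N :=
    Submodule.mem_span_singleton_self _
  have h2 : TensorMod.tmul _ _ (F L j • igen L l) (igen L m) ∈ N := by
    have := hE i _ h3
    rw [a2, TensorMod.smul_tmul] at this
    exact hc _ hl.qi _ this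
  have h1 : TensorMod.tmul _ _ (F L i • igen L l) (igen L m) ∈ N := by
    have := hE j _ h3
    rw [b2', TensorMod.smul_tmul] at this
    exact hc _ hl.qj' _ this
  have h0 : TensorMod.tmul _ _ (igen L l) (igen L m) ∈ N := by
    have := hE i _ h1
    rw [a1, TensorMod.smul_tmul] at this
    exact hc _ hl.qi _ this
  refine eq_top_of_forall_tmul_mem fun v => ?_
  let N' : Submodule ℂ (Irr L l) :=
    (N.restrictScalars ℂ).comap ((TensorProduct.mk ℂ (Irr L l) (Irr L m)).flip (igen L m))
  have hN' : N' = ⊤ := by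
    rw [eq_top_iff, ← hl.span_eq_top, Submodule.span_le]
    rintro _ ⟨k, rfl⟩
    fin_cases k
    exacts [h0, h1, h2, h3]
  exact (hN' ▸ Submodule.mem_top : v ∈ N')

/-- The universal property of the tensor product. -/
theorem IsAdm.exists_hom (hl : IsFourDim i j l) (hm : IsTypical m) {A : Type} [AddCommGroup A]
    [Module ℂ A] [Module (U L) A] [IsScalarTower ℂ (U L) A] {a : A} (h : IsAdm L i j l m a) :
    ∃ f : TensorMod (Irr L l) (Irr L m) →ₗ[U L] A, f (tgen L i j l m) = a := by
  obtain ⟨a1, a1', a2, a2', -⟩ := (isHW_igen L l).fs hl.ne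
  obtain ⟨b1, b1', b2, b2', -⟩ := (isHW_igen L l).fs hl.ne.symm
  have hbw : ∀ k, IsWt L (fourWt i j l k) (hl.basis L k) := fun k => by
    rw [hl.basis_apply]; exact isWt_four (isHW_igen L l).wt i j k
  -- The values forced by `φ (F_j F_i v) = a` and `φ (E_k u) = 𝐢 ^ (-m k) • E_k (φ u)`. The value on
  -- the highest weight vector is computed by climbing through `F_j v`.
  let c : Fin 4 → A := ![((qn (l i))⁻¹ * (qn (l j))⁻¹ * (iPow (m i))⁻¹ * (iPow (m j))⁻¹) •
      E L j • E L i • a, ((qn (l j + 1))⁻¹ * (iPow (m j))⁻¹) • E L j • a,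
      ((qn (l i))⁻¹ * (iPow (m i))⁻¹) • E L i • a, a]
  let φ : HomMod (Irr L l) A := (hl.basis L).constr ℂ c
  have hφ : ∀ k, φ (four L i j (igen L l) k) = c k := fun k => by
    rw [← hl.basis_apply]; exact (hl.basis L).constr_basis ℂ c k
  have hwt : IsWt L m φ := by
    refine isWt_homMod (hl.basis L) hbw fun k => ?_
    rw [hl.basis_apply, hφ]
    fin_cases k
    · have := ((h.wt.E i).E j).smul ((qn (l i))⁻¹ * (qn (l j))⁻¹ * (iPow (m i))⁻¹ * (iPow (m j))⁻¹)
      rwa [show l + m - simpleRoot i - simpleRoot j + simpleRoot i + simpleRoot j =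
        m + l by abel] at this
    · have := (h.wt.E j).smul ((qn (l j + 1))⁻¹ * (iPow (m j))⁻¹)
      rwa [show l + m - simpleRoot i - simpleRoot j + simpleRoot j =
        m + (l - simpleRoot i) by abel] at this
    · have := (h.wt.E i).smul ((qn (l i))⁻¹ * (iPow (m i))⁻¹)
      rwa [show l + m - simpleRoot i - simpleRoot j + simpleRoot i =
        m + (l - simpleRoot j) by abel] at this
    · have := h.wt
      rwa [show l + m - simpleRoot i - simpleRoot j =
        m + (l - simpleRoot i - simpleRoot j) by abel] at this
  have hφ0 : φ (igen L l) = ((qn (l i))⁻¹ * (qn (l j))⁻¹ * (iPow (m i))⁻¹ * (iPow (m j))⁻¹) •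
      E L j • E L i • a := hφ 0
  have hφ1 : φ (F L i • igen L l) = ((qn (l j + 1))⁻¹ * (iPow (m j))⁻¹) • E L j • a := hφ 1
  have hφ2 : φ (F L j • igen L l) = ((qn (l i))⁻¹ * (iPow (m i))⁻¹) • E L i • a := hφ 2
  have hφ3 : φ (F L j • F L i • igen L l) = a := hφ 3
  have n1 := hl.qi
  have n2 := hl.qj
  have n3 := hl.qj'
  have n4 := iPow_ne_zero (m i)
  have n5 := iPow_ne_zero (m j)
  -- The other way up passes through `F_i v`. Admissibility says that both ways give the same value
  -- at the top.
  have hr : E L i • E L j • a = ((qn (l j))⁻¹ * qn (l j + 1)) • E L j • E L i • a := by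
    rw [mul_smul, h.rel, csmul_smul, inv_mul_cancel₀ n2, one_smul]
  have hr0 : E L i • E L j • E L i • a = 0 := by
    have := congrArg (E L i • ·) h.rel
    simp only [U_smul_comm, E_E, smul_zero] at this
    exact (smul_eq_zero.mp this).resolve_left n3
  have hX : ∀ k, E L k • φ = 0 := fun k => (hl.basis L).ext fun n => by
    refine (hwt.hom_X_apply k _).trans ?_
    change _ = (0 : A)
    rw [hl.basis_apply]
    obtain rfl | rfl := eq_or_eq_of_ne hl.ne k
    · fin_cases n <;>
        simp only [four, Fin.zero_eta, Fin.mk_one, Fin.reduceFinMk, Matrix.cons_val, hφ0, hφ1, hφ2,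
          hφ3, (isHW_igen L l).X, a1, a1', a2, map_smul φ, map_zero φ, U_smul_comm, E_E, hr, hr0,
          csmul_smul, smul_zero, sub_zero, ← sub_smul]
      · rw [smul_eq_zero]; left; field_simp; ring
      · rw [mul_inv_cancel_left₀ n1, mul_inv_cancel₀ n4, one_smul, sub_self]
    · fin_cases n <;>
        simp only [four, Fin.zero_eta, Fin.mk_one, Fin.reduceFinMk, Matrix.cons_val, hφ0, hφ1, hφ2,
          hφ3, (isHW_igen L l).X, b1, b1', b2', map_smul φ, map_zero φ, U_smul_comm, E_E,
          csmul_smul, smul_zero, sub_zero, ← sub_smul]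
      · rw [smul_eq_zero]; left; field_simp; ring
      · rw [mul_inv_cancel_left₀ n3, mul_inv_cancel₀ n5, one_smul, sub_self]
  obtain ⟨f, hf⟩ := hm.exists_tensor_lift ⟨hwt, hX⟩
  exact ⟨f, by rw [tgen, hf, hφ3]⟩

/-! ### Simple quotients of the tensor product -/

/-- There are no nonzero homomorphisms from `X` to the irreducible module of highest weight `x`. -/
def HomZero (L : QPLattice) (X : Type) [AddCommGroup X] [Module (U L) X] (x : Wt) : Prop :=
  ∀ f : X →ₗ[U L] Irr L x, f = 0

/-- The homomorphisms from `X` to the irreducible module of highest weight `x` form a line. -/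
def HomOne (L : QPLattice) (X : Type) [AddCommGroup X] [Module (U L) X] (x : Wt) : Prop :=
  ∃ f : X →ₗ[U L] Irr L x, f ≠ 0 ∧ ∀ f' : X →ₗ[U L] Irr L x, ∃ c : ℂ, ∀ t, f' t = c • f t

theorem homZero_of_isAdm (hl : IsFourDim i j l) {x : Wt}
    (h : ∀ a : Irr L x, IsAdm L i j l m a → a = 0) :
    HomZero L (TensorMod (Irr L l) (Irr L m)) x := fun f =>
  LinearMap.ext_of_span_singleton (span_tgen hl) (h _ ((isAdm_tgen hl.ne).map f))

/-- A homomorphism is determined by the image of the cyclic generator, and every admissible vector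
is such an image. The Hom space is thus the space of admissible vectors. -/
theorem homOne_of_isAdm (hl : IsFourDim i j l) (hm : IsTypical m) {x : Wt} {a₀ : Irr L x}
    (h₀ : IsAdm L i j l m a₀) (hne : a₀ ≠ 0)
    (h : ∀ a : Irr L x, IsAdm L i j l m a → ∃ c : ℂ, a = c • a₀) :
    HomOne L (TensorMod (Irr L l) (Irr L m)) x := by
  obtain ⟨f, hf⟩ := h₀.exists_hom hl hm
  refine ⟨f, fun h0 => hne (by rw [← hf, h0]; rfl), fun f' => ?_⟩
  obtain ⟨c, hc⟩ := h _ ((isAdm_tgen hl.ne).map f')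
  refine ⟨c, fun t => ?_⟩
  obtain ⟨u, rfl⟩ := Submodule.mem_span_singleton.mp
    (span_tgen hl ▸ Submodule.mem_top : t ∈ Submodule.span (U L) {tgen L i j l m})
  rw [map_smul, map_smul, hc, hf, U_smul_comm]

/-- Only four irreducible modules can be quotients of the tensor product. -/
theorem homZero_of_ne (hl : IsFourDim i j l) {x : Wt} (h0 : l + m ≠ x)
    (h1 : l + m - simpleRoot i ≠ x) (h2 : l + m - simpleRoot j ≠ x)
    (h3 : l + m - simpleRoot i - simpleRoot j ≠ x) :
    HomZero L (TensorMod (Irr L l) (Irr L m)) x := by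
  refine homZero_of_isAdm hl fun a ha => ?_
  have hw : ∀ {y : Wt} {b : Irr L x}, IsWt L y b → E L i • b = 0 → E L j • b = 0 → y ≠ x → b = 0 :=
    fun {y b} hb hi hj hy => by
      refine IsHW.eq_zero_of_ne (x := y) ⟨hb, fun k => ?_⟩ (isHW_igen L x) (igen_ne_zero L x) hy
      obtain rfl | rfl := eq_or_eq_of_ne hl.ne k <;> assumption
  -- The raised vectors are eliminated from the top down: each is a highest weight vector as soon as
  -- those above it vanish, and its weight is not `x`. The start is `E_j E_i a`, which `E_i` kills
  -- by admissibility.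
  have hr0 : E L i • E L j • E L i • a = 0 := by
    have := congrArg (E L i • ·) ha.rel
    simp only [U_smul_comm, E_E, smul_zero] at this
    exact (smul_eq_zero.mp this).resolve_left hl.qj'
  have e1 : E L j • E L i • a = 0 := by
    refine hw ((ha.wt.E i).E j) hr0 (E_E _ _) ?_
    rwa [show l + m - simpleRoot i - simpleRoot j + simpleRoot i + simpleRoot j = l + m by abel]
  have e2 : E L i • E L j • a = 0 := by
    have := ha.rel
    rw [e1, smul_zero] at this
    exact (smul_eq_zero.mp this.symm).resolve_left hl.qj
  have e3 : E L i • a = 0 := by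
    refine hw (ha.wt.E i) (E_E _ _) e1 ?_
    rwa [show l + m - simpleRoot i - simpleRoot j + simpleRoot i = l + m - simpleRoot j by abel]
  have e4 : E L j • a = 0 := by
    refine hw (ha.wt.E j) e2 (E_E _ _) ?_
    rwa [show l + m - simpleRoot i - simpleRoot j + simpleRoot j = l + m - simpleRoot i by abel]
  exact hw ha.wt e3 e4 h3

/-- Here the admissible vectors are the highest weight vectors, for which the relation reads `0 =
0`. -/
theorem homOne_bottom (hl : IsFourDim i j l) (hm : IsTypical m) :
    HomOne L (TensorMod (Irr L l) (Irr L m)) (l + m - simpleRoot i - simpleRoot j) := by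
  have hv := isHW_igen L (l + m - simpleRoot i - simpleRoot j)
  refine homOne_of_isAdm hl hm (a₀ := igen L _) ⟨hv.wt, ?_⟩ (igen_ne_zero L _) fun a ha => ?_
  · rw [hv.X, hv.X]; simp only [smul_zero]
  · exact hv.eq_smul_of_height (mem_span_igen a) ha.wt.hU

/-- Makes the admissibility relation vacuous in degree one. -/
theorem E_E_F_smul {V : Type} [AddCommGroup V] [Module ℂ V] [Module (U L) V]
    [IsScalarTower ℂ (U L) V] {x : Wt} {v : V} (h : IsHW L x v) (a b k : Fin 2) :
    E L a • E L b • F L k • v = 0 := by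
  by_cases hbk : b = k
  · subst hbk
    rw [h.wt.E_F, h.X, smul_zero, zero_add, U_smul_comm, h.X, smul_zero]
  · rw [E_F_of_ne hbk, h.X, smul_zero, smul_zero]

theorem isAdm_middle {k k' : Fin 2} (hij : i ≠ j) (hk : k ≠ k') {x : Wt}
    (hx : x = l + m - simpleRoot k') (c : ℂ) : IsAdm L i j l m (c • F L k • igen L x) where
  wt := by
    have e : l + m - simpleRoot i - simpleRoot j = x - simpleRoot k := by
      obtain rfl | rfl := eq_or_eq_of_ne hij k <;> obtain rfl | rfl := eq_or_eq_of_ne hij k' <;>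
        first
        | exact absurd rfl hk
        | (subst hx; abel_nf)
    rw [e]
    exact ((isHW_igen L x).wt.F k).smul c
  rel := by
    simp only [U_smul_comm, E_E_F_smul (isHW_igen L x), smul_zero]

theorem IsAdm.exists_eq_of_middle {k k' : Fin 2} (hij : i ≠ j) (hk : k ≠ k') {x : Wt}
    (hx : x = l + m - simpleRoot k') {a : Irr L x} (ha : IsAdm L i j l m a) :
    ∃ c : ℂ, a = c • F L k • igen L x := by
  have e : l + m - simpleRoot i - simpleRoot j = x - simpleRoot k := by
    obtain rfl | rfl := eq_or_eq_of_ne hij k <;> obtain rfl | rfl := eq_or_eq_of_ne hij k' <;>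
      first
      | exact absurd rfl hk
      | (subst hx; abel_nf)
  exact (isHW_igen L x).eq_smul_of_isWt_sub hk (mem_span_igen a) (e ▸ ha.wt)

/-- If `[x k] = 0`, then `F_k v` is a highest weight vector of lower weight in a simple module. -/
theorem F_smul_igen_eq_zero {k : Fin 2} {x : Wt} (h : qn (x k) = 0) : F L k • igen L x = 0 := by
  refine IsHW.eq_zero_of_ne (x := x - simpleRoot k) ⟨(isHW_igen L x).wt.F k, fun a => ?_⟩
    (isHW_igen L x) (igen_ne_zero L x) fun h => ?_
  · by_cases hak : a = k
    · subst hak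
      rw [(isHW_igen L x).wt.E_F, h, zero_smul, (isHW_igen L x).X, smul_zero, zero_add]
    · rw [E_F_of_ne hak, (isHW_igen L x).X, smul_zero]
  · have := congrArg ht h
    rw [ht_sub_simpleRoot] at this
    simp at this

theorem F_smul_igen_ne_zero {k : Fin 2} {x : Wt} (h : qn (x k) ≠ 0) : F L k • igen L x ≠ 0 :=
  fun h0 => by
    have := (isHW_igen L x).wt.E_F k
    rw [h0, smul_zero, (isHW_igen L x).X, smul_zero, zero_add] at this
    exact smul_ne_zero h (igen_ne_zero L x) this.symm

/-- The admissible vectors are the multiples of `F_k v_x`, where `x k = l k + m k + 1` because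
removing `α_{k'}` raises the value at `k` by one. -/
theorem homOne_middle (hl : IsFourDim i j l) (hm : IsTypical m) {k k' : Fin 2} (hk : k ≠ k')
    (h : qn (l k + m k + 1) ≠ 0) :
    HomOne L (TensorMod (Irr L l) (Irr L m)) (l + m - simpleRoot k') := by
  have hne : F L k • igen L (l + m - simpleRoot k') ≠ 0 := by
    refine F_smul_igen_ne_zero ?_
    simpa only [Pi.sub_apply, Pi.add_apply, simpleRoot_of_ne hk.symm, sub_neg_eq_add] using h
  refine homOne_of_isAdm hl hm (isAdm_middle hl.ne hk rfl 1) (by simpa using hne) fun a ha => ?_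
  obtain ⟨c, rfl⟩ := ha.exists_eq_of_middle hl.ne hk rfl
  exact ⟨c, by rw [one_smul]⟩

theorem homZero_middle (hl : IsFourDim i j l) {k k' : Fin 2} (hk : k ≠ k')
    (h : qn (l k + m k + 1) = 0) :
    HomZero L (TensorMod (Irr L l) (Irr L m)) (l + m - simpleRoot k') := by
  refine homZero_of_isAdm hl fun a ha => ?_
  obtain ⟨c, rfl⟩ := ha.exists_eq_of_middle hl.ne hk rfl
  rw [F_smul_igen_eq_zero, smul_zero]
  simpa only [Pi.sub_apply, Pi.add_apply, simpleRoot_of_ne hk.symm, sub_neg_eq_add] using h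

/-- The condition on a combination of monomials to be admissible. -/
theorem isAdm_top_iff (hij : i ≠ j) (c d : ℂ) :
    IsAdm L i j l m (c • F L j • F L i • igen L (l + m) + d • F L i • F L j • igen L (l + m)) ↔
      c * (qn (l i + m i) * qn (m j)) = d * (qn (l j + m j) * qn (l i + m i + l j - 1)) := by
  obtain ⟨a1, a1', a2, a2', -⟩ := (isHW_igen L (l + m)).fs hij
  obtain ⟨b1, b1', b2, b2', -⟩ := (isHW_igen L (l + m)).fs hij.symm
  have hv := (isHW_igen L (l + m)).wt
  -- With `m j = (l j + m j) - l j`, the subtraction formula produces the coefficient that arises on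
  -- `F_j F_i v`; the addition formula `e2` does so for `F_i F_j v`.
  have e1 : qn (m j) = qn (l j + m j) * qn (l j + 1) - qn (l j + m j + 1) * qn (l j) := by
    rw [← qn_sub, add_sub_cancel_left]
  have e2 := qn_add_sub_one (l i + m i) (l j)
  have key : qn (l j + 1) • E L j • E L i •
        (c • F L j • F L i • igen L (l + m) + d • F L i • F L j • igen L (l + m)) -
      qn (l j) • E L i • E L j •
        (c • F L j • F L i • igen L (l + m) + d • F L i • F L j • igen L (l + m)) =
      (c * (qn (l i + m i) * qn (m j)) - d * (qn (l j + m j) * qn (l i + m i + l j - 1))) •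
        igen L (l + m) := by
    simp only [smul_add, U_smul_comm, a2, a2', b2, b2', a1, b1, csmul_smul, ← add_smul, ← sub_smul,
      Pi.add_apply]
    rw [e1, e2]
    congr 1; ring
  have hwt : IsWt L (l + m - simpleRoot i - simpleRoot j)
      (c • F L j • F L i • igen L (l + m) + d • F L i • F L j • igen L (l + m)) := by
    have h2 := (hv.F j).F i
    rw [sub_right_comm] at h2
    exact (((hv.F i).F j).smul c).add (h2.smul d)
  rw [← sub_eq_zero, ← smul_eq_zero_iff_left (igen_ne_zero L (l + m)), ← key, sub_eq_zero]
  exact ⟨fun h => h.rel, fun h => ⟨hwt, h⟩⟩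

theorem IsAdm.exists_eq_of_top (hij : i ≠ j) {a : Irr L (l + m)} (ha : IsAdm L i j l m a) :
    ∃ c d : ℂ, a = c • F L j • F L i • igen L (l + m) + d • F L i • F L j • igen L (l + m) :=
  (isHW_igen L _).eq_add_of_isWt_sub hij (mem_span_igen a) ha.wt

/-- `l i + l j - 1` is an even integer, so the argument agrees with `m i` modulo `2ℤ`. -/
theorem qn_shift_ne_zero (hl : IsFourDim i j l) (hm : IsTypical m) :
    qn (l i + m i + l j - 1) ≠ 0 := by
  obtain ⟨h1, -, -⟩ := hm.qn_ne_zero hl.ne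
  have h3 := hl.q3
  rw [Ne, qn_eq_zero_iff] at h1 ⊢
  rw [qn_eq_zero_iff] at h3
  obtain ⟨n, hn⟩ := h3
  rintro ⟨k, hk⟩
  exact h1 ⟨k - n, by push_cast; linear_combination hk - hn⟩

/-- For typical `l + m` the two degree-two monomials are independent, and admissibility is one
nontrivial linear equation on their coefficients. -/
theorem homOne_top (hl : IsFourDim i j l) (hm : IsTypical m) (h : IsTypical (l + m)) :
    HomOne L (TensorMod (Irr L l) (Irr L m)) (l + m) := by
  obtain ⟨h0, h1, h2⟩ := h.qn_ne_zero hl.ne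
  obtain ⟨-, hmj, -⟩ := hm.qn_ne_zero hl.ne
  have hs := qn_shift_ne_zero hl hm
  rw [Pi.add_apply] at h0 h1
  have hd : qn (l i + m i) * qn (m j) ≠ 0 := mul_ne_zero h0 hmj
  refine homOne_of_isAdm hl hm ((isAdm_top_iff hl.ne (qn (l j + m j) * qn (l i + m i + l j - 1))
    (qn (l i + m i) * qn (m j))).mpr (mul_comm _ _)) (fun hz => ?_) fun a ha => ?_
  · have hli := Fintype.linearIndependent_iff.mp (h.linearIndependent (L := L) hl.ne)
      ![0, 0, 0, qn (l j + m j) * qn (l i + m i + l j - 1), qn (l i + m i) * qn (m j), 0, 0, 0]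
      (by simpa [Fin.sum_univ_eight, mono] using hz) 4
    exact hd hli
  · obtain ⟨c, d, rfl⟩ := ha.exists_eq_of_top hl.ne
    have hcd := (isAdm_top_iff hl.ne c d).mp ha
    refine ⟨d * (qn (l i + m i) * qn (m j))⁻¹, ?_⟩
    rw [smul_add, csmul_smul, csmul_smul, mul_assoc, mul_assoc, inv_mul_cancel₀ hd, mul_one,
      mul_left_comm, ← hcd, mul_comm, mul_assoc, mul_inv_cancel₀ hd, mul_one]

/-- `F_i` kills the highest weight vector, so only `F_i F_j v` can survive, and the admissibility
equation makes its coefficient zero. -/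
theorem homZero_top_of_eq_zero (hl : IsFourDim i j l) (hm : IsTypical m)
    (h0 : qn (l i + m i) = 0) (h1 : qn (l j + m j) ≠ 0) :
    HomZero L (TensorMod (Irr L l) (Irr L m)) (l + m) := by
  refine homZero_of_isAdm hl fun a ha => ?_
  obtain ⟨c, d, rfl⟩ := ha.exists_eq_of_top hl.ne
  have hcd := (isAdm_top_iff hl.ne c d).mp ha
  rw [h0, zero_mul, mul_zero] at hcd
  rw [(mul_eq_zero.mp hcd.symm).resolve_right (mul_ne_zero h1 (qn_shift_ne_zero hl hm)),
    F_smul_igen_eq_zero (k := i) (by simpa using h0), smul_zero, smul_zero, zero_smul, add_zero]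

/-- The two monomials are linked by `relation_of_atypical`, and after division by `[m j]` the
admissibility equation says that their combination is zero. -/
theorem homZero_top_of_atypical (hl : IsFourDim i j l) (hm : IsTypical m)
    (h0 : qn (l i + m i) ≠ 0) (h2 : qn (l i + m i + (l j + m j) - 1) = 0) :
    HomZero L (TensorMod (Irr L l) (Irr L m)) (l + m) := by
  refine homZero_of_isAdm hl fun a ha => ?_
  obtain ⟨c, d, rfl⟩ := ha.exists_eq_of_top hl.ne
  have hcd := (isAdm_top_iff hl.ne c d).mp ha
  obtain ⟨-, hmj, -⟩ := hm.qn_ne_zero hl.ne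
  have hr := relation_of_atypical L (w := l + m) hl.ne h2
  simp only [Pi.add_apply] at hr
  have e1 : qn (m j) = qn (l j + m j) * qn (l j + 1) - qn (l j + m j + 1) * qn (l j) := by
    rw [← qn_sub, add_sub_cancel_left]
  have e2 := qn_add_sub_one (l i + m i) (l j)
  rw [qn_add_sub_one] at h2
  have h3 : c * qn (l i + m i) + d * qn (l i + m i + 1) = 0 := by
    refine (mul_eq_zero.mp ?_).resolve_right hmj
    rw [e2] at hcd
    linear_combination hcd + d * qn (l i + m i + 1) * e1 + d * qn (l j) * h2
  refine (smul_eq_zero.mp ?_).resolve_left h0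
  rw [smul_add, csmul_smul, smul_comm (qn _) d, hr, csmul_smul, ← add_smul, mul_comm _ c, h3,
    zero_smul]

end TensorFour

/-! ### Decomposition of projective modules -/

section Decomposition

variable {L : QPLattice}

/-- A proper submodule lies in a maximal one, whose quotient is some `L_y`. The hypotheses force `y
= x` and make the quotient map proportional to `π`, so this maximal submodule contains `ker π`;
hence `ker π` is superfluous. -/
theorem isProjectiveCover_of_homOne {X : WtMod L} (hX : IsProjective L X) {x : Wt}
    (h1 : HomOne L X.carrier x) (h0 : ∀ y, y ≠ x → HomZero L X.carrier y) :
    IsProjectiveCover L X x := by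
  obtain ⟨π, hπ, huniq⟩ := h1
  refine ⟨hX, π, surjective_of_ne_zero hπ, fun N hN => ?_⟩
  by_contra hne
  have : IsNoetherian (U L) X.carrier := isNoetherian_of_tower ℂ inferInstance
  obtain ⟨N', hN', hle⟩ := (eq_top_or_exists_le_coatom N).resolve_left hne
  have : IsSimpleModule (U L) (X.carrier ⧸ N') := isSimpleModule_iff_isCoatom.mpr hN'
  obtain ⟨y, ⟨e⟩⟩ := exists_equiv_irr_of_isWeightModule
    (X.isWeightModule.of_surjective N'.mkQ N'.mkQ_surjective)
  have hker : LinearMap.ker (e.toLinearMap ∘ₗ N'.mkQ) = N' := by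
    rw [LinearMap.ker_comp, LinearEquiv.ker, ← LinearMap.ker, Submodule.ker_mkQ]
  by_cases hyx : y = x
  · subst hyx
    obtain ⟨c, hc⟩ := huniq (e.toLinearMap ∘ₗ N'.mkQ)
    have hle' : LinearMap.ker π ≤ N' := fun t ht => by
      rw [← hker, LinearMap.mem_ker, hc, LinearMap.mem_ker.mp ht, smul_zero]
    exact hN'.1 (top_le_iff.mp (hN ▸ sup_le hle hle'))
  · rw [h0 y hyx (e.toLinearMap ∘ₗ N'.mkQ), LinearMap.ker_zero] at hker
    exact hN'.1 hker.symm

theorem IsProjective.of_retract {X Y : WtMod L} (hX : IsProjective L X)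
    (s : Y.carrier →ₗ[U L] X.carrier) (r : X.carrier →ₗ[U L] Y.carrier) (h : ∀ y, r (s y) = y) :
    IsProjective L Y := fun A B g f hg => by
  obtain ⟨k, hk⟩ := hX A B g (f ∘ₗ r) hg
  refine ⟨k ∘ₗ s, LinearMap.ext fun y => ?_⟩
  have := LinearMap.congr_fun hk (s y)
  simpa [h] using this

/-- A typical irreducible quotient of a weight module splits off. -/
theorem exists_split {X : WtMod L} (hX : IsProjective L X) {x : Wt} (hx : IsTypical x)
    (h1 : HomOne L X.carrier x) :
    ∃ X' : WtMod L, Nonempty (X.carrier ≃ₗ[U L] Irr L x × X'.carrier) ∧ IsProjective L X' ∧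
      Module.finrank ℂ X.carrier = 8 + Module.finrank ℂ X'.carrier ∧ HomZero L X'.carrier x ∧
      (∀ y, y ≠ x → HomOne L X.carrier y → HomOne L X'.carrier y) ∧
      ∀ y, HomZero L X.carrier y → HomZero L X'.carrier y := by
  obtain ⟨f, hf, huniq⟩ := h1
  -- The typical quotient is itself projective, so the map onto it has a section.
  obtain ⟨s, hs⟩ := hx.isProjective X (irrMod L x) f LinearMap.id (surjective_of_ne_zero hf)
  replace hs : ∀ a, f (s a) = a := LinearMap.congr_fun hs
  let pr : X.carrier →ₗ[U L] LinearMap.ker f :=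
    (LinearMap.id - s ∘ₗ f).codRestrict _ fun t => by simp [hs]
  have hpr : ∀ t, (pr t : X.carrier) = t - s (f t) := fun t => rfl
  have hprk : ∀ t : LinearMap.ker f, pr t = t := fun t => by
    ext; rw [hpr, LinearMap.mem_ker.mp t.2, map_zero, sub_zero]
  have hprs : ∀ a, pr (s a) = 0 := fun a => by
    ext; rw [hpr, hs, sub_self]; rfl
  let X' : WtMod L :=
    { carrier := LinearMap.ker f
      finite := inferInstanceAs (FiniteDimensional ℂ ((LinearMap.ker f).restrictScalars ℂ))
      isWeightModule := X.isWeightModule.of_surjective pr fun t => ⟨t, hprk t⟩ }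
  let e : X.carrier ≃ₗ[U L] Irr L x × LinearMap.ker f :=
    LinearEquiv.ofLinearMap (f.prod pr) (s.coprod (LinearMap.ker f).subtype)
      (LinearMap.ext fun t => by
        obtain ⟨a, k⟩ := t
        simp [hs, hprs, hprk, LinearMap.mem_ker.mp k.2])
      (LinearMap.ext fun t => by simp [hpr])
  have hdec : ∀ t, t = s (f t) + (pr t : X.carrier) := fun t => by rw [hpr]; abel
  refine ⟨X', ⟨e⟩, hX.of_retract (Y := X') (LinearMap.ker f).subtype pr hprk, ?_, ?_, ?_, ?_⟩
  · have : FiniteDimensional ℂ (LinearMap.ker f) := X'.finite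
    rw [← hx.finrank (L := L), (e.restrictScalars ℂ).finrank_eq]
    exact Module.finrank_prod
  · intro g
    -- A map on the kernel, extended by zero on the split copy of `L_x`, must be a multiple of `f`;
    -- evaluating on that copy shows the multiple is zero.
    obtain ⟨c, hc⟩ := huniq (g ∘ₗ pr)
    have hc0 : c = 0 := by
      have := hc (s (igen L x))
      rw [hs, LinearMap.comp_apply, hprs, map_zero] at this
      exact (smul_eq_zero.mp this.symm).resolve_right (igen_ne_zero L x)
    ext t
    have := hc t
    rw [LinearMap.comp_apply, hprk, hc0, zero_smul] at this
    exact this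
  · rintro y hy ⟨g, hg, hguniq⟩
    refine ⟨g ∘ₗ (LinearMap.ker f).subtype, fun h0 => hg (LinearMap.ext fun t => ?_), fun g' => ?_⟩
    · have h2 : g (s (f t)) = 0 := LinearMap.congr_fun (irr_hom_eq_zero hy.symm (g ∘ₗ s)) (f t)
      have h3 : g (pr t : X.carrier) = 0 := LinearMap.congr_fun h0 (pr t)
      exact (congrArg g (hdec t)).trans (by rw [map_add, h2, h3, add_zero]; rfl)
    · obtain ⟨c, hc⟩ := hguniq (g' ∘ₗ pr)
      refine ⟨c, fun t => ?_⟩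
      have := hc t
      rw [LinearMap.comp_apply, hprk] at this
      exact this
  · intro y hy g
    ext t
    have := LinearMap.congr_fun (hy (g ∘ₗ pr)) t
    rw [LinearMap.comp_apply, hprk] at this
    exact this

theorem isSumOfProjectives_cons {T T' : Type} [AddCommGroup T] [Module (U L) T] [AddCommGroup T']
    [Module (U L) T'] {P : WtMod L} {d : ℕ} {w : Wt} (hP : IsProjectiveCover L P w)
    (hd : Module.finrank ℂ P.carrier = d) (e : T ≃ₗ[U L] P.carrier × T') {l : List (ℕ × Wt)}
    (h : IsSumOfProjectives L T' l) : IsSumOfProjectives L T ((d, w) :: l) := by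
  obtain ⟨Q, hQ, ⟨e'⟩⟩ := h
  let R : Fin (l.length + 1) → WtMod L := Fin.cons P Q
  refine ⟨R, fun k => ?_, ⟨?_⟩⟩
  · refine Fin.cases ?_ (fun k => ?_) k
    · exact ⟨hP, hd⟩
    · exact hQ k
  · exact (e.trans ((LinearEquiv.refl (U L) P.carrier).prodCongr e')).trans
      (Fin.consLinearEquiv (U L) fun k => (R k).carrier)

theorem isSumOfProjectives_nil {T : Type} [AddCommGroup T] [Module (U L) T] [Subsingleton T] :
    IsSumOfProjectives L T [] :=
  ⟨fun k => k.elim0, fun k => k.elim0,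
    ⟨{ toFun := fun _ k => k.elim0
       invFun := fun _ => 0
       map_add' := fun _ _ => funext fun k => k.elim0
       map_smul' := fun _ _ => funext fun k => k.elim0
       left_inv := fun _ => Subsingleton.elim _ _
       right_inv := fun _ => funext fun k => k.elim0 }⟩⟩

/-- A projective weight module with multiplicity-free top, all of whose irreducible quotients but
one are typical, is the sum of the corresponding projective covers. -/
theorem isSumOfProjectives_of_homOne (D : List Wt) (x : Wt) (hD : (D ++ [x]).Nodup)
    (htyp : ∀ y ∈ D, IsTypical y) : ∀ (X : WtMod L), IsProjective L X →
    (∀ y ∈ D ++ [x], HomOne L X.carrier y) → (∀ y, y ∉ D ++ [x] → HomZero L X.carrier y) →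
    ∀ d, Module.finrank ℂ X.carrier = 8 * D.length + d →
    IsSumOfProjectives L X.carrier (D.map (fun y => (8, y)) ++ [(d, x)]) := by
  induction D with
  | nil =>
    intro X hX h1 h0 d hd
    refine isSumOfProjectives_cons (T' := PUnit) (isProjectiveCover_of_homOne hX (h1 x (by simp))
      fun y hy => h0 y (by simpa using hy)) (by simpa using hd) ?_ isSumOfProjectives_nil
    exact LinearEquiv.prodUnique.symm
  | cons y D ih =>
    intro X hX h1 h0 d hd
    obtain ⟨hyD, hD'⟩ := List.nodup_cons.mp hD
    have hy : IsTypical y := htyp y (by simp)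
    obtain ⟨X', ⟨e⟩, hX', hdim, hz, hone, hzero⟩ := exists_split hX hy (h1 y (by simp))
    have hne : ∀ z ∈ D ++ [x], z ≠ y := fun z hz h => hyD (h ▸ hz)
    refine isSumOfProjectives_cons (P := irrMod L y)
      (isProjectiveCover_of_homOne hy.isProjective ?_ fun z hz f => ?_) hy.finrank e
      (ih hD' (fun z hz => htyp z (by simp [hz])) X' hX'
        (fun z hz => hone z (hne z hz) (h1 z (List.mem_cons_of_mem _ hz))) (fun z hz' => ?_) d ?_)
    -- Schur's lemma for `L_y`: an endomorphism preserves the line of vectors of top height.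
    · refine ⟨LinearMap.id, fun h => igen_ne_zero L y (LinearMap.congr_fun h (igen L y)),
        fun f => ?_⟩
      have hf : IsHW L y (f (igen L y)) := (isHW_igen L y).map f
      obtain ⟨c, hc⟩ := (isHW_igen L y).eq_smul_of_height (mem_span_igen _) hf.wt.hU
      refine ⟨c, fun t => ?_⟩
      obtain ⟨u, rfl⟩ := Submodule.mem_span_singleton.mp (mem_span_igen t)
      rw [map_smul, hc, U_smul_comm]; rfl
    · exact irr_hom_eq_zero (Ne.symm hz) f
    · by_cases hzy : z = y
      · rw [hzy]; exact hz
      · exact hzero z (h0 z fun h => (List.mem_cons.mp h).elim hzy hz')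
    · rw [List.length_cons] at hd; omega

/-- The splitting argument leaves the atypical summand last, whereas one of the cases lists it
first. -/
theorem IsSumOfProjectives.rotate {T : Type} [AddCommGroup T] [Module (U L) T] {a b c : ℕ × Wt}
    (h : IsSumOfProjectives L T [a, b, c]) : IsSumOfProjectives L T [c, a, b] := by
  obtain ⟨P, hP, ⟨e⟩⟩ := h
  let σ : Fin 3 ≃ Fin 3 := (finRotate 3).symm
  let e' : ((k : Fin 3) → (P k).carrier) ≃ₗ[U L] ((k : Fin 3) → (P (σ k)).carrier) :=
    (LinearEquiv.piCongrLeft (U L) (fun k => (P k).carrier) σ).symm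
  refine ⟨fun k => P (σ k), fun k => ?_, ⟨e.trans e'⟩⟩
  have := hP (σ k)
  revert this
  change Fin 3 at k
  fin_cases k <;> exact id

end Decomposition

/-! ### The five cases -/

section Cases

variable {L : QPLattice} {i j : Fin 2} {l m : Wt}

theorem isSumOfProjectives_tensor (hl : IsFourDim i j l) (hm : IsTypical m) (D : List Wt) (x : Wt)
    (hD : (D ++ [x]).Nodup) (htyp : ∀ y ∈ D, IsTypical y)
    (h1 : ∀ y ∈ D ++ [x], HomOne L (TensorMod (Irr L l) (Irr L m)) y)
    (h0 : ∀ y, y ∉ D ++ [x] → HomZero L (TensorMod (Irr L l) (Irr L m)) y) (d : ℕ)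
    (hd : 32 = 8 * D.length + d) :
    IsSumOfProjectives L (TensorMod (Irr L l) (Irr L m)) (D.map (fun y => (8, y)) ++ [(d, x)]) := by
  refine isSumOfProjectives_of_homOne D x hD htyp (tensorIrr L l m)
    (hm.isProjective_tensor (hl.basis L) (y := fourWt i j l) fun k => ?_) h1 h0 d ?_
  · rw [hl.basis_apply]; exact isWt_four (isHW_igen L l).wt i j k
  · rw [← hd]
    refine (Module.finrank_tensorProduct (R := ℂ) (S := ℂ) (M := Irr L l) (M' := Irr L m)).trans ?_
    rw [hl.finrank, hm.finrank]

theorem qn_eq_zero_add_even {z : ℂ} (h : qn z = 0) (y : ℂ) : qn (z + y) = 0 ↔ qn y = 0 := by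
  rw [qn_eq_zero_iff] at h
  obtain ⟨n, rfl⟩ := h
  rw [qn_eq_zero_iff, qn_eq_zero_iff]
  constructor
  · rintro ⟨k, hk⟩; exact ⟨k - n, by push_cast; linear_combination hk⟩
  · rintro ⟨k, hk⟩; exact ⟨k + n, by push_cast; linear_combination hk⟩

theorem qn_sub_one_ne_zero {z : ℂ} (h : qn (z + 1) ≠ 0) : qn (z - 1) ≠ 0 := by
  rw [qn_sub_one, ← qn_add_one]; exact neg_ne_zero.mpr h

/-- Since `l k + l k' - 1` is even, typicality of this weight for `α_3` is inherited from `m`. -/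
theorem isTypical_middle (hl : IsFourDim i j l) (hm : IsTypical m) {k k' : Fin 2} (hk : k ≠ k')
    (h0 : qn (l k + m k + 1) ≠ 0) (h1 : qn (l k' + m k') ≠ 0) :
    IsTypical (l + m - simpleRoot k') := by
  have s1 := simpleRoot_self k'
  have s2 := simpleRoot_of_ne hk.symm
  refine isTypical_of_ne hk ?_ ?_ ?_
  · simpa only [Pi.sub_apply, Pi.add_apply, s2, sub_neg_eq_add] using h0
  · simpa only [Pi.sub_apply, Pi.add_apply, s1, qn_sub_two, neg_ne_zero] using h1
  · obtain ⟨-, -, h3⟩ := hm.qn_ne_zero hk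
    have e : l k + l k' - 1 = l i + l j - 1 := by
      obtain rfl | rfl := eq_or_eq_of_ne hl.ne k <;> obtain rfl | rfl := eq_or_eq_of_ne hl.ne k' <;>
        first
        | exact absurd rfl hk
        | rfl
        | rw [add_comm]
    have := (qn_eq_zero_add_even hl.q3 (m k + m k' - 1)).not.mpr h3
    rw [← e] at this
    simp only [Pi.sub_apply, Pi.add_apply, s1, s2]
    rw [show l k + m k - -1 + (l k' + m k' - 2) - 1 = l k + l k' - 1 + (m k + m k' - 1) by ring]
    exact this

theorem isTypical_bottom (hij : i ≠ j) (h0 : qn (l i + m i + 1) ≠ 0) (h1 : qn (l j + m j + 1) ≠ 0)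
    (h2 : qn (l i + m i + (l j + m j) - 1) ≠ 0) :
    IsTypical (l + m - simpleRoot i - simpleRoot j) := by
  have s1 := simpleRoot_self i
  have s2 := simpleRoot_of_ne hij.symm
  have s3 := simpleRoot_self j
  have s4 := simpleRoot_of_ne hij
  refine isTypical_of_ne hij ?_ ?_ ?_ <;> simp only [Pi.sub_apply, Pi.add_apply, s1, s2, s3, s4]
  · rw [show l i + m i - 2 - -1 = l i + m i - 1 by ring]; exact qn_sub_one_ne_zero h0
  · rw [show l j + m j - -1 - 2 = l j + m j - 1 by ring]; exact qn_sub_one_ne_zero h1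
  · rw [show l i + m i - 2 - -1 + (l j + m j - -1 - 2) - 1 = l i + m i + (l j + m j) - 1 - 2 by ring,
      qn_sub_two]
    exact neg_ne_zero.mpr h2

theorem sub_simpleRoot_ne_sub (hij : i ≠ j) (w : Wt) : w - simpleRoot i ≠ w - simpleRoot j :=
  fun h => by
    have := congrFun (sub_right_injective h) i
    rw [simpleRoot_self, simpleRoot_of_ne hij.symm] at this
    norm_num at this

theorem ne_sub_simpleRoot (w : Wt) (i : Fin 2) : w ≠ w - simpleRoot i := fun h => by
  have := congrArg ht h
  rw [ht_sub_simpleRoot] at this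
  exact one_ne_zero (α := ℂ) (by linear_combination this)

theorem ne_sub_simpleRoot_sub (w : Wt) (i j : Fin 2) : w ≠ w - simpleRoot i - simpleRoot j :=
  (sub_simpleRoot_sub_ne w i j).symm

theorem sub_simpleRoot_ne_sub_sub (w : Wt) (i j : Fin 2) :
    w - simpleRoot j ≠ w - simpleRoot i - simpleRoot j := fun h => by
  rw [sub_right_comm] at h
  exact ne_sub_simpleRoot _ _ h

/-- The top and the weight `l + m - α_i` drop out. Of the two that stay, only `l + m - α_j` is split
off, which leaves `24` dimensions for the bottom. -/
theorem case_both (hl : IsFourDim i j l) (hm : IsTypical m) (ha : qn (l i + m i) = 0)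
    (hb : qn (l j + m j + 1) = 0) :
    IsSumOfProjectives L (TensorMod (Irr L l) (Irr L m))
      [(8, l + m - simpleRoot j), (24, l + m - simpleRoot i - simpleRoot j)] := by
  have ha' := (qn_ne_zero_or (l i + m i)).resolve_left (not_not.mpr ha)
  have hb' := (qn_ne_zero_or (l j + m j)).resolve_right (not_not.mpr hb)
  refine isSumOfProjectives_tensor hl hm [l + m - simpleRoot j] _ ?_ ?_ ?_ ?_ 24 rfl
  · simp only [List.cons_append, List.nil_append, List.nodup_cons, List.mem_cons, List.not_mem_nil,
      or_false, List.nodup_nil, and_true, not_false_eq_true]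
    exact sub_simpleRoot_ne_sub_sub _ _ _
  · simpa using isTypical_middle hl hm hl.ne ha' hb'
  · simpa using ⟨homOne_middle hl hm hl.ne ha', homOne_bottom hl hm⟩
  · intro y hy
    simp only [List.cons_append, List.nil_append, List.mem_cons, List.not_mem_nil, or_false,
      not_or] at hy
    by_cases h0 : l + m = y
    · exact h0 ▸ homZero_top_of_eq_zero hl hm ha hb'
    by_cases h1 : l + m - simpleRoot i = y
    · exact h1 ▸ homZero_middle hl hl.ne.symm hb
    exact homZero_of_ne hl h0 h1 (Ne.symm hy.1) (Ne.symm hy.2)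

/-- The weight `l + m` is atypical for `α_3` and drops out. Two typical middle weights split off,
leaving `16` dimensions for the bottom. -/
theorem case_third (hl : IsFourDim i j l) (hm : IsTypical m) (ha : qn (l i + m i) ≠ 0)
    (ha' : qn (l i + m i + 1) ≠ 0) (hb : qn (l j + m j) ≠ 0) (hb' : qn (l j + m j + 1) ≠ 0)
    (hab : qn (l i + m i + (l j + m j) - 1) = 0) :
    IsSumOfProjectives L (TensorMod (Irr L l) (Irr L m))
      [(8, l + m - simpleRoot i), (8, l + m - simpleRoot j),
        (16, l + m - simpleRoot i - simpleRoot j)] := by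
  refine isSumOfProjectives_tensor hl hm [l + m - simpleRoot i, l + m - simpleRoot j] _
    ?_ ?_ ?_ ?_ 16 rfl
  · simp only [List.cons_append, List.nil_append, List.nodup_cons, List.mem_cons, List.not_mem_nil,
      or_false, not_or, List.nodup_nil, and_true, not_false_eq_true]
    exact ⟨⟨sub_simpleRoot_ne_sub hl.ne _, ne_sub_simpleRoot _ _⟩,
      sub_simpleRoot_ne_sub_sub _ _ _⟩
  · simpa using ⟨isTypical_middle hl hm hl.ne.symm hb' ha, isTypical_middle hl hm hl.ne ha' hb⟩
  · simpa using ⟨homOne_middle hl hm hl.ne.symm hb', homOne_middle hl hm hl.ne ha',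
      homOne_bottom hl hm⟩
  · intro y hy
    simp only [List.cons_append, List.nil_append, List.mem_cons, List.not_mem_nil, or_false,
      not_or] at hy
    by_cases h0 : l + m = y
    · exact h0 ▸ homZero_top_of_atypical hl hm ha hab
    exact homZero_of_ne hl h0 (Ne.symm hy.1) (Ne.symm hy.2.1) (Ne.symm hy.2.2)

/-- The top drops out and `l + m - α_i` carries the remaining `16` dimensions, so it is placed last
and moved to the front afterwards. -/
theorem case_even (hl : IsFourDim i j l) (hm : IsTypical m) (ha : qn (l i + m i) = 0)
    (hb : qn (l j + m j) ≠ 0) (hb' : qn (l j + m j + 1) ≠ 0)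
    (hab : qn (l i + m i + (l j + m j) - 1) ≠ 0) :
    IsSumOfProjectives L (TensorMod (Irr L l) (Irr L m))
      [(16, l + m - simpleRoot i), (8, l + m - simpleRoot j),
        (8, l + m - simpleRoot i - simpleRoot j)] := by
  have ha' := (qn_ne_zero_or (l i + m i)).resolve_left (not_not.mpr ha)
  refine IsSumOfProjectives.rotate (isSumOfProjectives_tensor hl hm
    [l + m - simpleRoot j, l + m - simpleRoot i - simpleRoot j] (l + m - simpleRoot i)
    ?_ ?_ ?_ ?_ 16 rfl)
  · simp only [List.cons_append, List.nil_append, List.nodup_cons, List.mem_cons, List.not_mem_nil,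
      or_false, not_or, List.nodup_nil, and_true, not_false_eq_true]
    exact ⟨⟨sub_simpleRoot_ne_sub_sub _ _ _, sub_simpleRoot_ne_sub hl.ne.symm _⟩,
      (ne_sub_simpleRoot _ _).symm⟩
  · simpa using ⟨isTypical_middle hl hm hl.ne ha' hb, isTypical_bottom hl.ne ha' hb' hab⟩
  · simpa using ⟨homOne_middle hl hm hl.ne ha', homOne_bottom hl hm,
      homOne_middle hl hm hl.ne.symm hb'⟩
  · intro y hy
    simp only [List.cons_append, List.nil_append, List.mem_cons, List.not_mem_nil, or_false,
      not_or] at hy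
    by_cases h0 : l + m = y
    · exact h0 ▸ homZero_top_of_eq_zero hl hm ha hb
    exact homZero_of_ne hl h0 (Ne.symm hy.2.2) (Ne.symm hy.1) (Ne.symm hy.2.1)

/-- Only `l + m - α_j` drops out; the top and the other middle weight are typical and split off. -/
theorem case_odd (hl : IsFourDim i j l) (hm : IsTypical m) (ha : qn (l i + m i + 1) = 0)
    (hb : qn (l j + m j) ≠ 0) (hb' : qn (l j + m j + 1) ≠ 0)
    (hab : qn (l i + m i + (l j + m j) - 1) ≠ 0) :
    IsSumOfProjectives L (TensorMod (Irr L l) (Irr L m))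
      [(8, l + m), (8, l + m - simpleRoot i), (16, l + m - simpleRoot i - simpleRoot j)] := by
  have ha' := (qn_ne_zero_or (l i + m i)).resolve_right (not_not.mpr ha)
  have ht := isTypical_of_ne (w := l + m) hl.ne ha' hb hab
  refine isSumOfProjectives_tensor hl hm [l + m, l + m - simpleRoot i] _ ?_ ?_ ?_ ?_ 16 rfl
  · simp only [List.cons_append, List.nil_append, List.nodup_cons, List.mem_cons, List.not_mem_nil,
      or_false, not_or, List.nodup_nil, and_true, not_false_eq_true]
    exact ⟨⟨ne_sub_simpleRoot _ _, ne_sub_simpleRoot_sub _ _ _⟩, ne_sub_simpleRoot _ _⟩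
  · simpa using ⟨ht, isTypical_middle hl hm hl.ne.symm hb' ha'⟩
  · simpa using ⟨homOne_top hl hm ht, homOne_middle hl hm hl.ne.symm hb', homOne_bottom hl hm⟩
  · intro y hy
    simp only [List.cons_append, List.nil_append, List.mem_cons, List.not_mem_nil, or_false,
      not_or] at hy
    by_cases h0 : l + m - simpleRoot j = y
    · exact h0 ▸ homZero_middle hl hl.ne ha
    exact homZero_of_ne hl (Ne.symm hy.1) (Ne.symm hy.2.1) h0 (Ne.symm hy.2.2)

/-- All four weights occur. With the bottom one placed last, its typicality is not needed: eight
dimensions remain for it. -/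
theorem case_generic (hl : IsFourDim i j l) (hm : IsTypical m) (ha : qn (l i + m i) ≠ 0)
    (ha' : qn (l i + m i + 1) ≠ 0) (hb : qn (l j + m j) ≠ 0) (hb' : qn (l j + m j + 1) ≠ 0)
    (hab : qn (l i + m i + (l j + m j) - 1) ≠ 0) :
    IsSumOfProjectives L (TensorMod (Irr L l) (Irr L m))
      [(8, l + m), (8, l + m - simpleRoot i), (8, l + m - simpleRoot j),
        (8, l + m - simpleRoot i - simpleRoot j)] := by
  have ht := isTypical_of_ne (w := l + m) hl.ne ha hb hab
  refine isSumOfProjectives_tensor hl hm [l + m, l + m - simpleRoot i, l + m - simpleRoot j] _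
    ?_ ?_ ?_ ?_ 8 rfl
  · simp only [List.cons_append, List.nil_append, List.nodup_cons, List.mem_cons, List.not_mem_nil,
      or_false, not_or, List.nodup_nil, and_true, not_false_eq_true]
    exact ⟨⟨ne_sub_simpleRoot _ _, ne_sub_simpleRoot _ _, ne_sub_simpleRoot_sub _ _ _⟩,
      ⟨sub_simpleRoot_ne_sub hl.ne _, ne_sub_simpleRoot _ _⟩, sub_simpleRoot_ne_sub_sub _ _ _⟩
  · simpa using ⟨ht, isTypical_middle hl hm hl.ne.symm hb' ha, isTypical_middle hl hm hl.ne ha' hb⟩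
  · simpa using ⟨homOne_top hl hm ht, homOne_middle hl hm hl.ne.symm hb',
      homOne_middle hl hm hl.ne ha', homOne_bottom hl hm⟩
  · intro y hy
    simp only [List.cons_append, List.nil_append, List.mem_cons, List.not_mem_nil, or_false,
      not_or] at hy
    exact homZero_of_ne hl (Ne.symm hy.1) (Ne.symm hy.2.1) (Ne.symm hy.2.2.1) (Ne.symm hy.2.2.2)

end Cases

/-! ### Arithmetic of the indices -/

theorem IsEven.isInt {z : ℂ} (h : IsEven z) : IsInt z := by
  obtain ⟨n, rfl⟩ := h; exact ⟨2 * n, by push_cast; rfl⟩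

theorem IsOdd.isInt {z : ℂ} (h : IsOdd z) : IsInt z := by
  obtain ⟨n, rfl⟩ := h; exact ⟨2 * n + 1, by push_cast; rfl⟩

theorem IsInt.isEven_or_isOdd {z : ℂ} (h : IsInt z) : IsEven z ∨ IsOdd z := by
  obtain ⟨n, rfl⟩ := h
  obtain ⟨k, rfl⟩ | ⟨k, rfl⟩ := Int.even_or_odd n
  · exact Or.inl ⟨k, by push_cast; ring⟩
  · exact Or.inr ⟨k, by push_cast; ring⟩

theorem IsInt.sub {y z : ℂ} (hy : IsInt y) (hz : IsInt z) : IsInt (y - z) := by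
  obtain ⟨a, rfl⟩ := hy; obtain ⟨b, rfl⟩ := hz; exact ⟨a - b, by push_cast; rfl⟩

theorem IsOdd.sub_isEven {y z : ℂ} (hy : IsOdd y) (hz : IsEven z) : IsOdd (y - z) := by
  obtain ⟨a, rfl⟩ := hy; obtain ⟨b, rfl⟩ := hz; exact ⟨a - b, by push_cast; ring⟩

theorem IsOdd.add_isEven {y z : ℂ} (hy : IsOdd y) (hz : IsEven z) : IsOdd (y + z) := by
  obtain ⟨a, rfl⟩ := hy; obtain ⟨b, rfl⟩ := hz; exact ⟨a + b, by push_cast; ring⟩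

theorem IsOdd.sub_isOdd {y z : ℂ} (hy : IsOdd y) (hz : IsOdd z) : IsEven (y - z) := by
  obtain ⟨a, rfl⟩ := hy; obtain ⟨b, rfl⟩ := hz; exact ⟨a - b, by push_cast; ring⟩

theorem isEven_add_two_iff (z : ℂ) : IsEven (z + 2) ↔ qn z = 0 := by
  rw [qn_eq_zero_iff]
  constructor
  · rintro ⟨n, hn⟩; exact ⟨n - 1, by push_cast; linear_combination hn⟩
  · rintro ⟨n, hn⟩; exact ⟨n + 1, by push_cast; linear_combination hn⟩

theorem isOdd_add_two_iff (z : ℂ) : IsOdd (z + 2) ↔ qn (z + 1) = 0 := by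
  rw [← isEven_add_two_iff]
  constructor
  · rintro ⟨n, hn⟩; exact ⟨n + 1, by push_cast; linear_combination hn⟩
  · rintro ⟨n, hn⟩; exact ⟨n - 1, by push_cast; linear_combination hn⟩

theorem qn_ne_zero_of_not_isInt {z : ℂ} (h : ¬ IsInt (z + 2)) : qn z ≠ 0 ∧ qn (z + 1) ≠ 0 :=
  ⟨fun h' => h ((isEven_add_two_iff z).mpr h').isInt,
    fun h' => h ((isOdd_add_two_iff z).mpr h').isInt⟩

theorem index_castSucc (w : Wt) (i : Fin 2) : index w i.castSucc = w i + 1 := by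
  fin_cases i
  · exact index_zero w
  · exact index_one w

theorem index_add_index (v w : Wt) (i : Fin 2) :
    index v i.castSucc + index w i.castSucc = v i + w i + 2 := by
  rw [index_castSucc, index_castSucc]; ring

theorem root_castSucc (i : Fin 2) : root i.castSucc = simpleRoot i := by
  fin_cases i <;> rfl

theorem sub_root_two {i j : Fin 2} (hij : i ≠ j) (w : Wt) :
    w - root 2 = w - simpleRoot i - simpleRoot j := by
  change w - (simpleRoot 0 + simpleRoot 1) = _
  rw [sub_sub]
  fin_cases i <;> fin_cases j
  · exact absurd rfl hij
  · rfl
  · rw [add_comm]; rfl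
  · exact absurd rfl hij

theorem index_two_of_ne {i j : Fin 2} (hij : i ≠ j) (w : Wt) : index w 2 = w i + w j + 2 := by
  rw [index_two]
  fin_cases i <;> fin_cases j
  · exact absurd rfl hij
  · rfl
  · rw [add_comm (w 0)]; rfl
  · exact absurd rfl hij

theorem exists_castSucc_of_pair_eq {i j : Fin 3} (h : ({i, j} : Set (Fin 3)) = {0, 1}) :
    ∃ a b : Fin 2, a ≠ b ∧ i = a.castSucc ∧ j = b.castSucc := by
  obtain ⟨rfl, rfl⟩ | ⟨rfl, rfl⟩ := Set.pair_eq_pair_iff.mp h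
  · exact ⟨0, 1, by decide, rfl, rfl⟩
  · exact ⟨1, 0, by decide, rfl, rfl⟩

theorem isFourDim_of_index {i j : Fin 2} (hij : i ≠ j) {w : Wt} (hi : ¬ IsInt (index w i.castSucc))
    (hj : ¬ IsInt (index w j.castSucc)) (h3 : IsOdd (index w 2)) : IsFourDim i j w := by
  have key : ∀ k : Fin 2, ¬ IsInt (index w k.castSucc) → qn (w k) ≠ 0 ∧ qn (w k + 1) ≠ 0 := by
    intro k hk
    refine qn_ne_zero_of_not_isInt fun ⟨n, hn⟩ => hk ⟨n - 1, ?_⟩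
    rw [index_castSucc]; push_cast; linear_combination hn
  refine ⟨hij, (key i hi).1, (key j hj).1, (key i hi).2, (key j hj).2, ?_⟩
  rw [index_two_of_ne hij] at h3
  obtain ⟨n, hn⟩ := h3
  exact (qn_eq_zero_iff _).mpr ⟨n - 1, by push_cast; linear_combination hn⟩

/-- As `v i + v j - 1` is even, atypicality of `v + w` for `α_3` depends only on the third index of
`w`. This is why `μ_3` governs the cases. -/
theorem IsFourDim.isEven_index_two_iff {i j : Fin 2} {v w : Wt} (h : IsFourDim i j v) :
    IsEven (index w 2) ↔ qn (v i + w i + (v j + w j) - 1) = 0 := by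
  rw [show v i + w i + (v j + w j) - 1 = v i + v j - 1 + (w i + w j) by ring,
    qn_eq_zero_add_even h.q3, index_two_of_ne h.ne, isEven_add_two_iff]

end UnrolledSL3

/-! ### The five decompositions and their exhaustiveness. -/

theorem mainTheorem7 (L : QPLattice) (lam mu : Wt)
    (h1 : ¬ IsInt (index lam 0)) (h2 : ¬ IsInt (index lam 1)) (h3 : IsOdd (index lam 2))
    (hmu : IsTypical mu) :
    -- the dimensions of the two irreducible modules
    (Module.finrank ℂ (Irr L lam) = 4 ∧ Module.finrank ℂ (Irr L mu) = 8) ∧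
    -- the decompositions in the five cases
    (∀ i j : Fin 3, ({i, j} : Set (Fin 3)) = {0, 1} →
      IsEven (index lam i + index mu i) → IsEven (index mu 2) →
      IsOdd (index lam j + index mu j) →
        IsSumOfProjectives L (TensorMod (Irr L lam) (Irr L mu))
          [(8, lam + mu - root j), (24, lam + mu - root 2)]) ∧
    (IsEven (index mu 2) → ¬ IsInt (index lam 0 + index mu 0) →
      ¬ IsInt (index lam 1 + index mu 1) →
        IsSumOfProjectives L (TensorMod (Irr L lam) (Irr L mu))
          [(8, lam + mu - root 0), (8, lam + mu - root 1), (16, lam + mu - root 2)]) ∧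
    (∀ i j : Fin 3, ({i, j} : Set (Fin 3)) = {0, 1} →
      IsEven (index lam i + index mu i) → ¬ IsInt (index lam j + index mu j) →
      ¬ IsInt (index mu 2) →
        IsSumOfProjectives L (TensorMod (Irr L lam) (Irr L mu))
          [(16, lam + mu - root i), (8, lam + mu - root j), (8, lam + mu - root 2)]) ∧
    (∀ i j : Fin 3, ({i, j} : Set (Fin 3)) = {0, 1} →
      IsOdd (index lam i + index mu i) → ¬ IsInt (index lam j + index mu j) →
      ¬ IsInt (index mu 2) →
        IsSumOfProjectives L (TensorMod (Irr L lam) (Irr L mu))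
          [(8, lam + mu), (8, lam + mu - root i), (16, lam + mu - root 2)]) ∧
    (¬ IsInt (index lam 0 + index mu 0) → ¬ IsInt (index lam 1 + index mu 1) →
      ¬ IsInt (index mu 2) →
        IsSumOfProjectives L (TensorMod (Irr L lam) (Irr L mu))
          [(8, lam + mu), (8, lam + mu - root 0), (8, lam + mu - root 1),
            (8, lam + mu - root 2)]) ∧
    -- one of the five cases always applies
    (∃ i j : Fin 3, ({i, j} : Set (Fin 3)) = {0, 1} ∧
      ((IsEven (index lam i + index mu i) ∧ IsEven (index mu 2) ∧
          IsOdd (index lam j + index mu j)) ∨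
        (IsEven (index mu 2) ∧ ¬ IsInt (index lam 0 + index mu 0) ∧
          ¬ IsInt (index lam 1 + index mu 1)) ∨
        (IsEven (index lam i + index mu i) ∧ ¬ IsInt (index lam j + index mu j) ∧
          ¬ IsInt (index mu 2)) ∨
        (IsOdd (index lam i + index mu i) ∧ ¬ IsInt (index lam j + index mu j) ∧
          ¬ IsInt (index mu 2)) ∨
        (¬ IsInt (index lam 0 + index mu 0) ∧ ¬ IsInt (index lam 1 + index mu 1) ∧
          ¬ IsInt (index mu 2)))) := by
  have hidx : ∀ k : Fin 2, ¬ IsInt (index lam k.castSucc) := by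
    intro k
    fin_cases k
    · exact h1
    · exact h2
  have hl : ∀ {a b : Fin 2}, a ≠ b → IsFourDim a b lam := fun h =>
    isFourDim_of_index h (hidx _) (hidx _) h3
  have h01 : (0 : Fin 2) ≠ 1 := by decide
  have e0 : index lam 0 + index mu 0 = lam 0 + mu 0 + 2 := index_add_index lam mu 0
  have e1 : index lam 1 + index mu 1 = lam 1 + mu 1 + 2 := index_add_index lam mu 1
  have h3' : ∀ {a b : Fin 2}, a ≠ b → ¬ IsInt (index mu 2) →
      qn (lam a + mu a + (lam b + mu b) - 1) ≠ 0 := fun h hn h0 =>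
    hn ((hl h).isEven_index_two_iff.mpr h0).isInt
  refine ⟨⟨(hl h01).finrank, hmu.finrank⟩, ?_, ?_, ?_, ?_, ?_, ?_⟩
  · intro i j hij hi _ hj
    obtain ⟨a, b, hab, rfl, rfl⟩ := exists_castSucc_of_pair_eq hij
    rw [index_add_index, isEven_add_two_iff] at hi
    rw [index_add_index, isOdd_add_two_iff] at hj
    rw [root_castSucc, sub_root_two hab]
    exact case_both (hl hab) hmu hi hj
  · intro he h0 h1
    rw [e0] at h0
    rw [e1] at h1
    obtain ⟨h0, h0'⟩ := qn_ne_zero_of_not_isInt h0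
    obtain ⟨h1, h1'⟩ := qn_ne_zero_of_not_isInt h1
    rw [sub_root_two h01]
    exact case_third (hl h01) hmu h0 h0' h1 h1' ((hl h01).isEven_index_two_iff.mp he)
  · intro i j hij hi hj hn
    obtain ⟨a, b, hab, rfl, rfl⟩ := exists_castSucc_of_pair_eq hij
    rw [index_add_index, isEven_add_two_iff] at hi
    rw [index_add_index] at hj
    obtain ⟨hj, hj'⟩ := qn_ne_zero_of_not_isInt hj
    rw [root_castSucc, root_castSucc, sub_root_two hab]
    exact case_even (hl hab) hmu hi hj hj' (h3' hab hn)
  · intro i j hij hi hj hn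
    obtain ⟨a, b, hab, rfl, rfl⟩ := exists_castSucc_of_pair_eq hij
    rw [index_add_index, isOdd_add_two_iff] at hi
    rw [index_add_index] at hj
    obtain ⟨hj, hj'⟩ := qn_ne_zero_of_not_isInt hj
    rw [root_castSucc, sub_root_two hab]
    exact case_odd (hl hab) hmu hi hj hj' (h3' hab hn)
  · intro h0 h1 hn
    rw [e0] at h0
    rw [e1] at h1
    obtain ⟨h0, h0'⟩ := qn_ne_zero_of_not_isInt h0
    obtain ⟨h1, h1'⟩ := qn_ne_zero_of_not_isInt h1
    rw [sub_root_two h01]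
    exact case_generic (hl h01) hmu h0 h0' h1 h1' (h3' h01 hn)
  -- Exhaustiveness rests on this identity: the two sums add up to `λ_3 + μ_3`, where `λ_3` is odd.
  · have hsum : index lam 0 + index mu 0 + (index lam 1 + index mu 1) =
        index lam 2 + index mu 2 := by
      rw [e0, e1, index_two, index_two]; ring
    have hs : index lam 0 + index mu 0 =
        index lam 2 + index mu 2 - (index lam 1 + index mu 1) := by linear_combination hsum
    have ht : index lam 1 + index mu 1 =
        index lam 2 + index mu 2 - (index lam 0 + index mu 0) := by linear_combination hsum
    have hpair : ({1, 0} : Set (Fin 3)) = {0, 1} := Set.pair_comm 1 0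
    by_cases hn : IsInt (index mu 2)
    -- Typicality makes an integral `μ_3` even, so the total is odd: either both sums are integers
    -- of opposite parity, or neither is an integer.
    · have he := hn.isEven_or_isOdd.resolve_right (hmu 2)
      have hodd := h3.add_isEven he
      by_cases hi : IsInt (index lam 0 + index mu 0)
      · obtain hi | hi := hi.isEven_or_isOdd
        · exact ⟨0, 1, rfl, Or.inl ⟨hi, he, ht ▸ hodd.sub_isEven hi⟩⟩
        · exact ⟨1, 0, hpair, Or.inl ⟨ht ▸ hodd.sub_isOdd hi, he, hi⟩⟩
      · exact ⟨0, 1, rfl, Or.inr (Or.inl ⟨he, hi, fun h => hi (hs ▸ hodd.isInt.sub h)⟩)⟩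
    -- If both sums were integers, `μ_3` would be one as well.
    · have hne : IsInt (index lam 0 + index mu 0) → ¬ IsInt (index lam 1 + index mu 1) :=
        fun h h' => hn (by
          have := (h.sub (h3.isInt.sub h'))
          rwa [show index lam 0 + index mu 0 - (index lam 2 - (index lam 1 + index mu 1)) =
            index mu 2 by linear_combination hsum] at this)
      by_cases hi : IsInt (index lam 0 + index mu 0)
      · obtain hi' | hi' := hi.isEven_or_isOdd
        · exact ⟨0, 1, rfl, Or.inr (Or.inr (Or.inl ⟨hi', hne hi, hn⟩))⟩
        · exact ⟨0, 1, rfl, Or.inr (Or.inr (Or.inr (Or.inl ⟨hi', hne hi, hn⟩)))⟩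
      · by_cases hj : IsInt (index lam 1 + index mu 1)
        · obtain hj' | hj' := hj.isEven_or_isOdd
          · exact ⟨1, 0, hpair, Or.inr (Or.inr (Or.inl ⟨hj', hi, hn⟩))⟩
          · exact ⟨1, 0, hpair, Or.inr (Or.inr (Or.inr (Or.inl ⟨hj', hi, hn⟩)))⟩
        · exact ⟨0, 1, rfl, Or.inr (Or.inr (Or.inr (Or.inr ⟨hi, hj, hn⟩)))⟩
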